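/- Let $k$ be a field of characteristic $0$. For a finite set $A$ let $\mathrm{Gerst}^\vee(A)$ be the graded commutative algebra generated by elements $w_{ij}=w_{ji}$ ($i\neq j$ in $A$) of degree $1$, subject to $w_{ij}w_{jl}+w_{jl}w_{li}+w_{li}w_{ij}=0$ for distinct $i,j,l$. Let $\frac{\partial}{\partial w}$ be its odd derivation with $w_{ij}\mapsto 1$ for all $i,j$. For a splitting $A=I\sqcup J$, the cocomposition $\mathrm{Gerst}^\vee(A)\to \mathrm{Gerst}^\vee(I\sqcup\{*\})\otimes \mathrm{Gerst}^\vee(J)$, $f\mapsto f^I\otimes f^J$ (a sum of such terms), is the morphism of graded algebras with $w_{ij}\mapsto w_{ij}\otimes 1$ if $i,j\in I$, $w_{ij}\mapsto w_{i*}\otimes 1$ if $i\in I$, $j\in J$, and $w_{ij}\mapsto 1\otimes w_{ij}$ if $i,j\in J$. Let $\mathrm{Bar}=\mathrm{Bar}(k[u]\otimes s^2\mathrm{Gerst}^\vee)$ be the free graded operad generated by the spaces $k[u]\otimes \mathrm{Gerst}^\vee(A)$, $|A|\ge 2$, where the generator (corolla with set of inputs $A$) $\frac{u^m}{m!}f$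 has degree $3-2|A|-2m+\deg f$ (so $u$ is even of degree $-2$). Let $d=\frac{\partial}{\partial u}\frac{\partial}{\partial w}+\mu$ be the derivation of degree $1$ of this operad given on generators by $$d\Big(\frac{u^m}{m!}f\Big)=\frac{u^{m-1}}{(m-1)!}\frac{\partial f}{\partial w}+\sum_{\substack{I\sqcup J=A,\ |I|\ge1,\ |J|\ge2\\ a+b=m}}(-1)^{\deg f^I}\,\frac{u^a}{a!}f^I\circ_*\frac{u^b}{b!}f^J ,$$ where the first term is $0$ for $m=0$. For $n\ge 1$ let $\zeta_n\colon \mathrm{Bar}(n-1)\to \mathrm{Bar}(n)$ be the derivation of even parity that adds a new input, labelled $n$ (it is compatible with relabellings of the old inputs, satisfies the Leibniz rule for operadic compositions, and kills the operadic unit), and that is given on a corolla with set of inputs $A$ by $\zeta_n=\iota_n+\sum_{s\in A}\varsigma_{sn}+\varsigma_{0n}$, where $$\iota_n\Big(\frac{u^m}{m!}f\Big)=\frac{u^m}{m!}f,\ \text{ regarded as a corolla with set of inputs } A\sqcup\{n\},$$ $$\varsigma_{sn}\Big(\frac{u^m}{m!}f\Big)=\sum_{a+b=m}\frac{u^a}{a!}f|_{s\to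 *}\circ_*\frac{u^{b+1}}{(b+1)!}w_{sn}\quad(s\in A),$$ $$\varsigma_{0n}\Big(\frac{u^m}{m!}f\Big)=-\sum_{a+b=m}\frac{u^{b+1}}{(b+1)!}w_{*n}\circ_*\frac{u^a}{a!}f .$$ When the corolla is a vertex of a tree, $A$ consists of all inputs of that vertex, whether they are inputs of the tree or internal edges. Let $\mathrm{Grav}^\vee(A)=\mathrm{Gerst}^\vee(A)/\operatorname{Im}\frac{\partial}{\partial w}$, and let $\varepsilon\colon\mathrm{Bar}\to\mathrm{Bar}(\mathrm{Grav}^\vee)$ be the morphism to the free operad generated by the spaces $\mathrm{Grav}^\vee(A)$, $|A|\ge 2$ (with the class of $f$ in parity $1+\deg f$), that is induced by $u\mapsto0$ and $f\mapsto[f]$. Let $\mathrm{Hycomm}$ be the operad generated by one even symmetric operation $m_n$ of arity $n$ for each $n\ge2$ subject to $$\sum_{S_1\sqcup S_2=S} m(m(a,b,x_{S_1}),c,x_{S_2})=\sum_{S_1\sqcup S_2=S} m(a,m(b,c,x_{S_1}),x_{S_2}),$$ and let $\kappa\colon \mathrm{Bar}(\mathrm{Grav}^\vee)\to\mathrm{Hycomm}$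 be the morphism of operads that sends the generator $[w_{ij}]$ of arity $n$ to $m_n$ and the generators $[f]$ with $\deg f\ne1$ to $0$. Then: 1. For every $n\ge1$ the map $\zeta_n$ is a chain map of degree $-2$: $\zeta_n d=d\,\zeta_n$ on $\mathrm{Bar}(n-1)$, and $\zeta_n$ sends elements of degree $r$ to elements of degree $r-2$ for every $r\in\mathbb Z$. 2. Put $\nu_2=w_{12}$ and $\nu_{i+1}=\zeta_{i+1}(\nu_i)$ for $i\ge2$. Then for all $n\ge2$ the element $\nu_n\in\mathrm{Bar}(n)$ is a cocycle that represents the generator $m_n$ of $\mathrm{Hycomm}$: the composite $\kappa\varepsilon$ is a chain map to $\mathrm{Hycomm}$ with zero differential, that is, $\kappa\varepsilon d=0$ on $\mathrm{Bar}(n)$ for every $n\ge 0$, and $$d\,\nu_n=0,\qquad \kappa(\varepsilon(\nu_n))=m_n .$$ -/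

import Mathlib

open scoped TensorProduct Polynomial

universe u v w

namespace CobarHycom

/-! ### Relabellings -/

/-- `I ⊔ (J ⊔ {*}) ≃ (I ⊔ J) ⊔ {*}`. -/
def sumOption (I J : Type) : I ⊕ Option J ≃ Option (I ⊕ J) where
  toFun
    | .inl i => some (.inl i)
    | .inr (some j) => some (.inr j)
    | .inr none => none
  invFun
    | some (.inl i) => .inl i
    | some (.inr j) => .inr (some j)
    | none => .inr none
  left_inv := by rintro (i | _ | j) <;> rfl
  right_inv := by rintro (_ | i | j) <;> rfl

/-- `(I ⊔ {*}) ⊔ J ≃ (I ⊔ J) ⊔ {*}`. -/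
def optionSum (I J : Type) : Option I ⊕ J ≃ Option (I ⊕ J) where
  toFun
    | .inl (some i) => some (.inl i)
    | .inl none => none
    | .inr j => some (.inr j)
  invFun
    | some (.inl i) => .inl (some i)
    | some (.inr j) => .inr j
    | none => .inl none
  left_inv := by rintro ((_ | i) | j) <;> rfl
  right_inv := by rintro (_ | i | j) <;> rfl

/-- The exchange of the two extra labels of `(I ⊔ {*}) ⊔ {*'}`. -/
def optionSwap (I : Type) : Option (Option I) ≃ Option (Option I) where
  toFun
    | none => some none
    | some none => none
    | some (some i) => some (some i)
  invFun
    | none => some none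
    | some none => none
    | some (some i) => some (some i)
  left_inv := by rintro (_ | _ | i) <;> rfl
  right_inv := by rintro (_ | _ | i) <;> rfl

/-- `(I ⊔ K) ⊔ J ≃ (I ⊔ J) ⊔ K`. -/
def sumSwap (I K J : Type) : (I ⊕ K) ⊕ J ≃ (I ⊕ J) ⊕ K where
  toFun
    | .inl (.inl i) => .inl (.inl i)
    | .inl (.inr k) => .inr k
    | .inr j => .inl (.inr j)
  invFun
    | .inl (.inl i) => .inl (.inl i)
    | .inr k => .inl (.inr k)
    | .inl (.inr j) => .inr j
  left_inv := by rintro ((i | k) | j) <;> rfl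
  right_inv := by rintro ((i | j) | k) <;> rfl

/-- `I ⊔ {pt} ≃ I ⊔ {*}`. -/
def sumUnit (I : Type) : I ⊕ Unit ≃ Option I := (Equiv.optionEquivSumPUnit I).symm

/-- `{pt} ≃ ∅ ⊔ {*}`. -/
def unitOption : Unit ≃ Option Empty where
  toFun _ := none
  invFun _ := ()
  left_inv _ := rfl
  right_inv := by rintro (_ | e); rfl; exact e.elim

/-! ### Super species and super operads -/

/-- A linear species (functor on sets and bijections) with values in super vector spaces over a
field of characteristic zero.  The `ℤ/2`-grading is recorded by the involution `sgn`, which is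
`1` on even and `-1` on odd elements. -/
structure SuperSpecies (k : Type u) [Field k] where
  obj : Type → Type v
  [acg : ∀ A, AddCommGroup (obj A)]
  [mod : ∀ A, Module k (obj A)]
  map : ∀ {A B : Type}, A ≃ B → obj A →ₗ[k] obj B
  map_refl : ∀ {A : Type} (x : obj A), map (Equiv.refl A) x = x
  map_trans : ∀ {A B C : Type} (σ : A ≃ B) (τ : B ≃ C) (x : obj A),
    map τ (map σ x) = map (σ.trans τ) x
  sgn : ∀ {A : Type}, obj A →ₗ[k] obj A
  sgn_sgn : ∀ {A : Type} (x : obj A), sgn (sgn x) = x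
  sgn_map : ∀ {A B : Type} (σ : A ≃ B) (x : obj A), sgn (map σ x) = map σ (sgn x)

attribute [instance] SuperSpecies.acg SuperSpecies.mod

/-- A (unital, symmetric) operad in super vector spaces, given by its partial compositions
`∘_* : P(I ⊔ {*}) ⊗ P(J) → P(I ⊔ J)`; the operation at the root is written first. -/
structure SuperOperad (k : Type u) [Field k] extends SuperSpecies.{u, v} k where
  one : obj Unit
  comp : ∀ {I J : Type}, obj (Option I) →ₗ[k] obj J →ₗ[k] obj (I ⊕ J)
  sgn_one : sgn one = one
  sgn_comp : ∀ {I J : Type} (x : obj (Option I)) (y : obj J),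
    sgn (comp x y) = comp (sgn x) (sgn y)
  comp_map : ∀ {I J I' J' : Type} (σ : I ≃ I') (τ : J ≃ J') (x : obj (Option I)) (y : obj J),
    comp (map (Equiv.optionCongr σ) x) (map τ y) = map (Equiv.sumCongr σ τ) (comp x y)
  comp_one : ∀ {I : Type} (x : obj (Option I)), map (sumUnit I) (comp x one) = x
  one_comp : ∀ {J : Type} (y : obj J),
    map (Equiv.emptySum Empty J) (comp (map unitOption one) y) = y
  comp_assoc : ∀ {I J K : Type} (x : obj (Option I)) (y : obj (Option J)) (z : obj K),
    comp (map (sumOption I J) (comp x y)) z = map (Equiv.sumAssoc I J K).symm (comp x (comp y z))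
  comp_parallel : ∀ {I J K : Type} (q r : ℕ) (x : obj (Option (Option I))) (y : obj J) (z : obj K),
    sgn y = (-1 : k) ^ q • y → sgn z = (-1 : k) ^ r • z →
    comp (map (optionSum I J) (comp x y)) z =
      (-1 : k) ^ (q * r) • map (sumSwap I K J)
        (comp (map (optionSum I K) (comp (map (optionSwap I) x) z)) y)

/-! ### Operads presented by generators and relations -/

section Presented

variable {k : Type u} [Field k]

/-- Formal expressions in generators from the components of `V` with at least two inputs. -/
inductive Term (V : SuperSpecies.{u, v} k) : Type → Type (max 1 u v)
  | zero {A : Type} : Term V A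
  | add {A : Type} : Term V A → Term V A → Term V A
  | smul {A : Type} : k → Term V A → Term V A
  | map {A B : Type} : A ≃ B → Term V A → Term V B
  | sgn {A : Type} : Term V A → Term V A
  | one : Term V Unit
  | comp {I J : Type} : Term V (Option I) → Term V J → Term V (I ⊕ J)
  | gen {A : Type} : 2 ≤ Nat.card A → V.obj A → Term V A

/-- The congruence on expressions generated by the axioms of a super operad, by the structure of
super species of `V`, and by the relations `X`. -/
inductive Rel (V : SuperSpecies.{u, v} k) (X : ∀ A : Type, Term V A → Prop) :
    ∀ {A : Type}, Term V A → Term V A → Prop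
  | refl {A : Type} (s : Term V A) : Rel V X s s
  | symm {A : Type} {s t : Term V A} : Rel V X s t → Rel V X t s
  | trans {A : Type} {r s t : Term V A} : Rel V X r s → Rel V X s t → Rel V X r t
  | add_congr {A : Type} {s s' t t' : Term V A} :
      Rel V X s s' → Rel V X t t' → Rel V X (.add s t) (.add s' t')
  | smul_congr {A : Type} (c : k) {s s' : Term V A} :
      Rel V X s s' → Rel V X (.smul c s) (.smul c s')
  | map_congr {A B : Type} (σ : A ≃ B) {s s' : Term V A} :
      Rel V X s s' → Rel V X (.map σ s) (.map σ s')
  | sgn_congr {A : Type} {s s' : Term V A} : Rel V X s s' → Rel V X (.sgn s) (.sgn s')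
  | comp_congr {I J : Type} {s s' : Term V (Option I)} {t t' : Term V J} :
      Rel V X s s' → Rel V X t t' → Rel V X (.comp s t) (.comp s' t')
  | add_comm {A : Type} (s t : Term V A) : Rel V X (.add s t) (.add t s)
  | add_assoc {A : Type} (r s t : Term V A) :
      Rel V X (.add (.add r s) t) (.add r (.add s t))
  | zero_add {A : Type} (s : Term V A) : Rel V X (.add .zero s) s
  | neg_add {A : Type} (s : Term V A) : Rel V X (.add (.smul (-1) s) s) .zero
  | one_smul {A : Type} (s : Term V A) : Rel V X (.smul 1 s) s
  | mul_smul {A : Type} (c d : k) (s : Term V A) : Rel V X (.smul (c * d) s) (.smul c (.smul d s))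
  | smul_add {A : Type} (c : k) (s t : Term V A) :
      Rel V X (.smul c (.add s t)) (.add (.smul c s) (.smul c t))
  | add_smul {A : Type} (c d : k) (s : Term V A) :
      Rel V X (.smul (c + d) s) (.add (.smul c s) (.smul d s))
  | map_add {A B : Type} (σ : A ≃ B) (s t : Term V A) :
      Rel V X (.map σ (.add s t)) (.add (.map σ s) (.map σ t))
  | map_smul {A B : Type} (σ : A ≃ B) (c : k) (s : Term V A) :
      Rel V X (.map σ (.smul c s)) (.smul c (.map σ s))
  | map_refl {A : Type} (s : Term V A) : Rel V X (.map (Equiv.refl A) s) s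
  | map_trans {A B C : Type} (σ : A ≃ B) (τ : B ≃ C) (s : Term V A) :
      Rel V X (.map τ (.map σ s)) (.map (σ.trans τ) s)
  | sgn_add {A : Type} (s t : Term V A) :
      Rel V X (.sgn (.add s t)) (.add (.sgn s) (.sgn t))
  | sgn_smul {A : Type} (c : k) (s : Term V A) : Rel V X (.sgn (.smul c s)) (.smul c (.sgn s))
  | sgn_sgn {A : Type} (s : Term V A) : Rel V X (.sgn (.sgn s)) s
  | sgn_map {A B : Type} (σ : A ≃ B) (s : Term V A) :
      Rel V X (.sgn (.map σ s)) (.map σ (.sgn s))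
  | sgn_one : Rel V X (.sgn .one) .one
  | sgn_comp {I J : Type} (s : Term V (Option I)) (t : Term V J) :
      Rel V X (.sgn (.comp s t)) (.comp (.sgn s) (.sgn t))
  | add_comp {I J : Type} (s s' : Term V (Option I)) (t : Term V J) :
      Rel V X (.comp (.add s s') t) (.add (.comp s t) (.comp s' t))
  | smul_comp {I J : Type} (c : k) (s : Term V (Option I)) (t : Term V J) :
      Rel V X (.comp (.smul c s) t) (.smul c (.comp s t))
  | comp_add {I J : Type} (s : Term V (Option I)) (t t' : Term V J) :
      Rel V X (.comp s (.add t t')) (.add (.comp s t) (.comp s t'))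
  | comp_smul {I J : Type} (c : k) (s : Term V (Option I)) (t : Term V J) :
      Rel V X (.comp s (.smul c t)) (.smul c (.comp s t))
  | comp_map {I J I' J' : Type} (σ : I ≃ I') (τ : J ≃ J') (s : Term V (Option I)) (t : Term V J) :
      Rel V X (.comp (.map (Equiv.optionCongr σ) s) (.map τ t))
        (.map (Equiv.sumCongr σ τ) (.comp s t))
  | comp_one {I : Type} (s : Term V (Option I)) : Rel V X (.map (sumUnit I) (.comp s .one)) s
  | one_comp {J : Type} (t : Term V J) :
      Rel V X (.map (Equiv.emptySum Empty J) (.comp (.map unitOption .one) t)) t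
  | comp_assoc {I J K : Type} (r : Term V (Option I)) (s : Term V (Option J)) (t : Term V K) :
      Rel V X (.comp (.map (sumOption I J) (.comp r s)) t)
        (.map (Equiv.sumAssoc I J K).symm (.comp r (.comp s t)))
  | comp_parallel {I J K : Type} (p q : ℕ) (r : Term V (Option (Option I))) (s : Term V J)
      (t : Term V K) : Rel V X (.sgn s) (.smul ((-1 : k) ^ p) s) →
      Rel V X (.sgn t) (.smul ((-1 : k) ^ q) t) →
      Rel V X (.comp (.map (optionSum I J) (.comp r s)) t)
        (.smul ((-1 : k) ^ (p * q)) (.map (sumSwap I K J)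
          (.comp (.map (optionSum I K) (.comp (.map (optionSwap I) r) t)) s)))
  | gen_add {A : Type} (h : 2 ≤ Nat.card A) (x y : V.obj A) :
      Rel V X (.gen h (x + y)) (.add (.gen h x) (.gen h y))
  | gen_smul {A : Type} (h : 2 ≤ Nat.card A) (c : k) (x : V.obj A) :
      Rel V X (.gen h (c • x)) (.smul c (.gen h x))
  | gen_map {A B : Type} (hA : 2 ≤ Nat.card A) (hB : 2 ≤ Nat.card B) (σ : A ≃ B) (x : V.obj A) :
      Rel V X (.gen hB (V.map σ x)) (.map σ (.gen hA x))
  | gen_sgn {A : Type} (h : 2 ≤ Nat.card A) (x : V.obj A) :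
      Rel V X (.gen h (V.sgn x)) (.sgn (.gen h x))
  | rel {A : Type} (t : Term V A) : X A t → Rel V X t .zero

/-- Expressions modulo the congruence. -/
def Pres (V : SuperSpecies.{u, v} k) (X : ∀ A : Type, Term V A → Prop) (A : Type) :
    Type (max 1 u v) :=
  Quot (Rel V X (A := A))

namespace Pres

variable {V : SuperSpecies.{u, v} k} {X : ∀ A : Type, Term V A → Prop}

/-- The class of an expression. -/
def mk {A : Type} (t : Term V A) : Pres V X A := Quot.mk _ t

instance (A : Type) : Zero (Pres V X A) := ⟨mk .zero⟩

instance (A : Type) : Add (Pres V X A) :=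
  ⟨Quot.map₂ Term.add (fun _ _ _ h => .add_congr (.refl _) h)
    (fun _ _ _ h => .add_congr h (.refl _))⟩

instance (A : Type) : Neg (Pres V X A) :=
  ⟨Quot.map (Term.smul (-1)) (fun _ _ h => .smul_congr _ h)⟩

instance (A : Type) : AddCommGroup (Pres V X A) where
  add_assoc := by rintro ⟨a⟩ ⟨b⟩ ⟨c⟩; exact Quot.sound (.add_assoc _ _ _)
  zero_add := by rintro ⟨a⟩; exact Quot.sound (.zero_add _)
  add_zero := by rintro ⟨a⟩; exact Quot.sound ((Rel.add_comm _ _).trans (.zero_add _))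
  neg_add_cancel := by rintro ⟨a⟩; exact Quot.sound (.neg_add _)
  add_comm := by rintro ⟨a⟩ ⟨b⟩; exact Quot.sound (.add_comm _ _)
  nsmul := nsmulRec
  zsmul := zsmulRec

theorem mk_add {A : Type} (s t : Term V A) :
    (mk (.add s t) : Pres V X A) = mk s + mk t := rfl

instance (A : Type) : SMul k (Pres V X A) where
  smul c := Quot.map (Term.smul c) (fun _ _ h => .smul_congr _ h)

theorem mk_smul {A : Type} (c : k) (t : Term V A) :
    (mk (.smul c t) : Pres V X A) = c • mk t := rfl

instance (A : Type) : Module k (Pres V X A) := Module.ofMinimalAxioms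
  (by rintro c ⟨a⟩ ⟨b⟩; exact Quot.sound (.smul_add _ _ _))
  (by rintro c d ⟨a⟩; exact Quot.sound (.add_smul _ _ _))
  (by rintro c d ⟨a⟩; exact Quot.sound (.mul_smul _ _ _))
  (by rintro ⟨a⟩; exact Quot.sound (.one_smul _))

end Pres

/-- The operad presented by the generators `V` (in arities at least two) and the relations
`t = 0` for `t` in `X`. -/
def presented (V : SuperSpecies.{u, v} k) (X : ∀ A : Type, Term V A → Prop) :
    SuperOperad.{u, max 1 u v} k where
  obj := Pres V X
  map σ :=
    { toFun := Quot.map (Term.map σ) (fun _ _ h => .map_congr _ h)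
      map_add' := by rintro ⟨a⟩ ⟨b⟩; exact Quot.sound (.map_add _ _ _)
      map_smul' := by rintro c ⟨a⟩; exact Quot.sound (.map_smul _ _ _) }
  map_refl := by rintro A ⟨a⟩; exact Quot.sound (.map_refl _)
  map_trans := by rintro A B C σ τ ⟨a⟩; exact Quot.sound (.map_trans _ _ _)
  sgn :=
    { toFun := Quot.map Term.sgn (fun _ _ h => .sgn_congr h)
      map_add' := by rintro ⟨a⟩ ⟨b⟩; exact Quot.sound (.sgn_add _ _)
      map_smul' := by rintro c ⟨a⟩; exact Quot.sound (.sgn_smul _ _) }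
  sgn_sgn := by rintro A ⟨a⟩; exact Quot.sound (.sgn_sgn _)
  sgn_map := by rintro A B σ ⟨a⟩; exact Quot.sound (.sgn_map _ _)
  one := Pres.mk .one
  comp := LinearMap.mk₂ k
    (Quot.map₂ Term.comp (fun _ _ _ h => .comp_congr (.refl _) h)
      (fun _ _ _ h => .comp_congr h (.refl _)))
    (by rintro ⟨a⟩ ⟨b⟩ ⟨c⟩; exact Quot.sound (.add_comp _ _ _))
    (by rintro c ⟨a⟩ ⟨b⟩; exact Quot.sound (.smul_comp _ _ _))
    (by rintro ⟨a⟩ ⟨b⟩ ⟨c⟩; exact Quot.sound (.comp_add _ _ _))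
    (by rintro c ⟨a⟩ ⟨b⟩; exact Quot.sound (.comp_smul _ _ _))
  sgn_one := Quot.sound .sgn_one
  sgn_comp := by rintro I J ⟨a⟩ ⟨b⟩; exact Quot.sound (.sgn_comp _ _)
  comp_map := by rintro I J I' J' σ τ ⟨a⟩ ⟨b⟩; exact Quot.sound (.comp_map _ _ _ _)
  comp_one := by rintro I ⟨a⟩; exact Quot.sound (.comp_one _)
  one_comp := by rintro J ⟨a⟩; exact Quot.sound (.one_comp _)
  comp_assoc := by rintro I J K ⟨a⟩ ⟨b⟩ ⟨c⟩; exact Quot.sound (.comp_assoc _ _ _)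
  comp_parallel := by
    rintro I J K q r ⟨a⟩ ⟨b⟩ ⟨c⟩ hb hc
    have e : Equivalence (Rel V X (A := J)) := ⟨.refl, .symm, .trans⟩
    have e' : Equivalence (Rel V X (A := K)) := ⟨.refl, .symm, .trans⟩
    have hb' : Rel V X (.sgn b) (.smul ((-1 : k) ^ q) b) :=
      e.eqvGen_iff.1 (Quot.eqvGen_exact hb)
    have hc' : Rel V X (.sgn c) (.smul ((-1 : k) ^ r) c) :=
      e'.eqvGen_iff.1 (Quot.eqvGen_exact hc)
    exact Quot.sound (.comp_parallel q r a b c hb' hc')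

/-- The free operad on the part of `V` of arities at least two. -/
def free (V : SuperSpecies.{u, v} k) : SuperOperad.{u, max 1 u v} k :=
  presented V fun _ _ => False

/-- The generators of a presented operad. -/
def gen (V : SuperSpecies.{u, v} k) (X : ∀ A : Type, Term V A → Prop) {A : Type}
    (h : 2 ≤ Nat.card A) : V.obj A →ₗ[k] (presented V X).obj A where
  toFun x := Pres.mk (.gen h x)
  map_add' x y := Quot.sound (.gen_add h x y)
  map_smul' c x := Quot.sound (.gen_smul h c x)

/-- The generators of a free operad. -/
def freeGen (V : SuperSpecies.{u, v} k) {A : Type} (h : 2 ≤ Nat.card A) :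
    V.obj A →ₗ[k] (free V).obj A :=
  gen V (fun _ _ => False) h

theorem gen_map (V : SuperSpecies.{u, v} k) (X : ∀ A : Type, Term V A → Prop) {A B : Type}
    (hA : 2 ≤ Nat.card A) (hB : 2 ≤ Nat.card B) (σ : A ≃ B) (x : V.obj A) :
    gen V X hB (V.map σ x) = (presented V X).map σ (gen V X hA x) :=
  Quot.sound (.gen_map hA hB σ x)

theorem gen_sgn (V : SuperSpecies.{u, v} k) (X : ∀ A : Type, Term V A → Prop) {A : Type}
    (h : 2 ≤ Nat.card A) (x : V.obj A) :
    gen V X h (V.sgn x) = (presented V X).sgn (gen V X h x) :=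
  Quot.sound (.gen_sgn h x)

/-- A morphism of super species from the part of `V` of arities at least two to an operad. -/
structure GenMap (V : SuperSpecies.{u, v} k) (Q : SuperOperad.{u, w} k) where
  toFun : ∀ {A : Type}, 2 ≤ Nat.card A → V.obj A →ₗ[k] Q.obj A
  toFun_map : ∀ {A B : Type} (hA : 2 ≤ Nat.card A) (hB : 2 ≤ Nat.card B) (σ : A ≃ B)
    (x : V.obj A), toFun hB (V.map σ x) = Q.map σ (toFun hA x)
  toFun_sgn : ∀ {A : Type} (h : 2 ≤ Nat.card A) (x : V.obj A),
    toFun h (V.sgn x) = Q.sgn (toFun h x)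

variable {V : SuperSpecies.{u, v} k} {Q : SuperOperad.{u, w} k}

/-- The value of an expression in `Q`. -/
def GenMap.eval (g : GenMap V Q) : ∀ {A : Type}, Term V A → Q.obj A
  | _, .zero => 0
  | _, .add s t => g.eval s + g.eval t
  | _, .smul c s => c • g.eval s
  | _, .map σ s => Q.map σ (g.eval s)
  | _, .sgn s => Q.sgn (g.eval s)
  | _, .one => Q.one
  | _, .comp s t => Q.comp (g.eval s) (g.eval t)
  | _, .gen h x => g.toFun h x

theorem GenMap.eval_rel (g : GenMap V Q) {X : ∀ A : Type, Term V A → Prop}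
    (hX : ∀ (A : Type) (t : Term V A), X A t → g.eval t = 0) {A : Type} {s t : Term V A}
    (h : Rel V X s t) : g.eval s = g.eval t := by
  induction h with
  | refl s => rfl
  | symm _ ih => exact ih.symm
  | trans _ _ ih ih' => exact ih.trans ih'
  | add_congr _ _ ih ih' => simp only [eval, ih, ih']
  | smul_congr _ _ ih => simp only [eval, ih]
  | map_congr _ _ ih => simp only [eval, ih]
  | sgn_congr _ ih => simp only [eval, ih]
  | comp_congr _ _ ih ih' => simp only [eval, ih, ih']
  | add_comm => simp only [eval]; exact _root_.add_comm _ _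
  | add_assoc => simp only [eval]; exact _root_.add_assoc _ _ _
  | zero_add => simp [eval]
  | neg_add => simp [eval]
  | one_smul => simp [eval]
  | mul_smul => simp only [eval]; exact SemigroupAction.mul_smul _ _ _
  | smul_add => simp [eval]
  | add_smul => simp only [eval]; exact Module.add_smul _ _ _
  | map_add => simp [eval]
  | map_smul => simp [eval]
  | map_refl => simp only [eval]; exact Q.map_refl _
  | map_trans => simp only [eval]; exact Q.map_trans _ _ _
  | sgn_add => simp [eval]
  | sgn_smul => simp [eval]
  | sgn_sgn => simp only [eval]; exact Q.sgn_sgn _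
  | sgn_map => simp only [eval]; exact Q.sgn_map _ _
  | sgn_one => simp only [eval]; exact Q.sgn_one
  | sgn_comp => simp only [eval]; exact Q.sgn_comp _ _
  | add_comp => simp [eval]
  | smul_comp => simp [eval]
  | comp_add => simp [eval]
  | comp_smul => simp [eval]
  | comp_map => simp only [eval]; exact Q.comp_map _ _ _ _
  | comp_one => simp only [eval]; exact Q.comp_one _
  | one_comp => simp only [eval]; exact Q.one_comp _
  | comp_assoc => simp only [eval]; exact Q.comp_assoc _ _ _
  | comp_parallel p q _ _ _ _ _ ih ih' =>
    simp only [eval] at ih ih' ⊢; exact Q.comp_parallel p q _ _ _ ih ih'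
  | gen_add => simp [eval]
  | gen_smul => simp [eval]
  | gen_map hA hB σ x => simp only [eval]; exact g.toFun_map hA hB σ x
  | gen_sgn h x => simp only [eval]; exact g.toFun_sgn h x
  | rel t ht => exact hX _ t ht

/-- The morphism of operads out of a free operad that extends a map of generators. -/
def GenMap.lift (g : GenMap V Q) {A : Type} : (free V).obj A →ₗ[k] Q.obj A where
  toFun := Quot.lift g.eval fun _ _ h => g.eval_rel (fun _ _ => False.elim) h
  map_add' := by rintro ⟨a⟩ ⟨b⟩; rfl
  map_smul' := by rintro c ⟨a⟩; rfl

theorem GenMap.lift_gen (g : GenMap V Q) {A : Type} (h : 2 ≤ Nat.card A) (x : V.obj A) :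
    g.lift (freeGen V h x) = g.toFun h x := rfl

theorem GenMap.lift_map (g : GenMap V Q) {A B : Type} (σ : A ≃ B) (x : (free V).obj A) :
    g.lift ((free V).map σ x) = Q.map σ (g.lift x) := by
  obtain ⟨a⟩ := x; rfl

theorem GenMap.lift_comp (g : GenMap V Q) {I J : Type} (x : (free V).obj (Option I))
    (y : (free V).obj J) :
    g.lift ((free V).comp x y) = Q.comp (g.lift x) (g.lift y) := by
  obtain ⟨a⟩ := x; obtain ⟨b⟩ := y; rfl

theorem GenMap.lift_one (g : GenMap V Q) : g.lift (free V).one = Q.one := rfl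

theorem GenMap.lift_sgn (g : GenMap V Q) {A : Type} (x : (free V).obj A) :
    g.lift ((free V).sgn x) = Q.sgn (g.lift x) := by
  obtain ⟨a⟩ := x; rfl

/-! ### Derivations -/

namespace SuperOperad

variable (P : SuperOperad.{u, v} k)

theorem comp_map_left {I I' J : Type} (σ : I ≃ I') (x : P.obj (Option I)) (y : P.obj J) :
    P.comp (P.map (Equiv.optionCongr σ) x) y =
      P.map (Equiv.sumCongr σ (Equiv.refl J)) (P.comp x y) := by
  rw [← P.comp_map, P.map_refl]

theorem comp_map_right {I J J' : Type} (τ : J ≃ J') (x : P.obj (Option I)) (y : P.obj J) :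
    P.comp x (P.map τ y) = P.map (Equiv.sumCongr (Equiv.refl I) τ) (P.comp x y) := by
  rw [← P.comp_map, Equiv.optionCongr_refl, P.map_refl]

theorem comp_assoc' {I J K L M : Type} (e : I ⊕ M ≃ Option L) (m : M ≃ Option J) (s : I ⊕ J ≃ L)
    (h : e = (Equiv.sumCongr (Equiv.refl I) m).trans
      ((sumOption I J).trans (Equiv.optionCongr s)))
    (x : P.obj (Option I)) (y : P.obj M) (z : P.obj K) :
    P.comp (P.map e (P.comp x y)) z =
      P.map ((Equiv.sumAssoc I J K).symm.trans (Equiv.sumCongr s (Equiv.refl K)))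
        (P.comp x (P.comp (P.map m y) z)) := by
  rw [h, ← P.map_trans, ← P.map_trans, comp_map_left, ← comp_map_right, P.comp_assoc, P.map_trans]

theorem comp_comp_map {I J K L M : Type} (e : M ⊕ J ≃ Option L) (m : M ≃ Option I) (s : I ⊕ J ≃ L)
    (h : e = (Equiv.sumCongr m (Equiv.refl J)).trans
      ((optionSum I J).trans (Equiv.optionCongr s)))
    (x : P.obj (Option M)) (y : P.obj J) (z : P.obj K) :
    P.comp (P.map e (P.comp x y)) z = P.map (Equiv.sumCongr s (Equiv.refl K))
      (P.comp (P.map (optionSum I J) (P.comp (P.map (Equiv.optionCongr m) x) y)) z) := by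
  rw [h, ← P.map_trans, ← P.map_trans, ← P.comp_map_left m, P.comp_map_left s]

theorem comp_parallel' {I J K L : Type} (e : Option I ⊕ J ≃ Option L) (s : I ⊕ J ≃ L)
    (h : e = (optionSum I J).trans (Equiv.optionCongr s)) (q r : ℕ)
    (x : P.obj (Option (Option I))) (y : P.obj J) (z : P.obj K)
    (hy : P.sgn y = (-1 : k) ^ q • y) (hz : P.sgn z = (-1 : k) ^ r • z) :
    P.comp (P.map e (P.comp x y)) z =
      (-1 : k) ^ (q * r) • P.map ((sumSwap I K J).trans (Equiv.sumCongr s (Equiv.refl K)))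
        (P.comp (P.map (optionSum I K) (P.comp (P.map (optionSwap I) x) z)) y) := by
  rw [h, ← P.map_trans, comp_map_left, P.comp_parallel q r x y z hy hz, map_smul, P.map_trans]

/-- The `p`-th power of the parity involution. -/
def sgnPow (p : ℕ) {A : Type} : P.obj A →ₗ[k] P.obj A := (P.sgn : Module.End k (P.obj A)) ^ p

theorem sgnPow_zero {A : Type} (x : P.obj A) : P.sgnPow 0 x = x := by simp [sgnPow]

theorem sgnPow_succ (p : ℕ) {A : Type} (x : P.obj A) :
    P.sgnPow (p + 1) x = P.sgnPow p (P.sgn x) := by simp [sgnPow, pow_succ]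

theorem sgnPow_map (p : ℕ) {A B : Type} (σ : A ≃ B) (x : P.obj A) :
    P.sgnPow p (P.map σ x) = P.map σ (P.sgnPow p x) := by
  induction p generalizing x with
  | zero => simp only [sgnPow_zero]
  | succ p ih => simp only [sgnPow_succ, P.sgn_map, ih]

theorem sgnPow_comp (p : ℕ) {I J : Type} (x : P.obj (Option I)) (y : P.obj J) :
    P.sgnPow p (P.comp x y) = P.comp (P.sgnPow p x) (P.sgnPow p y) := by
  induction p generalizing x y with
  | zero => simp only [sgnPow_zero]
  | succ p ih => simp only [sgnPow_succ, P.sgn_comp, ih]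

theorem sgn_sgnPow (p : ℕ) {A : Type} (x : P.obj A) :
    P.sgn (P.sgnPow p x) = P.sgnPow p (P.sgn x) := by
  induction p generalizing x with
  | zero => simp only [sgnPow_zero]
  | succ p ih => simp only [sgnPow_succ, ih]

theorem sgnPow_one (p : ℕ) : P.sgnPow p P.one = P.one := by
  induction p with
  | zero => simp only [sgnPow_zero]
  | succ p ih => simp only [sgnPow_succ, P.sgn_one, ih]

theorem sgnPow_homogeneous (p q : ℕ) {A : Type} (x : P.obj A) (h : P.sgn x = (-1 : k) ^ q • x) :
    P.sgnPow p x = (-1 : k) ^ (p * q) • x := by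
  induction p with
  | zero => simp [sgnPow_zero]
  | succ p ih => rw [sgnPow_succ, h, map_smul, ih, smul_smul, ← pow_add]; congr 2; ring

end SuperOperad

/-- The square-zero extension of an operad `P` by the copy `A ↦ P(A ⊔ E)` of itself, placed in
parity `p`, with `(x, x') ∘ (y, y') = (x ∘ y, x' ∘ y + (-1)^(p |x|) x ∘ y')`.
A morphism `x ↦ (x, D x)` into it is the same thing as a derivation `D` of parity `p` that adds
the inputs `E`. -/
def sqZero (P : SuperOperad.{u, v} k) (E : Type) (p : ℕ) : SuperOperad.{u, v} k where
  obj A := P.obj A × P.obj (A ⊕ E)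
  map σ := LinearMap.prodMap (P.map σ) (P.map (Equiv.sumCongr σ (Equiv.refl E)))
  map_refl := by
    rintro A ⟨x, x'⟩
    ext
    · exact P.map_refl x
    · simpa using P.map_refl x'
  map_trans := by
    rintro A B C σ τ ⟨x, x'⟩
    ext
    · exact P.map_trans _ _ x
    · simp [P.map_trans]
  sgn := LinearMap.prodMap P.sgn ((-1 : k) ^ p • P.sgn)
  sgn_sgn := by
    rintro A ⟨x, x'⟩
    ext
    · exact P.sgn_sgn x
    · simp [P.sgn_sgn, smul_smul, ← mul_pow]
  sgn_map := by
    rintro A B σ ⟨x, x'⟩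
    ext
    · exact P.sgn_map σ x
    · simp [P.sgn_map]
  one := (P.one, 0)
  comp {I J} := LinearMap.mk₂ k
    (fun x y => (P.comp x.1 y.1,
      P.map (sumSwap I E J) (P.comp (P.map (optionSum I E) x.2) y.1) +
      P.map (Equiv.sumAssoc I J E).symm (P.comp (P.sgnPow p x.1) y.2)))
    (by rintro x x' y; ext <;> simp; abel)
    (by rintro c x y; ext <;> simp)
    (by rintro x y y'; ext <;> simp; abel)
    (by rintro c x y; ext <;> simp)
  sgn_one := by ext <;> simp [P.sgn_one]
  sgn_comp := by
    rintro I J ⟨x, x'⟩ ⟨y, y'⟩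
    ext
    · simp [P.sgn_comp]
    · simp [P.sgn_comp, P.sgn_map, P.sgn_sgnPow]
  comp_map := by
    rintro I J I' J' σ τ ⟨x, x'⟩ ⟨y, y'⟩
    ext
    · simp [P.comp_map]
    · have h1 : (Equiv.sumCongr (Equiv.optionCongr σ) (Equiv.refl E)).trans (optionSum I' E) =
          (optionSum I E).trans (Equiv.optionCongr (Equiv.sumCongr σ (Equiv.refl E))) := by
        ext ((_ | i) | j) <;> rfl
      simp only [LinearMap.mk₂_apply, LinearMap.prodMap_apply, P.map_trans, h1, map_add,
        P.sgnPow_map]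
      rw [← P.map_trans, P.comp_map, P.comp_map, P.map_trans, P.map_trans]
      congr 2
      · congr 1; ext ((i | i) | j) <;> rfl
      · congr 1; ext (i | j | j) <;> rfl
  comp_one := by
    rintro I ⟨x, x'⟩
    ext
    · simp [P.comp_one]
    · have h1 : (sumSwap I E Unit).trans (Equiv.sumCongr (sumUnit I) (Equiv.refl E)) =
          (sumUnit (I ⊕ E)).trans (optionSum I E).symm := by
        ext ((i | i) | j) <;> rfl
      simp only [LinearMap.mk₂_apply, LinearMap.prodMap_apply, P.map_trans, h1, map_zero,
        add_zero]
      rw [← P.map_trans, P.comp_one, P.map_trans, Equiv.self_trans_symm, P.map_refl]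
  one_comp := by
    rintro J ⟨y, y'⟩
    ext
    · simp [P.one_comp]
    · have h1 : (Equiv.sumAssoc Empty J E).symm.trans
          (Equiv.sumCongr (Equiv.emptySum Empty J) (Equiv.refl E)) =
          Equiv.emptySum Empty (J ⊕ E) := by
        ext (i | j | j)
        · exact i.elim
        · rfl
        · rfl
      simp only [LinearMap.mk₂_apply, LinearMap.prodMap_apply, map_zero,
        LinearMap.zero_apply, zero_add, P.map_trans, P.sgnPow_map, P.sgnPow_one, h1, P.one_comp]
  comp_assoc := by
    rintro I J K ⟨x, x'⟩ ⟨y, y'⟩ ⟨z, z'⟩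
    ext
    · simp [P.comp_assoc]
    · simp only [LinearMap.mk₂_apply, LinearMap.prodMap_apply, map_add, LinearMap.add_apply,
        P.map_trans, P.sgnPow_map, P.sgnPow_comp, P.comp_assoc, P.comp_map_right]
      rw [P.comp_assoc' _ (Equiv.refl _) (sumSwap I E J) (by ext ((i | i) | _ | j) <;> rfl),
        P.comp_assoc' _ (optionSum J E) (Equiv.sumAssoc I J E).symm
          (by ext (i | (_ | j) | j) <;> rfl)]
      simp only [P.map_trans, P.map_refl, add_assoc]
      congr 2
      · congr 1; ext ((i | i) | j | j) <;> rfl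
      · congr 2; ext (i | (j | j) | j) <;> rfl
      · congr 2; ext (i | j | j | j) <;> rfl
  comp_parallel := by
    rintro I J K q r ⟨x, x'⟩ ⟨y, y'⟩ ⟨z, z'⟩ hy hz
    simp only [LinearMap.prodMap_apply, Prod.ext_iff, Prod.smul_fst, Prod.smul_snd,
      LinearMap.smul_apply] at hy hz
    obtain ⟨hy, hy'⟩ := hy
    obtain ⟨hz, hz'⟩ := hz
    have key : ∀ {B : Type} (t : P.obj B) (n : ℕ), (-1 : k) ^ p • P.sgn t = (-1 : k) ^ n • t →
        P.sgn t = (-1 : k) ^ (p + n) • t := by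
      intro B t n h
      have h2 : (-1 : k) ^ p * (-1 : k) ^ p = 1 := by rw [← mul_pow]; simp
      rw [pow_add, ← smul_smul, ← h, smul_smul, h2, one_smul]
    replace hy' := key _ _ hy'
    replace hz' := key _ _ hz'
    ext
    · simp [P.comp_parallel q r x y z hy hz]
    · simp only [LinearMap.mk₂_apply, LinearMap.prodMap_apply, map_add, LinearMap.add_apply,
        P.map_trans, P.sgnPow_map, P.sgnPow_comp, Prod.smul_snd, smul_add]
      rw [P.comp_comp_map _ (optionSum I E) (sumSwap I E J) (by ext (((_ | i) | i) | j) <;> rfl),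
        P.comp_parallel q r _ y z hy hz,
        P.comp_parallel' _ (Equiv.sumAssoc I J E).symm
          (by ext ((_ | i) | j | j) <;> rfl) (p + q) r _ y' z hy' hz,
        P.sgnPow_homogeneous p q y hy, P.sgnPow_homogeneous p r z hz,
        P.comp_comp_map _ (optionSum I E) (sumSwap I E K)
          (by ext (((_ | i) | i) | j) <;> rfl),
        P.comp_comp_map _ (Equiv.refl _) (Equiv.sumAssoc I K E).symm
          (by ext ((_ | i) | j | j) <;> rfl)]
      simp only [Equiv.optionCongr_refl, P.map_refl, map_smul, LinearMap.smul_apply, P.map_trans]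
      rw [P.comp_parallel q (p + r) _ y z' hy hz']
      simp only [map_smul, smul_smul, ← pow_add, P.map_trans]
      have h1 : (optionSum (Option I) E).trans
          ((optionSum I E).optionCongr.trans (optionSwap (I ⊕ E))) =
          ((optionSwap I).sumCongr (Equiv.refl E)).trans ((optionSum (Option I) E).trans
            (optionSum I E).optionCongr) := by
        ext ((_ | _ | i) | j) <;> rfl
      have e1 : (-1 : k) ^ (p * q + q * (p + r)) = (-1) ^ (q * r) := by
        rw [show p * q + q * (p + r) = 2 * (p * q) + q * r by ring, pow_add, pow_mul]; simp
      have e2 : (-1 : k) ^ ((p + q) * r) = (-1) ^ (q * r + p * r) := by congr 1; ring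
      simp only [Equiv.trans_assoc, h1, e1, e2]
      rw [add_right_comm]
      refine congrArg₂ (· + ·) (congrArg₂ (· + ·) ?_ ?_) ?_
      · congr 3; ext (((i | i) | i) | j) <;> rfl
      · congr 3; ext ((i | j | j) | j) <;> rfl
      · congr 3; ext ((i | j) | j | j) <;> rfl

/-- A derivation on generators: a map `δ : V(A) → F(A ⊔ E)` of parity `p` into the free operad
`F`, compatible with relabellings of `A`. -/
structure DerData (V : SuperSpecies.{u, v} k) (E : Type) (p : ℕ) where
  toFun : ∀ {A : Type}, 2 ≤ Nat.card A → V.obj A →ₗ[k] (free V).obj (A ⊕ E)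
  toFun_map : ∀ {A B : Type} (hA : 2 ≤ Nat.card A) (hB : 2 ≤ Nat.card B) (σ : A ≃ B)
    (x : V.obj A),
    toFun hB (V.map σ x) = (free V).map (Equiv.sumCongr σ (Equiv.refl E)) (toFun hA x)
  toFun_sgn : ∀ {A : Type} (h : 2 ≤ Nat.card A) (x : V.obj A),
    toFun h (V.sgn x) = (-1 : k) ^ p • (free V).sgn (toFun h x)

/-- The morphism `x ↦ (x, δ x)` on generators. -/
def DerData.toGenMap {E : Type} {p : ℕ} (δ : DerData V E p) :
    GenMap V (sqZero (free V) E p) where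
  toFun h := LinearMap.prod (freeGen V h) (δ.toFun h)
  toFun_map hA hB σ x := Prod.ext (gen_map V _ hA hB σ x) (δ.toFun_map hA hB σ x)
  toFun_sgn h x := Prod.ext (gen_sgn V _ h x) (δ.toFun_sgn h x)

/-- The derivation of the free operad that extends `δ`. -/
def DerData.deriv {E : Type} {p : ℕ} (δ : DerData V E p) {A : Type} :
    (free V).obj A →ₗ[k] (free V).obj (A ⊕ E) :=
  LinearMap.snd k _ _ ∘ₗ δ.toGenMap.lift

theorem DerData.lift_fst {E : Type} {p : ℕ} (δ : DerData V E p) {A : Type} (x : (free V).obj A) :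
    (δ.toGenMap.lift x).1 = x := by
  suffices h : ∀ t : Term V A, (δ.toGenMap.eval t).1 = Pres.mk t from by
    obtain ⟨t⟩ := x; exact h t
  clear x
  intro t
  induction t with
  | zero => rfl
  | add s t hs ht => exact congrArg₂ (· + ·) hs ht
  | smul c s hs => exact congrArg (c • ·) hs
  | map σ s hs => exact congrArg ((free V).map σ) hs
  | sgn s hs => exact congrArg (free V).sgn hs
  | one => rfl
  | comp s t hs ht => exact congrArg₂ (fun a b => (free V).comp a b) hs ht
  | gen h x => rfl

theorem DerData.deriv_gen {E : Type} {p : ℕ} (δ : DerData V E p) {A : Type}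
    (h : 2 ≤ Nat.card A) (x : V.obj A) : δ.deriv (freeGen V h x) = δ.toFun h x := rfl

/-- The Leibniz rule. -/
theorem DerData.deriv_comp {E : Type} {p : ℕ} (δ : DerData V E p) {I J : Type}
    (x : (free V).obj (Option I)) (y : (free V).obj J) :
    δ.deriv ((free V).comp x y) =
      (free V).map (sumSwap I E J) ((free V).comp ((free V).map (optionSum I E) (δ.deriv x)) y) +
      (free V).map (Equiv.sumAssoc I J E).symm
        ((free V).comp ((free V).sgnPow p x) (δ.deriv y)) := by
  have h := congrArg Prod.snd (δ.toGenMap.lift_comp x y)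
  have hx := δ.lift_fst x
  have hy := δ.lift_fst y
  refine h.trans ?_
  change (free V).map _ ((free V).comp ((free V).map _ (δ.toGenMap.lift x).2)
      (δ.toGenMap.lift y).1) + (free V).map _ ((free V).comp
      ((free V).sgnPow p (δ.toGenMap.lift x).1) (δ.toGenMap.lift y).2) = _
  rw [hx, hy]
  rfl

theorem DerData.deriv_map {E : Type} {p : ℕ} (δ : DerData V E p) {A B : Type} (σ : A ≃ B)
    (x : (free V).obj A) :
    δ.deriv ((free V).map σ x) =
      (free V).map (Equiv.sumCongr σ (Equiv.refl E)) (δ.deriv x) :=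
  congrArg Prod.snd (δ.toGenMap.lift_map σ x)

theorem DerData.deriv_one {E : Type} {p : ℕ} (δ : DerData V E p) :
    δ.deriv (free V).one = 0 := rfl

end Presented

/-! ### The Orlik–Solomon algebras -/

section OrlikSolomon

variable (k : Type u) [Field k]

/-- The relations among the generators `w_ij`, `i ≠ j`: symmetry, graded commutativity (all `w_ij`
are odd) and the Arnold relations. -/
inductive OSRel (A : Type) :
    FreeAlgebra k {p : A × A // p.1 ≠ p.2} → FreeAlgebra k {p : A × A // p.1 ≠ p.2} → Prop
  | symm (i j : A) (h : i ≠ j) :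
      OSRel A (FreeAlgebra.ι k ⟨(i, j), h⟩) (FreeAlgebra.ι k ⟨(j, i), h.symm⟩)
  | sq (p : {p : A × A // p.1 ≠ p.2}) : OSRel A (FreeAlgebra.ι k p * FreeAlgebra.ι k p) 0
  | anticomm (p q : {p : A × A // p.1 ≠ p.2}) :
      OSRel A (FreeAlgebra.ι k p * FreeAlgebra.ι k q + FreeAlgebra.ι k q * FreeAlgebra.ι k p) 0
  | arnold (i j l : A) (hij : i ≠ j) (hjl : j ≠ l) (hli : l ≠ i) :
      OSRel A (FreeAlgebra.ι k ⟨(i, j), hij⟩ * FreeAlgebra.ι k ⟨(j, l), hjl⟩ +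
        FreeAlgebra.ι k ⟨(j, l), hjl⟩ * FreeAlgebra.ι k ⟨(l, i), hli⟩ +
        FreeAlgebra.ι k ⟨(l, i), hli⟩ * FreeAlgebra.ι k ⟨(i, j), hij⟩) 0

/-- The Orlik–Solomon algebra on the label set `A`, the cohomology of the configuration space of
points in the plane labelled by `A`. -/
def OS (A : Type) : Type u := RingQuot (OSRel k A)

namespace OS

noncomputable instance (A : Type) : Ring (OS k A) := inferInstanceAs (Ring (RingQuot (OSRel k A)))

noncomputable instance (A : Type) : Algebra k (OS k A) :=
  inferInstanceAs (Algebra k (RingQuot (OSRel k A)))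

variable {A B : Type}

/-- The projection from the free algebra. -/
noncomputable def proj (A : Type) : FreeAlgebra k {p : A × A // p.1 ≠ p.2} →ₐ[k] OS k A :=
  RingQuot.mkAlgHom k (OSRel k A)

theorem proj_rel {x y : FreeAlgebra k {p : A × A // p.1 ≠ p.2}} (h : OSRel k A x y) :
    proj k A x = proj k A y := RingQuot.mkAlgHom_rel k h

/-- The generator `w_ij`. -/
noncomputable def w (i j : A) (h : i ≠ j) : OS k A := proj k A (FreeAlgebra.ι k ⟨(i, j), h⟩)

theorem w_symm (i j : A) (h : i ≠ j) : w k i j h = w k j i h.symm :=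
  proj_rel k (OSRel.symm i j h)

theorem w_sq (i j : A) (h : i ≠ j) : w k i j h * w k i j h = 0 := by
  have := proj_rel k (OSRel.sq (k := k) ⟨(i, j), h⟩)
  rwa [map_mul, map_zero] at this

theorem w_anticomm (i j l m : A) (h : i ≠ j) (h' : l ≠ m) :
    w k i j h * w k l m h' + w k l m h' * w k i j h = 0 := by
  have := proj_rel k (OSRel.anticomm (k := k) ⟨(i, j), h⟩ ⟨(l, m), h'⟩)
  rwa [map_add, map_mul, map_mul, map_zero] at this

theorem w_arnold (i j l : A) (hij : i ≠ j) (hjl : j ≠ l) (hli : l ≠ i) :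
    w k i j hij * w k j l hjl + w k j l hjl * w k l i hli + w k l i hli * w k i j hij = 0 := by
  have := proj_rel k (OSRel.arnold (k := k) i j l hij hjl hli)
  rwa [map_add, map_add, map_mul, map_mul, map_mul, map_zero] at this

/-- The universal property: an algebra morphism is determined by images of the `w_ij` that
satisfy the relations. -/
noncomputable def lift {R : Type v} [Ring R] [Algebra k R] (f : ∀ i j : A, i ≠ j → R)
    (hsymm : ∀ i j h, f i j h = f j i h.symm)
    (hsq : ∀ i j h, f i j h * f i j h = 0)
    (hanti : ∀ i j l m h h', f i j h * f l m h' + f l m h' * f i j h = 0)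
    (harn : ∀ i j l hij hjl hli, f i j hij * f j l hjl + f j l hjl * f l i hli +
      f l i hli * f i j hij = 0) : OS k A →ₐ[k] R :=
  RingQuot.liftAlgHom k ⟨FreeAlgebra.lift k fun p => f p.1.1 p.1.2 p.2, by
    intro x y h
    cases h with
    | symm i j h => simpa using hsymm i j h
    | sq p => simpa using hsq _ _ p.2
    | anticomm p q => simpa using hanti _ _ _ _ p.2 q.2
    | arnold i j l hij hjl hli => simpa using harn i j l hij hjl hli⟩

theorem lift_w {R : Type v} [Ring R] [Algebra k R] (f : ∀ i j : A, i ≠ j → R)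
    (hsymm hsq hanti harn) (i j : A) (h : i ≠ j) :
    lift k f hsymm hsq hanti harn (w k i j h) = f i j h :=
  (RingQuot.liftAlgHom_mkAlgHom_apply ..).trans (FreeAlgebra.lift_ι_apply ..)

variable {k}

theorem induction {C : OS k A → Prop} (f : OS k A) (one : C 1)
    (add : ∀ f g, C f → C g → C (f + g)) (smul : ∀ (c : k) f, C f → C (c • f))
    (mul : ∀ i j h f, C f → C (w k i j h * f)) : C f := by
  obtain ⟨a, rfl⟩ : ∃ a, proj k A a = f := RingQuot.mkAlgHom_surjective k (OSRel k A) f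
  suffices ∀ g, C g → C (proj k A a * g) by
    simpa using this 1 one
  induction a using FreeAlgebra.induction with
  | grade0 r => intro g hg; rw [AlgHom.commutes, ← Algebra.smul_def]; exact smul r g hg
  | grade1 p => intro g hg; exact mul p.1.1 p.1.2 p.2 g hg
  | mul a b ha hb => intro g hg; rw [map_mul, mul_assoc]; exact ha _ (hb _ hg)
  | add a b ha hb => intro g hg; rw [map_add, add_mul]; exact add _ _ (ha _ hg) (hb _ hg)

variable (k)

/-- The morphism `w_ij ↦ w_{φ(i) φ(j)}` induced by an injection of label sets. -/
noncomputable def map (φ : A ↪ B) : OS k A →ₐ[k] OS k B :=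
  lift k (fun i j h => w k (φ i) (φ j) (φ.injective.ne h))
    (fun _ _ _ => w_symm k _ _ _) (fun _ _ _ => w_sq k _ _ _)
    (fun _ _ _ _ _ _ => w_anticomm k _ _ _ _ _ _) (fun _ _ _ _ _ _ => w_arnold k _ _ _ _ _ _)

/-- The parity involution `w_ij ↦ -w_ij`. -/
noncomputable def tau : OS k A →ₐ[k] OS k A :=
  lift k (fun i j h => -w k i j h)
    (fun i j h => by rw [w_symm]) (fun i j h => by rw [neg_mul_neg, w_sq])
    (fun i j l m h h' => by rw [neg_mul_neg, neg_mul_neg, w_anticomm])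
    (fun i j l h h' h'' => by rw [neg_mul_neg, neg_mul_neg, neg_mul_neg, w_arnold])

/-- The algebra morphism `f ↦ (τ f, ∂f/∂w; 0, f)` into upper triangular matrices, where `τ` is the
parity involution.  It encodes the graded Leibniz rule `∂(fg) = ∂f · g + τ(f) · ∂g`. -/
noncomputable def dwMatrix : OS k A →ₐ[k] Matrix (Fin 2) (Fin 2) (OS k A) :=
  lift k (fun i j h => !![-w k i j h, 1; 0, w k i j h])
    (fun i j h => by rw [w_symm])
    (fun i j h => by simp [w_sq, ← Matrix.ext_iff])
    (fun i j l m h h' => by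
      simp [← Matrix.ext_iff, w_anticomm])
    (fun i j l h h' h'' => by
      simp [← Matrix.ext_iff, w_arnold])

/-- The odd derivation `∂/∂w = ∑_{i<j} ∂/∂w_ij`: it sends every `w_ij` to `1`. -/
noncomputable def dw : OS k A →ₗ[k] OS k A :=
  Matrix.entryLinearMap k (OS k A) 0 1 ∘ₗ (dwMatrix k).toLinearMap

theorem dw_one : dw k (1 : OS k A) = 0 := by simp [dw]

theorem dwMatrix_w_mul (i j : A) (h : i ≠ j) (f : OS k A) :
    dwMatrix k (w k i j h * f) = !![-w k i j h, 1; 0, w k i j h] * dwMatrix k f := by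
  rw [map_mul]; congr 1; exact lift_w ..

theorem dwMatrix_one_one (f : OS k A) : dwMatrix k f 1 0 = 0 ∧ dwMatrix k f 1 1 = f := by
  induction f using induction with
  | one => simp
  | add f g hf hg => simp [hf, hg]
  | smul c f hf => simp [hf]
  | mul i j h f hf => simp [dwMatrix_w_mul, Matrix.mul_apply, Fin.sum_univ_two, hf]

/-- `∂(w_ij f) = f - w_ij ∂f`. -/
theorem dw_w_mul (i j : A) (h : i ≠ j) (f : OS k A) :
    dw k (w k i j h * f) = f - w k i j h * dw k f := by
  change dwMatrix k _ 0 1 = _ - _ * dwMatrix k f 0 1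
  simp [dwMatrix_w_mul, Matrix.mul_apply, Fin.sum_univ_two, dwMatrix_one_one]
  abel

/-- The monomials of degree `r` in the `w_ij` span the component of degree `r`. -/
noncomputable def degree (A : Type) (r : ℕ) : Submodule k (OS k A) :=
  (Submodule.span k {x | ∃ (i j : A) (h : i ≠ j), x = w k i j h}) ^ r

theorem map_w (φ : A ↪ B) (i j : A) (h : i ≠ j) :
    map k φ (w k i j h) = w k (φ i) (φ j) (φ.injective.ne h) := lift_w ..

theorem tau_w (i j : A) (h : i ≠ j) : tau k (w k i j h) = -w k i j h := lift_w ..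

theorem tau_tau (f : OS k A) : tau k (tau k f) = f := by
  induction f using induction with
  | one => simp
  | add f g hf hg => simp [hf, hg]
  | smul c f hf => simp [hf]
  | mul i j h f hf => simp [tau_w, hf]

theorem map_refl (f : OS k A) : map k (Equiv.refl A).toEmbedding f = f := by
  induction f using induction with
  | one => simp
  | add f g hf hg => rw [map_add, hf, hg]
  | smul c f hf => rw [map_smul, hf]
  | mul i j h f hf => rw [map_mul, hf, map_w]; rfl

theorem map_map {C : Type} (φ : A ↪ B) (ψ : B ↪ C) (f : OS k A) :
    map k ψ (map k φ f) = map k (φ.trans ψ) f := by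
  induction f using induction with
  | one => simp
  | add f g hf hg => simp only [map_add, hf, hg]
  | smul c f hf => simp only [map_smul, hf]
  | mul i j h f hf => simp only [map_mul, hf, map_w]; rfl

theorem tau_map (φ : A ↪ B) (f : OS k A) : tau k (map k φ f) = map k φ (tau k f) := by
  induction f using induction with
  | one => simp
  | add f g hf hg => simp only [map_add, hf, hg]
  | smul c f hf => simp only [map_smul, hf]
  | mul i j h f hf => simp only [map_mul, hf, map_w, tau_w, map_neg]

theorem dw_map (φ : A ↪ B) (f : OS k A) : dw k (map k φ f) = map k φ (dw k f) := by
  induction f using induction with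
  | one => simp only [map_one, dw_one, map_zero]
  | add f g hf hg => simp only [map_add, hf, hg]
  | smul c f hf => simp only [map_smul, hf]
  | mul i j h f hf => simp only [map_mul, hf, map_w, dw_w_mul, map_sub]

theorem dw_tau (f : OS k A) : dw k (tau k f) = -tau k (dw k f) := by
  induction f using induction with
  | one => simp only [map_one, dw_one, map_zero, neg_zero]
  | add f g hf hg => simp only [map_add, hf, hg, neg_add]
  | smul c f hf => simp only [map_smul, hf, smul_neg]
  | mul i j h f hf =>
    simp only [map_mul, tau_w, neg_mul, map_neg, dw_w_mul, map_sub, hf, mul_neg, sub_neg_eq_add]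

/-- Left multiplication by `x ⊗ 1` on the graded tensor product `OS(A) ⊗ OS(B)`. -/
noncomputable def mulL (x : OS k A) : Module.End k (OS k A ⊗[k] OS k B) :=
  TensorProduct.map (LinearMap.mulLeft k x) LinearMap.id

/-- Left multiplication by `1 ⊗ y`, for odd `y`, on the graded tensor product `OS(A) ⊗ OS(B)`:
by the Koszul rule `(1 ⊗ y)(f ⊗ g) = τ(f) ⊗ y g`. -/
noncomputable def mulR (y : OS k B) : Module.End k (OS k A ⊗[k] OS k B) :=
  TensorProduct.map (tau k).toLinearMap (LinearMap.mulLeft k y)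

theorem mulL_mul (x x' : OS k A) :
    (mulL k x * mulL k x' : Module.End k (OS k A ⊗[k] OS k B)) = mulL k (x * x') := by
  ext; simp [mulL]

theorem mulL_add (x x' : OS k A) :
    (mulL k (x + x') : Module.End k (OS k A ⊗[k] OS k B)) = mulL k x + mulL k x' := by
  ext; simp [mulL, add_mul, TensorProduct.add_tmul]

theorem mulL_zero : (mulL k 0 : Module.End k (OS k A ⊗[k] OS k B)) = 0 := by
  ext; simp [mulL]

/-- Left multiplication by `1 ⊗ y`, for even `y`. -/
noncomputable def mulE (y : OS k B) : Module.End k (OS k A ⊗[k] OS k B) :=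
  TensorProduct.map LinearMap.id (LinearMap.mulLeft k y)

theorem mulE_add (y y' : OS k B) :
    (mulE k (y + y') : Module.End k (OS k A ⊗[k] OS k B)) = mulE k y + mulE k y' := by
  ext; simp [mulE, add_mul, TensorProduct.tmul_add]

theorem mulE_zero : (mulE k 0 : Module.End k (OS k A ⊗[k] OS k B)) = 0 := by
  ext; simp [mulE]

theorem mulR_mul (y y' : OS k B) :
    (mulR k y * mulR k y' : Module.End k (OS k A ⊗[k] OS k B)) = mulE k (y * y') := by
  ext; simp [mulR, mulE, tau_tau]

theorem mulR_mulL (i j : A) (h : i ≠ j) (y : OS k B) :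
    (mulR k y * mulL k (w k i j h) : Module.End k (OS k A ⊗[k] OS k B)) =
      -(mulL k (w k i j h) * mulR k y) := by
  ext; simp [mulR, mulL, tau_w, TensorProduct.neg_tmul]

/-- Left multiplication by the image of the generator `w_ab` under the cocomposition, on the
graded tensor product `OS(I ⊔ {*}) ⊗ OS(J)`, with `none` as the label `*`. -/
noncomputable def cocompGen (I J : Type) : ∀ a b : I ⊕ J, a ≠ b →
    Module.End k (OS k (Option I) ⊗[k] OS k J)
  | .inl i, .inl i', h => mulL k (w k (some i) (some i') (by simpa using h))
  | .inl i, .inr _, _ => mulL k (w k (some i) none (by simp))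
  | .inr _, .inl i, _ => mulL k (w k none (some i) (by simp))
  | .inr j, .inr j', h => mulR k (w k j j' (by simpa using h))

/-- The morphism from `OS(I ⊔ J)` to the graded tensor product algebra `OS(I ⊔ {*}) ⊗ OS(J)` that
sends `w_ab` to `w_ab ⊗ 1`, `w_a* ⊗ 1`, `1 ⊗ w_ab` for `a, b ∈ I`, for `a ∈ I` and `b ∈ J`, and for
`a, b ∈ J` respectively; the elements of the target are seen as left multiplications. -/
noncomputable def cocompAlg (I J : Type) :
    OS k (I ⊕ J) →ₐ[k] Module.End k (OS k (Option I) ⊗[k] OS k J) :=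
  lift k (cocompGen k I J)
    (by
      rintro (i | j) (i' | j') h <;> simp only [cocompGen] <;> rw [w_symm])
    (by
      rintro (i | j) (i' | j') h <;>
        simp only [cocompGen, mulL_mul, mulR_mul, w_sq, mulL_zero, mulE_zero])
    (by
      rintro (i | j) (i' | j') (l | l) (m | m) h h' <;>
        simp only [cocompGen, mulL_mul, ← mulL_add, w_anticomm, mulL_zero, mulR_mulL,
          add_neg_cancel, neg_add_cancel, mulR_mul, ← mulE_add, mulE_zero])
    (by
      rintro (i | i) (j | j) (l | l) h h' h'' <;>
        simp only [cocompGen, mulL_mul, ← mulL_add, w_arnold, mulL_zero, mulR_mulL, mulR_mul,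
          ← mulE_add, mulE_zero]
      · rw [w_symm k none (some i), w_sq, mulL_zero, add_zero, add_neg_cancel]
      · rw [w_symm k none (some j), w_sq, mulL_zero, zero_add, add_neg_cancel]
      · rw [w_symm k none (some l), w_sq, mulL_zero, add_zero, neg_add_cancel])

/-- The cocomposition `μ : OS(I ⊔ J) → OS(I ⊔ {*}) ⊗ OS(J)`. -/
noncomputable def cocomp (I J : Type) : OS k (I ⊕ J) →ₗ[k] OS k (Option I) ⊗[k] OS k J :=
  LinearMap.applyₗ (1 ⊗ₜ 1) ∘ₗ (cocompAlg k I J).toLinearMap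

end OS
end OrlikSolomon

section OrlikSolomon
variable (k : Type u) [Field k]
namespace OS
variable {A B : Type}

theorem cocomp_one (I J : Type) : cocomp k I J 1 = 1 ⊗ₜ 1 := by
  simp [cocomp]

theorem cocomp_w_mul (I J : Type) (a b : I ⊕ J) (h : a ≠ b) (f : OS k (I ⊕ J)) :
    cocomp k I J (w k a b h * f) = cocompGen k I J a b h (cocomp k I J f) := by
  change cocompAlg k I J (w k a b h * f) (1 ⊗ₜ 1) = _
  rw [map_mul, cocompAlg, lift_w]
  rfl

theorem cocomp_map {I J I' J' : Type} (σ : I ≃ I') (τ : J ≃ J') (f : OS k (I ⊕ J)) :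
    cocomp k I' J' (map k (Equiv.sumCongr σ τ).toEmbedding f) =
      TensorProduct.map (map k (Equiv.optionCongr σ).toEmbedding).toLinearMap
        (map k τ.toEmbedding).toLinearMap (cocomp k I J f) := by
  induction f using induction with
  | one => simp [cocomp_one]
  | add f g hf hg => simp only [map_add, hf, hg]
  | smul c f hf => simp only [map_smul, hf]
  | mul a b h f hf =>
    rw [map_mul, map_w, cocomp_w_mul, hf, cocomp_w_mul]
    generalize cocomp k I J f = t
    induction t using TensorProduct.induction_on with
    | zero => simp only [map_zero]
    | add x y hx hy => simp only [map_add, hx, hy]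
    | tmul x y =>
      rcases a with a | a <;> rcases b with b | b <;>
        simp only [cocompGen, mulL, mulR, TensorProduct.map_tmul, AlgHom.toLinearMap_apply,
          LinearMap.mulLeft_apply, LinearMap.id_apply, map_mul, map_w, ← tau_map] <;> rfl

theorem cocomp_tau {I J : Type} (f : OS k (I ⊕ J)) :
    cocomp k I J (tau k f) =
      TensorProduct.map (tau k).toLinearMap (tau k).toLinearMap (cocomp k I J f) := by
  induction f using induction with
  | one => simp [cocomp_one]
  | add f g hf hg => simp only [map_add, hf, hg]
  | smul c f hf => simp only [map_smul, hf]
  | mul a b h f hf =>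
    rw [map_mul, tau_w, neg_mul, map_neg, cocomp_w_mul, hf, cocomp_w_mul]
    generalize cocomp k I J f = t
    induction t using TensorProduct.induction_on with
    | zero => simp only [map_zero, neg_zero]
    | add x y hx hy => simp only [map_add, neg_add, hx, hy]
    | tmul x y =>
      rcases a with a | a <;> rcases b with b | b <;>
        simp [cocompGen, mulL, mulR, tau_w, TensorProduct.neg_tmul, TensorProduct.tmul_neg]

end OS
end OrlikSolomon

/-! ### The cobar complex of `k[u] ⊗ s²Gerst^∨` -/

section Cobar

variable (k : Type u) [Field k]

/-- The divided power `u^n / n!`. -/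
noncomputable def ud (n : ℕ) : k[X] := Polynomial.monomial n ((n.factorial : k)⁻¹)

/-- The linear map on `k[u]` with prescribed values `u^n / n! ↦ F n` (in characteristic zero). -/
noncomputable def udLift {M : Type*} [AddCommGroup M] [Module k M] (F : ℕ → M) : k[X] →ₗ[k] M :=
  Polynomial.lsum fun n => LinearMap.toSpanSingleton k M ((n.factorial : k) • F n)

theorem udLift_ud [CharZero k] {M : Type*} [AddCommGroup M] [Module k M] (F : ℕ → M) (n : ℕ) :
    udLift k F (ud k n) = F n := by
  have h : (n.factorial : k) ≠ 0 := by exact_mod_cast n.factorial_ne_zero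
  simp [udLift, ud, Polynomial.lsum_apply, smul_smul, h]

/-- `∂/∂u : u^(n+1) / (n+1)! ↦ u^n / n!`. -/
noncomputable def du : k[X] →ₗ[k] k[X] := Polynomial.derivative

/-- `u^n / n! ↦ ∑_{a + b = n} u^a / a! ⊗ u^b / b!`. -/
noncomputable def splitU : k[X] →ₗ[k] k[X] ⊗[k] k[X] :=
  udLift k fun n => ∑ p ∈ Finset.HasAntidiagonal.antidiagonal n, ud k p.1 ⊗ₜ[k] ud k p.2

/-- `u^n / n! ↦ ∑_{a + b = n} u^a / a! ⊗ u^(b+1) / (b+1)!`. -/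
noncomputable def splitShiftU : k[X] →ₗ[k] k[X] ⊗[k] k[X] :=
  udLift k fun n => ∑ p ∈ Finset.HasAntidiagonal.antidiagonal n, ud k p.1 ⊗ₜ[k] ud k (p.2 + 1)

/-- Relabelling on `k[u] ⊗ Gerst^∨`. -/
noncomputable def gmap {A B : Type} (φ : A ↪ B) : k[X] ⊗[k] OS k A →ₗ[k] k[X] ⊗[k] OS k B :=
  TensorProduct.map LinearMap.id (OS.map k φ).toLinearMap

/-- The parity involution of `k[u] ⊗ Gerst^∨`, for the parity in which `u^a f` is `deg f`. -/
noncomputable def gtau {A : Type} : k[X] ⊗[k] OS k A →ₗ[k] k[X] ⊗[k] OS k A :=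
  TensorProduct.map LinearMap.id (OS.tau k).toLinearMap

theorem gmap_refl {A : Type} (x : k[X] ⊗[k] OS k A) :
    gmap k (Equiv.refl A).toEmbedding x = x := by
  have h : (OS.map k (Equiv.refl A).toEmbedding).toLinearMap = LinearMap.id :=
    LinearMap.ext (OS.map_refl k)
  rw [gmap, h, TensorProduct.map_id, LinearMap.id_apply]

theorem gmap_gmap {A B C : Type} (φ : A ↪ B) (ψ : B ↪ C) (x : k[X] ⊗[k] OS k A) :
    gmap k ψ (gmap k φ x) = gmap k (φ.trans ψ) x := by
  have h : (OS.map k ψ).toLinearMap ∘ₗ (OS.map k φ).toLinearMap =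
      (OS.map k (φ.trans ψ)).toLinearMap := LinearMap.ext (OS.map_map k φ ψ)
  rw [gmap, gmap, gmap, ← LinearMap.comp_apply, ← TensorProduct.map_comp, h, LinearMap.id_comp]

theorem gtau_gtau {A : Type} (x : k[X] ⊗[k] OS k A) : gtau k (gtau k x) = x := by
  have h : (OS.tau k).toLinearMap ∘ₗ (OS.tau k).toLinearMap = (LinearMap.id : _ →ₗ[k] OS k A) :=
    LinearMap.ext (OS.tau_tau k)
  rw [gtau, ← LinearMap.comp_apply, ← TensorProduct.map_comp, h, LinearMap.id_comp,
    TensorProduct.map_id, LinearMap.id_apply]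

theorem gtau_gmap {A B : Type} (φ : A ↪ B) (x : k[X] ⊗[k] OS k A) :
    gtau k (gmap k φ x) = gmap k φ (gtau k x) := by
  have h : (OS.tau k).toLinearMap ∘ₗ (OS.map k φ).toLinearMap =
      (OS.map k φ).toLinearMap ∘ₗ (OS.tau k).toLinearMap := LinearMap.ext (OS.tau_map k φ)
  rw [gtau, gmap, gtau, ← LinearMap.comp_apply, ← LinearMap.comp_apply, ← TensorProduct.map_comp,
    ← TensorProduct.map_comp, h]

/-- The species `A ↦ k[u] ⊗ Gerst^∨(A)` with shifted parity: as a generator of the cobar complex,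
`u^a f` has parity `1 + deg f`. -/
noncomputable def genSpecies : SuperSpecies.{u, u} k where
  obj A := k[X] ⊗[k] OS k A
  map σ := gmap k σ.toEmbedding
  map_refl := gmap_refl k
  map_trans σ τ x := gmap_gmap k _ _ x
  sgn := -gtau k
  sgn_sgn x := by simp [gtau_gtau]
  sgn_map σ x := by simp [gtau_gmap]

/-- The operad underlying the cobar complex of `k[u] ⊗ s²Gerst^∨`. -/
noncomputable def Bar : SuperOperad.{u, max 1 u} k := free (genSpecies k)

/-- The corolla decorated by an element of `k[u] ⊗ Gerst^∨(A)`. -/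
noncomputable def corolla {A : Type} (h : 2 ≤ Nat.card A) :
    k[X] ⊗[k] OS k A →ₗ[k] (Bar k).obj A :=
  freeGen (genSpecies k) h

/-- The homological degree: `deg (u^n/n! f) = 3 - 2 |A| - 2 n + deg f` on corollas with inputs `A`,
and degrees add under composition. -/
inductive HasDegree : ∀ {A : Type}, ℤ → (Bar k).obj A → Prop
  | zero {A : Type} (d : ℤ) : HasDegree d (0 : (Bar k).obj A)
  | add {A : Type} (d : ℤ) (x y : (Bar k).obj A) :
      HasDegree d x → HasDegree d y → HasDegree d (x + y)
  | smul {A : Type} (d : ℤ) (c : k) (x : (Bar k).obj A) : HasDegree d x → HasDegree d (c • x)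
  | map {A B : Type} (d : ℤ) (σ : A ≃ B) (x : (Bar k).obj A) :
      HasDegree d x → HasDegree d ((Bar k).map σ x)
  | one : HasDegree 0 (Bar k).one
  | comp {I J : Type} (d e : ℤ) (x : (Bar k).obj (Option I)) (y : (Bar k).obj J) :
      HasDegree d x → HasDegree e y → HasDegree (d + e) ((Bar k).comp x y)
  | corolla {A : Type} (h : 2 ≤ Nat.card A) (n r : ℕ) (f : OS k A) (hf : f ∈ OS.degree k A r) :
      HasDegree (3 - 2 * (Nat.card A : ℤ) - 2 * (n : ℤ) + (r : ℤ)) (corolla k h (ud k n ⊗ₜ f))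

theorem two_le_card_option {I : Type} (h : 1 ≤ Nat.card I) : 2 ≤ Nat.card (Option I) := by
  have : Finite I := Nat.finite_of_card_ne_zero (by omega)
  rw [Finite.card_option]; omega

theorem corolla_map {A B : Type} (hA : 2 ≤ Nat.card A) (hB : 2 ≤ Nat.card B) (σ : A ≃ B)
    (x : k[X] ⊗[k] OS k A) :
    corolla k hB (gmap k σ.toEmbedding x) = (Bar k).map σ (corolla k hA x) :=
  gen_map (genSpecies k) _ hA hB σ x

theorem corolla_gtau {A : Type} (h : 2 ≤ Nat.card A) (x : k[X] ⊗[k] OS k A) :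
    corolla k h (gtau k x) = -(Bar k).sgn (corolla k h x) := by
  have e : -corolla k h (gtau k x) = (Bar k).sgn (corolla k h x) := by
    rw [← map_neg]
    exact gen_sgn (genSpecies k) _ h x
  rw [← e, neg_neg]

/-- The cocomposition of `k[u] ⊗ Gerst^∨`:
`u^n/n! f ↦ ∑_{a+b=n} u^a/a! f^I ⊗ u^b/b! f^J`. -/
noncomputable def gcocomp (I J : Type) :
    k[X] ⊗[k] OS k (I ⊕ J) →ₗ[k] (k[X] ⊗[k] OS k (Option I)) ⊗[k] (k[X] ⊗[k] OS k J) :=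
  (TensorProduct.tensorTensorTensorComm k k[X] k[X] (OS k (Option I)) (OS k J)).toLinearMap ∘ₗ
    TensorProduct.map (splitU k) (OS.cocomp k I J)

theorem gcocomp_natural {I J I' J' : Type} (F : OS k (I ⊕ J) →ₗ[k] OS k (I' ⊕ J'))
    (G : OS k (Option I) →ₗ[k] OS k (Option I')) (H : OS k J →ₗ[k] OS k J')
    (h : ∀ f, OS.cocomp k I' J' (F f) = TensorProduct.map G H (OS.cocomp k I J f))
    (x : k[X] ⊗[k] OS k (I ⊕ J)) :
    gcocomp k I' J' (TensorProduct.map LinearMap.id F x) =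
      TensorProduct.map (TensorProduct.map LinearMap.id G) (TensorProduct.map LinearMap.id H)
        (gcocomp k I J x) := by
  have h1 := TensorProduct.tensorTensorTensorComm_comp_map (R := k)
    (LinearMap.id : k[X] →ₗ[k] k[X]) (LinearMap.id : k[X] →ₗ[k] k[X]) G H
  rw [TensorProduct.map_id] at h1
  have h2 : OS.cocomp k I' J' ∘ₗ F = TensorProduct.map G H ∘ₗ OS.cocomp k I J :=
    LinearMap.ext h
  have h3 : gcocomp k I' J' ∘ₗ TensorProduct.map LinearMap.id F =
      TensorProduct.map (TensorProduct.map LinearMap.id G) (TensorProduct.map LinearMap.id H) ∘ₗ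
        gcocomp k I J := by
    rw [gcocomp, gcocomp, LinearMap.comp_assoc, ← TensorProduct.map_comp, h2, ← LinearMap.comp_assoc,
      ← h1, LinearMap.comp_assoc, ← TensorProduct.map_comp, LinearMap.comp_id, LinearMap.id_comp]
  exact LinearMap.congr_fun h3 x

/-- `x ⊗ y ↦ (-1)^(deg x) x ∘_* y` on corollas. -/
noncomputable def joinCorolla {I J : Type} (hI : 1 ≤ Nat.card I) (hJ : 2 ≤ Nat.card J) :
    (k[X] ⊗[k] OS k (Option I)) ⊗[k] (k[X] ⊗[k] OS k J) →ₗ[k] (Bar k).obj (I ⊕ J) :=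
  TensorProduct.lift ((Bar k).comp.compl₁₂
    (corolla k (two_le_card_option hI) ∘ₗ gtau k) (corolla k hJ))

/-- The part of the differential of a corolla with inputs `I ⊔ J` that puts the inputs `J` on the
upper vertex:
`u^n/n! f ↦ ∑_{a+b=n} (-1)^(deg f^I) u^a/a! f^I ∘_* u^b/b! f^J`. -/
noncomputable def splitCorolla {I J : Type} (hI : 1 ≤ Nat.card I) (hJ : 2 ≤ Nat.card J) :
    k[X] ⊗[k] OS k (I ⊕ J) →ₗ[k] (Bar k).obj (I ⊕ J) :=
  joinCorolla k hI hJ ∘ₗ gcocomp k I J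

theorem splitCorolla_map {I J I' J' : Type} (hI : 1 ≤ Nat.card I) (hJ : 2 ≤ Nat.card J)
    (hI' : 1 ≤ Nat.card I') (hJ' : 2 ≤ Nat.card J') (σ : I ≃ I') (τ : J ≃ J')
    (x : k[X] ⊗[k] OS k (I ⊕ J)) :
    splitCorolla k hI' hJ' (gmap k (Equiv.sumCongr σ τ).toEmbedding x) =
      (Bar k).map (Equiv.sumCongr σ τ) (splitCorolla k hI hJ x) := by
  have h := gcocomp_natural k (OS.map k (Equiv.sumCongr σ τ).toEmbedding).toLinearMap _ _
    (OS.cocomp_map k σ τ) x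
  change joinCorolla k hI' hJ' (gcocomp k I' J' (TensorProduct.map LinearMap.id _ x)) =
    (Bar k).map (Equiv.sumCongr σ τ) (joinCorolla k hI hJ (gcocomp k I J x))
  refine (congrArg _ h).trans ?_
  generalize gcocomp k I J x = t
  suffices joinCorolla k hI' hJ' ∘ₗ TensorProduct.map
      (gmap k (Equiv.optionCongr σ).toEmbedding) (gmap k τ.toEmbedding) =
      (Bar k).map (Equiv.sumCongr σ τ) ∘ₗ joinCorolla k hI hJ from LinearMap.congr_fun this t
  apply TensorProduct.ext'
  intro a b
  change (Bar k).comp (corolla k _ (gtau k (gmap k _ a))) (corolla k hJ' (gmap k _ b)) =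
    (Bar k).map _ ((Bar k).comp (corolla k _ (gtau k a)) (corolla k hJ b))
  rw [gtau_gmap, corolla_map k (two_le_card_option hI), corolla_map k hJ, (Bar k).comp_map]

theorem splitCorolla_gtau {I J : Type} (hI : 1 ≤ Nat.card I) (hJ : 2 ≤ Nat.card J)
    (x : k[X] ⊗[k] OS k (I ⊕ J)) :
    splitCorolla k hI hJ (gtau k x) = (Bar k).sgn (splitCorolla k hI hJ x) := by
  have h := gcocomp_natural k (OS.tau k).toLinearMap _ _ (OS.cocomp_tau k (I := I) (J := J)) x
  change joinCorolla k hI hJ (gcocomp k I J (TensorProduct.map LinearMap.id _ x)) =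
    (Bar k).sgn (joinCorolla k hI hJ (gcocomp k I J x))
  refine (congrArg _ h).trans ?_
  generalize gcocomp k I J x = t
  suffices joinCorolla k hI hJ ∘ₗ TensorProduct.map (gtau k) (gtau k) =
      (Bar k).sgn ∘ₗ joinCorolla k hI hJ from LinearMap.congr_fun this t
  apply TensorProduct.ext'
  intro a b
  change (Bar k).comp (corolla k _ (gtau k (gtau k a))) (corolla k hJ (gtau k b)) =
    (Bar k).sgn ((Bar k).comp (corolla k _ (gtau k a)) (corolla k hJ b))
  rw [(Bar k).sgn_comp, corolla_gtau k _ (gtau k a), corolla_gtau k hJ b, map_neg, map_neg,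
    LinearMap.neg_apply, neg_neg]

end Cobar

section Cobar

variable (k : Type u) [Field k]

/-- The ways to split a label set `A` as `I ⊔ J` with `|I| ≥ 1` and `|J| ≥ 2`, given by `J`. -/
def Cut (A : Type) : Type :=
  {J : Set A // 1 ≤ Nat.card {a : A // a ∉ J} ∧ 2 ≤ Nat.card {a : A // a ∈ J}}

open Classical in
/-- `(A \ J) ⊔ J ≃ A`. -/
noncomputable def cutEquiv {A : Type} (J : Set A) : {a : A // a ∉ J} ⊕ {a : A // a ∈ J} ≃ A :=
  (Equiv.sumComm _ _).trans (Equiv.sumCompl fun a => a ∈ J)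

/-- Relabelling of `A \ J`. -/
def cutMapI {A B : Type} (σ : A ≃ B) (J : Set A) :
    {a : A // a ∉ J} ≃ {b : B // b ∉ σ.symm ⁻¹' J} :=
  σ.subtypeEquiv fun a => by simp

/-- Relabelling of `J`. -/
def cutMapJ {A B : Type} (σ : A ≃ B) (J : Set A) :
    {a : A // a ∈ J} ≃ {b : B // b ∈ σ.symm ⁻¹' J} :=
  σ.subtypeEquiv fun a => by simp

/-- Relabelling of cuts. -/
def cutMap {A B : Type} (σ : A ≃ B) : Cut A ≃ Cut B where
  toFun J := ⟨σ.symm ⁻¹' J.1, by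
    rw [← Nat.card_congr (cutMapI σ J.1), ← Nat.card_congr (cutMapJ σ J.1)]; exact J.2⟩
  invFun J := ⟨σ ⁻¹' J.1, by
    have h := J.2
    rw [Nat.card_congr (cutMapI σ.symm J.1), Nat.card_congr (cutMapJ σ.symm J.1)] at h; exact h⟩
  left_inv J := by apply Subtype.ext; ext; simp
  right_inv J := by apply Subtype.ext; ext; simp

theorem cutEquiv_natural {A B : Type} (σ : A ≃ B) (J : Set A) :
    (Equiv.sumCongr (cutMapI σ J) (cutMapJ σ J)).trans (cutEquiv (σ.symm ⁻¹' J)) =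
      (cutEquiv J).trans σ := by
  ext (a | a) <;> rfl

instance {A : Type} [Finite A] : Finite (Cut A) := Subtype.finite

/-- `splitCorolla` for a splitting `A = I ⊔ J` given by a bijection. -/
noncomputable def cutTermOf {I J A : Type} (hI : 1 ≤ Nat.card I) (hJ : 2 ≤ Nat.card J)
    (e : I ⊕ J ≃ A) : k[X] ⊗[k] OS k A →ₗ[k] (Bar k).obj A :=
  (Bar k).map e ∘ₗ splitCorolla k hI hJ ∘ₗ gmap k e.symm.toEmbedding

theorem cutTermOf_map {I J I' J' A B : Type} (hI : 1 ≤ Nat.card I) (hJ : 2 ≤ Nat.card J)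
    (hI' : 1 ≤ Nat.card I') (hJ' : 2 ≤ Nat.card J') (s : I ≃ I') (t : J ≃ J') (e : I ⊕ J ≃ A)
    (e' : I' ⊕ J' ≃ B) (σ : A ≃ B) (h : (Equiv.sumCongr s t).trans e' = e.trans σ)
    (x : k[X] ⊗[k] OS k A) :
    cutTermOf k hI' hJ' e' (gmap k σ.toEmbedding x) = (Bar k).map σ (cutTermOf k hI hJ e x) := by
  have h' : σ.trans e'.symm = e.symm.trans (Equiv.sumCongr s t) := by
    refine Equiv.ext fun a => ?_
    obtain ⟨y, rfl⟩ := e.surjective a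
    have hy := Equiv.congr_fun h y
    simp only [Equiv.trans_apply, Equiv.symm_apply_apply] at hy ⊢
    rw [Equiv.symm_apply_eq]
    exact hy.symm
  have e1 : gmap k e'.symm.toEmbedding (gmap k σ.toEmbedding x) =
      gmap k (Equiv.sumCongr s t).toEmbedding (gmap k e.symm.toEmbedding x) := by
    have h'' : σ.toEmbedding.trans e'.symm.toEmbedding =
        e.symm.toEmbedding.trans (Equiv.sumCongr s t).toEmbedding := by
      ext a
      exact Equiv.congr_fun h' a
    rw [gmap_gmap, gmap_gmap, h'']
  have e2 := splitCorolla_map k hI hJ hI' hJ' s t (gmap k e.symm.toEmbedding x)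
  have e3 := congrArg ((Bar k).map e') ((congrArg (splitCorolla k hI' hJ') e1).trans e2)
  refine e3.trans (((Bar k).map_trans _ _ _).trans (Eq.trans ?_ ((Bar k).map_trans _ _ _).symm))
  exact congrArg (fun g : I ⊕ J ≃ B => (Bar k).map g _) h

theorem cutTermOf_gtau {I J A : Type} (hI : 1 ≤ Nat.card I) (hJ : 2 ≤ Nat.card J)
    (e : I ⊕ J ≃ A) (x : k[X] ⊗[k] OS k A) :
    cutTermOf k hI hJ e (gtau k x) = (Bar k).sgn (cutTermOf k hI hJ e x) := by
  simp only [cutTermOf, LinearMap.comp_apply]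
  rw [← gtau_gmap, splitCorolla_gtau, (Bar k).sgn_map]

/-- The summand of the differential of a corolla in which the inputs `J` are put on the upper
vertex. -/
noncomputable def cutTerm {A : Type} (J : Cut A) : k[X] ⊗[k] OS k A →ₗ[k] (Bar k).obj A :=
  cutTermOf k J.2.1 J.2.2 (cutEquiv J.1)

theorem cutTerm_map {A B : Type} (σ : A ≃ B) (J : Cut A) (x : k[X] ⊗[k] OS k A) :
    cutTerm k (cutMap σ J) (gmap k σ.toEmbedding x) = (Bar k).map σ (cutTerm k J x) :=
  cutTermOf_map k J.2.1 J.2.2 (cutMap σ J).2.1 (cutMap σ J).2.2 (cutMapI σ J.1) (cutMapJ σ J.1)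
    (cutEquiv J.1) (cutEquiv (cutMap σ J).1) σ (cutEquiv_natural σ J.1) x

theorem cutTerm_gtau {A : Type} (J : Cut A) (x : k[X] ⊗[k] OS k A) :
    cutTerm k J (gtau k x) = (Bar k).sgn (cutTerm k J x) :=
  cutTermOf_gtau k J.2.1 J.2.2 (cutEquiv J.1) x

/-- The cocomposition part of the differential of a corolla:
`u^n/n! f ↦ ∑_{I ⊔ J = A, |I| ≥ 1, |J| ≥ 2} ∑_{a+b=n} (-1)^(deg f^I) u^a/a! f^I ∘_* u^b/b! f^J`. -/
noncomputable def muCorolla {A : Type} : k[X] ⊗[k] OS k A →ₗ[k] (Bar k).obj A :=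
  ∑ᶠ J : Cut A, cutTerm k J

theorem muCorolla_apply {A : Type} [Finite A] (x : k[X] ⊗[k] OS k A) :
    muCorolla k x = ∑ᶠ J : Cut A, cutTerm k J x := by
  have := Fintype.ofFinite (Cut A)
  rw [muCorolla, finsum_eq_sum_of_fintype, finsum_eq_sum_of_fintype, LinearMap.sum_apply]

/-- `∂_u ∂_w` on `k[u] ⊗ Gerst^∨`. -/
noncomputable def duw {A : Type} : k[X] ⊗[k] OS k A →ₗ[k] k[X] ⊗[k] OS k A :=
  TensorProduct.map (du k) (OS.dw k)

theorem duw_gmap {A B : Type} (φ : A ↪ B) (x : k[X] ⊗[k] OS k A) :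
    duw k (gmap k φ x) = gmap k φ (duw k x) := by
  have h : OS.dw k ∘ₗ (OS.map k φ).toLinearMap = (OS.map k φ).toLinearMap ∘ₗ OS.dw k :=
    LinearMap.ext (OS.dw_map k φ)
  rw [duw, gmap, duw, ← LinearMap.comp_apply, ← LinearMap.comp_apply, ← TensorProduct.map_comp,
    ← TensorProduct.map_comp, h, LinearMap.comp_id, LinearMap.id_comp]

theorem duw_gtau {A : Type} (x : k[X] ⊗[k] OS k A) :
    duw k (gtau k x) = -gtau k (duw k x) := by
  have h : OS.dw k ∘ₗ (OS.tau k).toLinearMap =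
      -((OS.tau k).toLinearMap ∘ₗ (OS.dw k : _ →ₗ[k] OS k A)) :=
    LinearMap.ext (OS.dw_tau k)
  rw [duw, gtau, ← LinearMap.comp_apply, ← LinearMap.comp_apply, ← TensorProduct.map_comp,
    ← TensorProduct.map_comp, h, LinearMap.comp_id, LinearMap.id_comp,
    ← neg_one_smul k, TensorProduct.map_smul_right]
  exact neg_one_smul k (TensorProduct.map (du k) ((OS.tau k).toLinearMap ∘ₗ OS.dw k) x)

/-- A derivation given on corollas. -/
noncomputable def mkDer {E : Type} {p : ℕ}
    (F : ∀ {A : Type}, 2 ≤ Nat.card A → k[X] ⊗[k] OS k A →ₗ[k] (Bar k).obj (A ⊕ E))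
    (F_map : ∀ {A B : Type} (hA : 2 ≤ Nat.card A) (hB : 2 ≤ Nat.card B) (σ : A ≃ B)
      (x : k[X] ⊗[k] OS k A), F hB (gmap k σ.toEmbedding x) =
        (Bar k).map (Equiv.sumCongr σ (Equiv.refl E)) (F hA x))
    (F_gtau : ∀ {A : Type} (h : 2 ≤ Nat.card A) (x : k[X] ⊗[k] OS k A),
      F h (gtau k x) = -((-1 : k) ^ p • (Bar k).sgn (F h x))) :
    DerData (genSpecies k) E p where
  toFun h := F h
  toFun_map hA hB σ x := F_map hA hB σ x
  toFun_sgn h x := by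
    have e := F_gtau h x
    change F h (-gtau k x) = _
    rw [map_neg, e, neg_neg]
    rfl

theorem finite_of_two_le {A : Type} (h : 2 ≤ Nat.card A) : Finite A :=
  Nat.finite_of_card_ne_zero (by omega)

/-- The differential on corollas: `∂_u ∂_w` plus the cocomposition. -/
noncomputable def dCorolla {A : Type} (h : 2 ≤ Nat.card A) :
    k[X] ⊗[k] OS k A →ₗ[k] (Bar k).obj A :=
  corolla k h ∘ₗ duw k + muCorolla k

theorem dCorolla_map {A B : Type} (hA : 2 ≤ Nat.card A) (hB : 2 ≤ Nat.card B) (σ : A ≃ B)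
    (x : k[X] ⊗[k] OS k A) :
    dCorolla k hB (gmap k σ.toEmbedding x) = (Bar k).map σ (dCorolla k hA x) := by
  have := finite_of_two_le hA
  have := finite_of_two_le hB
  have := Fintype.ofFinite (Cut A)
  change corolla k hB (duw k (gmap k _ x)) + muCorolla k (gmap k _ x) =
    (Bar k).map σ (corolla k hA (duw k x) + muCorolla k x)
  rw [duw_gmap, corolla_map k hA, map_add ((Bar k).map σ)]
  congr 1
  rw [muCorolla_apply, muCorolla_apply, ← finsum_comp_equiv (cutMap σ)]
  simp only [cutTerm_map]
  rw [finsum_eq_sum_of_fintype, finsum_eq_sum_of_fintype, map_sum]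

theorem dCorolla_gtau {A : Type} (h : 2 ≤ Nat.card A) (x : k[X] ⊗[k] OS k A) :
    dCorolla k h (gtau k x) = (Bar k).sgn (dCorolla k h x) := by
  have := finite_of_two_le h
  have := Fintype.ofFinite (Cut A)
  change corolla k h (duw k (gtau k x)) + muCorolla k (gtau k x) =
    (Bar k).sgn (corolla k h (duw k x) + muCorolla k x)
  rw [duw_gtau, map_neg, corolla_gtau, neg_neg, map_add, muCorolla_apply, muCorolla_apply]
  simp only [cutTerm_gtau]
  rw [finsum_eq_sum_of_fintype, finsum_eq_sum_of_fintype, map_sum]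

/-- The differential on corollas as a derivation that adds no input. -/
noncomputable def dData : DerData (genSpecies k) Empty 1 :=
  mkDer k (fun {A} h => (Bar k).map (Equiv.sumEmpty A Empty).symm ∘ₗ dCorolla k h)
    (by
      intro A B hA hB σ x
      have h : (Equiv.sumEmpty A Empty).symm.trans (Equiv.sumCongr σ (Equiv.refl Empty)) =
          σ.trans (Equiv.sumEmpty B Empty).symm := Equiv.ext fun _ => rfl
      change (Bar k).map _ (dCorolla k hB _) = (Bar k).map _ ((Bar k).map _ (dCorolla k hA x))
      rw [(Bar k).map_trans, h, ← (Bar k).map_trans, dCorolla_map k hA])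
    (by
      intro A h x
      change (Bar k).map _ (dCorolla k h _) = -((-1) ^ 1 • (Bar k).sgn ((Bar k).map _ _))
      rw [dCorolla_gtau, (Bar k).sgn_map, pow_one, neg_smul, one_smul, neg_neg])

/-- The differential `∂_u ∂_w + μ` of the cobar complex, the odd derivation extending `dData`. -/
noncomputable def d {A : Type} : (Bar k).obj A →ₗ[k] (Bar k).obj A :=
  (Bar k).map (Equiv.sumEmpty A Empty) ∘ₗ (dData k).deriv

/-! ### The map `ζ` -/

theorem two_le_card_sum {A : Type} (h : 2 ≤ Nat.card A) : 2 ≤ Nat.card (A ⊕ Unit) := by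
  have := finite_of_two_le h
  rw [Nat.card_sum]; omega

/-- `ι` on corollas: a new input `n`, the label `inr ()`, is added and the decoration is
unchanged. -/
noncomputable def iotaCorolla {A : Type} (h : 2 ≤ Nat.card A) :
    k[X] ⊗[k] OS k A →ₗ[k] (Bar k).obj (A ⊕ Unit) :=
  corolla k (two_le_card_sum h) ∘ₗ gmap k Function.Embedding.inl

theorem iotaCorolla_map {A B : Type} (hA : 2 ≤ Nat.card A) (hB : 2 ≤ Nat.card B) (σ : A ≃ B)
    (x : k[X] ⊗[k] OS k A) :
    iotaCorolla k hB (gmap k σ.toEmbedding x) =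
      (Bar k).map (Equiv.sumCongr σ (Equiv.refl Unit)) (iotaCorolla k hA x) := by
  change corolla k _ (gmap k Function.Embedding.inl (gmap k σ.toEmbedding x)) =
    (Bar k).map _ (corolla k _ (gmap k Function.Embedding.inl x))
  rw [← corolla_map k (two_le_card_sum hA) (two_le_card_sum hB), gmap_gmap, gmap_gmap]
  rfl

theorem iotaCorolla_gtau {A : Type} (h : 2 ≤ Nat.card A) (x : k[X] ⊗[k] OS k A) :
    iotaCorolla k h (gtau k x) = -(Bar k).sgn (iotaCorolla k h x) := by
  change corolla k _ (gmap k _ (gtau k x)) = -(Bar k).sgn (corolla k _ (gmap k _ x))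
  rw [← gtau_gmap, corolla_gtau]

/-- `u^n/n! f ↦ ∑_{a+b=n} (u^a/a! f) ⊗ u^(b+1)/(b+1)!`. -/
noncomputable def shiftOut {A : Type} :
    k[X] ⊗[k] OS k A →ₗ[k] (k[X] ⊗[k] OS k A) ⊗[k] k[X] :=
  (TensorProduct.rightComm k k[X] k[X] (OS k A)).toLinearMap ∘ₗ
    TensorProduct.map (splitShiftU k) LinearMap.id

theorem shiftOut_natural {A B : Type} (F : OS k A →ₗ[k] OS k B) (x : k[X] ⊗[k] OS k A) :
    shiftOut k (TensorProduct.map LinearMap.id F x) =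
      TensorProduct.map (TensorProduct.map LinearMap.id F) LinearMap.id (shiftOut k x) := by
  have h1 : (TensorProduct.rightComm k k[X] k[X] (OS k B)).toLinearMap ∘ₗ
        TensorProduct.map LinearMap.id F =
      TensorProduct.map (TensorProduct.map LinearMap.id F) LinearMap.id ∘ₗ
        (TensorProduct.rightComm k k[X] k[X] (OS k A)).toLinearMap := by
    apply TensorProduct.ext_threefold
    intro a b c
    simp
  have h3 : shiftOut k ∘ₗ TensorProduct.map LinearMap.id F =
      TensorProduct.map (TensorProduct.map LinearMap.id F) LinearMap.id ∘ₗ shiftOut k := by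
    rw [shiftOut, shiftOut, LinearMap.comp_assoc, ← TensorProduct.map_comp, ← LinearMap.comp_assoc,
      ← h1, LinearMap.comp_assoc, ← TensorProduct.map_comp, LinearMap.comp_id, LinearMap.id_comp,
      LinearMap.id_comp, LinearMap.comp_id]
  exact LinearMap.congr_fun h3 x

/-- The binary corolla with inputs `i, j` decorated by `p(u) w_ij`. -/
noncomputable def binary {B : Type} (hB : 2 ≤ Nat.card B) (i j : B) (h : i ≠ j) :
    k[X] →ₗ[k] (Bar k).obj B :=
  corolla k hB ∘ₗ (TensorProduct.mk k k[X] (OS k B)).flip (OS.w k i j h)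

theorem binary_sgn {B : Type} (hB : 2 ≤ Nat.card B) (i j : B) (h : i ≠ j) (p : k[X]) :
    (Bar k).sgn (binary k hB i j h p) = binary k hB i j h p := by
  have := corolla_gtau k hB (p ⊗ₜ OS.w k i j h)
  change (Bar k).sgn (corolla k hB (p ⊗ₜ OS.w k i j h)) = corolla k hB (p ⊗ₜ OS.w k i j h)
  rw [← neg_neg ((Bar k).sgn _), ← this, ← map_neg, gtau, TensorProduct.map_tmul]
  simp [OS.tau_w, TensorProduct.tmul_neg]

open Classical in
/-- `A ≃ (A \ {s}) ⊔ {*}` with `s` going to `*`. -/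
noncomputable def splitAt {A : Type} (s : A) : A ≃ Option {a : A // a ≠ s} :=
  (Equiv.optionSubtypeNe s).symm

/-- `(A \ {s}) ⊔ {s, n} ≃ A ⊔ {n}`. -/
noncomputable def attachEquiv {A : Type} (s : A) : {a : A // a ≠ s} ⊕ (Unit ⊕ Unit) ≃ A ⊕ Unit :=
  (Equiv.sumAssoc _ _ _).symm.trans
    (Equiv.sumCongr ((sumUnit _).trans (splitAt s).symm) (Equiv.refl Unit))

/-- `ς_sn` on corollas, for an input `s`: the binary corolla with inputs `s` and `n` is attached at
the input `s`,
`u^n/n! f ↦ ∑_{a+b=n} u^a/a! f ∘_* u^(b+1)/(b+1)! w_sn`. -/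
noncomputable def sigmaIn {A : Type} (h : 2 ≤ Nat.card A) (s : A) :
    k[X] ⊗[k] OS k A →ₗ[k] (Bar k).obj (A ⊕ Unit) :=
  (Bar k).map (attachEquiv s) ∘ₗ TensorProduct.lift ((Bar k).comp.compl₁₂
    ((Bar k).map (splitAt s) ∘ₗ corolla k h)
    (binary k (B := Unit ⊕ Unit) (by simp) (.inl ()) (.inr ()) (by simp))) ∘ₗ shiftOut k

/-- `ς_0n` on corollas: the corolla is attached to the input `*` of the binary corolla with inputs
`*` and `n`,
`u^n/n! f ↦ -∑_{a+b=n} u^(b+1)/(b+1)! w_*n ∘_* u^a/a! f`. -/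
noncomputable def sigmaOut {A : Type} (h : 2 ≤ Nat.card A) :
    k[X] ⊗[k] OS k A →ₗ[k] (Bar k).obj (A ⊕ Unit) :=
  -((Bar k).map (Equiv.sumComm Unit A) ∘ₗ TensorProduct.lift ((Bar k).comp.flip.compl₁₂
    (corolla k h) (binary k (B := Option Unit) (by simp) none (some ()) (by simp))) ∘ₗ shiftOut k)

/-- Relabelling of `A \ {s}`. -/
def removeMap {A B : Type} (σ : A ≃ B) (s : A) : {a : A // a ≠ s} ≃ {b : B // b ≠ σ s} :=
  σ.subtypeEquiv fun a => by simp

theorem splitAt_natural {A B : Type} (σ : A ≃ B) (s : A) :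
    σ.trans (splitAt (σ s)) = (splitAt s).trans (Equiv.optionCongr (removeMap σ s)) := by
  refine Equiv.ext fun a => ?_
  obtain ⟨y, rfl⟩ := (splitAt s).symm.surjective a
  simp only [Equiv.trans_apply, Equiv.apply_symm_apply]
  rw [← Equiv.eq_symm_apply]
  rcases y with _ | y <;> simp [splitAt, removeMap]

theorem attachEquiv_natural {A B : Type} (σ : A ≃ B) (s : A) :
    (Equiv.sumCongr (removeMap σ s) (Equiv.refl (Unit ⊕ Unit))).trans (attachEquiv (σ s)) =
      (attachEquiv s).trans (Equiv.sumCongr σ (Equiv.refl Unit)) := by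
  refine Equiv.ext fun a => ?_
  rcases a with a | a | a <;> simp [attachEquiv, splitAt, removeMap, sumUnit]

theorem sigmaIn_map {A B : Type} (hA : 2 ≤ Nat.card A) (hB : 2 ≤ Nat.card B) (σ : A ≃ B) (s : A)
    (x : k[X] ⊗[k] OS k A) :
    sigmaIn k hB (σ s) (gmap k σ.toEmbedding x) =
      (Bar k).map (Equiv.sumCongr σ (Equiv.refl Unit)) (sigmaIn k hA s x) := by
  have h := shiftOut_natural k (OS.map k σ.toEmbedding).toLinearMap x
  refine (congrArg (fun t => (Bar k).map (attachEquiv (σ s)) (TensorProduct.lift _ t)) h).trans ?_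
  change _ = (Bar k).map _ ((Bar k).map (attachEquiv s) (TensorProduct.lift _ (shiftOut k x)))
  generalize shiftOut k x = t
  induction t using TensorProduct.induction_on with
  | zero => simp only [map_zero]
  | add x y hx hy => simp only [map_add, hx, hy]
  | tmul a p =>
    change (Bar k).map _ ((Bar k).comp ((Bar k).map _ (corolla k hB (gmap k σ.toEmbedding a)))
        (binary k _ _ _ _ p)) = (Bar k).map _ ((Bar k).map _ ((Bar k).comp
        ((Bar k).map (splitAt s) (corolla k hA a)) (binary k _ _ _ _ p)))
    rw [corolla_map k hA, (Bar k).map_trans, splitAt_natural, ← (Bar k).map_trans,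
      (Bar k).comp_map_left, (Bar k).map_trans, (Bar k).map_trans, attachEquiv_natural]

theorem sigmaIn_gtau {A : Type} (h : 2 ≤ Nat.card A) (s : A) (x : k[X] ⊗[k] OS k A) :
    sigmaIn k h s (gtau k x) = -(Bar k).sgn (sigmaIn k h s x) := by
  have h' := shiftOut_natural k (OS.tau k).toLinearMap x
  refine (congrArg (fun t => (Bar k).map (attachEquiv s) (TensorProduct.lift _ t)) h').trans ?_
  change _ = -(Bar k).sgn ((Bar k).map (attachEquiv s) (TensorProduct.lift _ (shiftOut k x)))
  generalize shiftOut k x = t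
  induction t using TensorProduct.induction_on with
  | zero => simp only [map_zero, neg_zero]
  | add x y hx hy => simp only [map_add, neg_add, hx, hy]
  | tmul a p =>
    change (Bar k).map _ ((Bar k).comp ((Bar k).map _ (corolla k h (gtau k a)))
        (binary k _ _ _ _ p)) = -(Bar k).sgn ((Bar k).map _ ((Bar k).comp
        ((Bar k).map (splitAt s) (corolla k h a)) (binary k _ _ _ _ p)))
    rw [(Bar k).sgn_map, (Bar k).sgn_comp, binary_sgn, (Bar k).sgn_map, corolla_gtau, map_neg,
      map_neg, LinearMap.neg_apply, map_neg]

theorem sigmaOut_map {A B : Type} (hA : 2 ≤ Nat.card A) (hB : 2 ≤ Nat.card B) (σ : A ≃ B)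
    (x : k[X] ⊗[k] OS k A) :
    sigmaOut k hB (gmap k σ.toEmbedding x) =
      (Bar k).map (Equiv.sumCongr σ (Equiv.refl Unit)) (sigmaOut k hA x) := by
  have h := shiftOut_natural k (OS.map k σ.toEmbedding).toLinearMap x
  refine (congrArg (fun t => -(Bar k).map (Equiv.sumComm Unit B) (TensorProduct.lift _ t)) h).trans
    ?_
  change _ = (Bar k).map _ (-(Bar k).map (Equiv.sumComm Unit A)
    (TensorProduct.lift _ (shiftOut k x)))
  generalize shiftOut k x = t
  rw [map_neg]
  congr 1
  induction t using TensorProduct.induction_on with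
  | zero => simp only [map_zero]
  | add x y hx hy => simp only [map_add, hx, hy]
  | tmul a p =>
    change (Bar k).map _ ((Bar k).comp (binary k _ _ _ _ p)
        (corolla k hB (gmap k σ.toEmbedding a))) = (Bar k).map _ ((Bar k).map _ ((Bar k).comp
        (binary k _ _ _ _ p) (corolla k hA a)))
    rw [corolla_map k hA, (Bar k).comp_map_right, (Bar k).map_trans, (Bar k).map_trans]
    congr 2
    ext (a | a) <;> rfl

theorem sigmaOut_gtau {A : Type} (h : 2 ≤ Nat.card A) (x : k[X] ⊗[k] OS k A) :
    sigmaOut k h (gtau k x) = -(Bar k).sgn (sigmaOut k h x) := by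
  have h' := shiftOut_natural k (OS.tau k).toLinearMap x
  refine (congrArg (fun t => -(Bar k).map (Equiv.sumComm Unit A)
    (TensorProduct.lift _ t)) h').trans ?_
  change _ = -(Bar k).sgn (-(Bar k).map (Equiv.sumComm Unit A)
    (TensorProduct.lift _ (shiftOut k x)))
  generalize shiftOut k x = t
  rw [map_neg]
  congr 1
  induction t using TensorProduct.induction_on with
  | zero => simp only [map_zero, neg_zero]
  | add x y hx hy => simp only [map_add, neg_add, hx, hy]
  | tmul a p =>
    change (Bar k).map _ ((Bar k).comp (binary k _ _ _ _ p) (corolla k h (gtau k a))) =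
      -(Bar k).sgn ((Bar k).map _ ((Bar k).comp (binary k _ _ _ _ p) (corolla k h a)))
    rw [(Bar k).sgn_map, (Bar k).sgn_comp, binary_sgn, corolla_gtau, map_neg, map_neg]

/-- The derivation `ι` that adds an input. -/
noncomputable def iotaData : DerData (genSpecies k) Unit 0 :=
  mkDer k (iotaCorolla k) (iotaCorolla_map k)
    (fun h x => by rw [iotaCorolla_gtau, pow_zero, one_smul])

/-- The derivation that is `∑_s ς_sn` on corollas, `s` running over the inputs of the corolla. -/
noncomputable def sigmaInData : DerData (genSpecies k) Unit 0 :=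
  mkDer k (fun {A} h => ∑ᶠ s : A, sigmaIn k h s)
    (by
      intro A B hA hB σ x
      have := finite_of_two_le hA
      have := finite_of_two_le hB
      have := Fintype.ofFinite A
      rw [← finsum_comp_equiv σ, finsum_eq_sum_of_fintype, finsum_eq_sum_of_fintype,
        LinearMap.sum_apply, LinearMap.sum_apply, map_sum]
      exact Finset.sum_congr rfl fun s _ => sigmaIn_map k hA hB σ s x)
    (by
      intro A h x
      have := finite_of_two_le h
      have := Fintype.ofFinite A
      rw [finsum_eq_sum_of_fintype, LinearMap.sum_apply, LinearMap.sum_apply, map_sum, pow_zero,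
        one_smul, ← Finset.sum_neg_distrib]
      exact Finset.sum_congr rfl fun s _ => sigmaIn_gtau k h s x)

/-- The derivation that is `ς_0n` on corollas. -/
noncomputable def sigmaOutData : DerData (genSpecies k) Unit 0 :=
  mkDer k (sigmaOut k) (sigmaOut_map k)
    (fun h x => by rw [sigmaOut_gtau, pow_zero, one_smul])

/-- `ζ = ι + ∑_s ς_sn + ς_0n`, from the inputs `A` to the inputs `A ⊔ {n}`. -/
noncomputable def zetaSum {A : Type} : (Bar k).obj A →ₗ[k] (Bar k).obj (A ⊕ Unit) :=
  (iotaData k).deriv + (sigmaInData k).deriv + (sigmaOutData k).deriv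

/-- `{1, …, n} ⊔ {n + 1} ≃ {1, …, n + 1}`. -/
def addLast (n : ℕ) : Fin n ⊕ Unit ≃ Fin (n + 1) :=
  (sumUnit (Fin n)).trans finSuccEquivLast.symm

/-- The map `ζ_(n+1)` from arity `n` to arity `n + 1`. -/
noncomputable def zeta (n : ℕ) : (Bar k).obj (Fin n) →ₗ[k] (Bar k).obj (Fin (n + 1)) :=
  (Bar k).map (addLast n) ∘ₗ zetaSum k

/-- `nu k n` is the element `ν_(n+2)` of arity `n + 2`: `ν_2 = w_12` and `ν_(i+1) = ζ_(i+1)(ν_i)`.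
-/
noncomputable def nu : (n : ℕ) → (Bar k).obj (Fin (n + 2))
  | 0 => corolla k (by simp) (1 ⊗ₜ OS.w k 0 1 (by simp))
  | n + 1 => zeta k (n + 2) (nu n)

end Cobar

/-! ### The cobar complex of the gravity cooperad -/

section Gravity

variable (k : Type u) [Field k]

/-- `Grav^∨(A) = Gerst^∨(A) / Im ∂_w`. -/
abbrev GravDual (A : Type) : Type u := OS k A ⧸ LinearMap.range (OS.dw k : OS k A →ₗ[k] OS k A)

/-- Relabelling on `Grav^∨`. -/
noncomputable def gravMap {A B : Type} (φ : A ↪ B) : GravDual k A →ₗ[k] GravDual k B :=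
  Submodule.mapQ _ _ (OS.map k φ).toLinearMap (by
    rintro _ ⟨f, rfl⟩
    exact ⟨OS.map k φ f, OS.dw_map k _ f⟩)

/-- The parity involution of `Grav^∨`, for the parity in which the class of `f` is `deg f`. -/
noncomputable def gravTau {A : Type} : GravDual k A →ₗ[k] GravDual k A :=
  Submodule.mapQ _ _ (OS.tau k).toLinearMap (by
    rintro _ ⟨f, rfl⟩
    exact ⟨-OS.tau k f, by rw [map_neg, OS.dw_tau, neg_neg]; rfl⟩)

theorem gravMap_mk {A B : Type} (φ : A ↪ B) (f : OS k A) :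
    gravMap k φ (Submodule.Quotient.mk f) = Submodule.Quotient.mk (OS.map k φ f) := rfl

theorem gravTau_mk {A : Type} (f : OS k A) :
    gravTau k (Submodule.Quotient.mk f) = Submodule.Quotient.mk (OS.tau k f) := rfl

/-- The species `Grav^∨` with shifted parity: as a generator of the cobar complex, the class of
`f` has parity `1 + deg f`. -/
noncomputable def gravSpecies : SuperSpecies.{u, u} k where
  obj A := GravDual k A
  map σ := gravMap k σ.toEmbedding
  map_refl x := by
    obtain ⟨f, rfl⟩ := Submodule.Quotient.mk_surjective _ x
    rw [gravMap_mk, OS.map_refl]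
  map_trans σ τ x := by
    obtain ⟨f, rfl⟩ := Submodule.Quotient.mk_surjective _ x
    rw [gravMap_mk, gravMap_mk, gravMap_mk, OS.map_map]
    rfl
  sgn := -gravTau k
  sgn_sgn x := by
    obtain ⟨f, rfl⟩ := Submodule.Quotient.mk_surjective _ x
    rw [LinearMap.neg_apply, LinearMap.neg_apply, map_neg, neg_neg, gravTau_mk, gravTau_mk,
      OS.tau_tau]
  sgn_map σ x := by
    obtain ⟨f, rfl⟩ := Submodule.Quotient.mk_surjective _ x
    rw [LinearMap.neg_apply, LinearMap.neg_apply, map_neg, gravTau_mk, gravMap_mk, gravTau_mk,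
      gravMap_mk, OS.tau_map]

/-- The operad underlying the cobar complex of `Grav^∨`. -/
noncomputable def BarGrav : SuperOperad.{u, max 1 u} k := free (gravSpecies k)

/-- `u ↦ 0` and the projection `Gerst^∨ → Grav^∨`. -/
noncomputable def augment (A : Type) : k[X] ⊗[k] OS k A →ₗ[k] GravDual k A :=
  TensorProduct.lift (LinearMap.lsmul k (GravDual k A) ∘ₗ Polynomial.lcoeff k 0) ∘ₗ
    TensorProduct.map LinearMap.id (Submodule.mkQ _)

theorem augment_natural {A B : Type} (F : OS k A →ₗ[k] OS k B) (G : GravDual k A →ₗ[k] GravDual k B)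
    (h : ∀ f, G (Submodule.Quotient.mk f) = Submodule.Quotient.mk (F f)) (x : k[X] ⊗[k] OS k A) :
    augment k B (TensorProduct.map LinearMap.id F x) = G (augment k A x) := by
  suffices augment k B ∘ₗ TensorProduct.map LinearMap.id F = G ∘ₗ augment k A from
    LinearMap.congr_fun this x
  apply TensorProduct.ext'
  intro p f
  exact ((map_smul G (p.coeff 0) _).trans (congrArg (p.coeff 0 • ·) (h f))).symm

/-- `ε` on generators. -/
noncomputable def epsData : GenMap (genSpecies k) (BarGrav k) where
  toFun {A} h := freeGen (gravSpecies k) h ∘ₗ augment k A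
  toFun_map {A B} hA hB σ x := by
    refine Eq.trans ?_ (gen_map (gravSpecies k) _ hA hB σ (augment k A x))
    exact congrArg (freeGen (gravSpecies k) hB)
      (augment_natural k _ (gravMap k σ.toEmbedding) (fun _ => rfl) x)
  toFun_sgn {A} h x := by
    refine Eq.trans ?_ (gen_sgn (gravSpecies k) _ h (augment k A x))
    refine congrArg (freeGen (gravSpecies k) h) ?_
    exact (map_neg (augment k A) (gtau k x)).trans (congrArg (fun y => -y)
      (augment_natural k (OS.tau k).toLinearMap (gravTau k) (fun _ => rfl) x))

/-- The morphism of operads `ε` from the cobar complex of `k[u] ⊗ s²Gerst^∨` to that of `Grav^∨`. -/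
noncomputable def eps {A : Type} : (Bar k).obj A →ₗ[k] (BarGrav k).obj A := (epsData k).lift

end Gravity

/-! ### The operad of hypercommutative algebras -/

section Hycomm

variable (k : Type u) [Field k]

/-- One even generator `m_A`, invariant under permutations of the inputs, for every finite set `A`
with at least two elements. -/
def hycommSpecies : SuperSpecies.{u, u} k where
  obj _ := k
  map _ := LinearMap.id
  map_refl _ := rfl
  map_trans _ _ _ := rfl
  sgn := LinearMap.id
  sgn_sgn _ := rfl
  sgn_map _ _ := rfl

/-- `m_(I ⊔ {*}) ∘_* m_J` in the free operad on the generators, for a splitting `A = I ⊔ J`. -/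
noncomputable def hycommCut {A : Type} (J : Cut A) : (free (hycommSpecies k)).obj A :=
  (free (hycommSpecies k)).map (cutEquiv J.1) ((free (hycommSpecies k)).comp
    (freeGen (hycommSpecies k) (two_le_card_option J.2.1) (1 : k))
    (freeGen (hycommSpecies k) J.2.2 (1 : k)))

/-- The relations of hypercommutative algebras: for distinct inputs `a, b, c` of `A`,
`∑ m(m(a, b, x_S), c, x_T) = ∑ m(a, m(b, c, x_S), x_T)`, where the sums are over all splittings
`S ⊔ T` of the other inputs. -/
def HycommRel (A : Type) (t : Term (hycommSpecies k) A) : Prop :=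
  ∃ a b c : A, a ≠ b ∧ b ≠ c ∧ a ≠ c ∧ (Pres.mk t : (free (hycommSpecies k)).obj A) =
    (∑ᶠ (J : Cut A) (_ : a ∈ J.1 ∧ b ∈ J.1 ∧ c ∉ J.1), hycommCut k J) -
    ∑ᶠ (J : Cut A) (_ : b ∈ J.1 ∧ c ∈ J.1 ∧ a ∉ J.1), hycommCut k J

/-- The operad `Hycomm`. -/
noncomputable def Hycomm : SuperOperad.{u, max 1 u} k := presented (hycommSpecies k) (HycommRel k)

/-- The generator `m_A` of `Hycomm`. -/
noncomputable def hycommGen {A : Type} (h : 2 ≤ Nat.card A) : (Hycomm k).obj A :=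
  gen (hycommSpecies k) (HycommRel k) h (1 : k)

/-- The functional on `Gerst^∨(A)` that is `1` on every `w_ij` and `0` in degrees other than one,
seen through `w_ij ↦ ε` into the dual numbers. -/
noncomputable def OS.toDual (A : Type) : OS k A →ₐ[k] TrivSqZeroExt k k :=
  OS.lift k (fun _ _ _ => TrivSqZeroExt.inr 1) (fun _ _ _ => rfl)
    (fun _ _ _ => by simp) (fun _ _ _ _ _ _ => by simp) (fun _ _ _ _ _ _ => by simp)

theorem OS.toDual_dw {A : Type} (f : OS k A) :
    (OS.toDual k A (OS.dw k f)).fst = (OS.toDual k A f).snd ∧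
      (OS.toDual k A (OS.dw k f)).snd = 0 := by
  induction f using OS.induction with
  | one => simp [OS.dw_one]
  | add f g hf hg => simp [hf, hg]
  | smul c f hf => simp [hf]
  | mul i j h f hf =>
    have e : OS.toDual k A (OS.w k i j h) = TrivSqZeroExt.inr 1 := OS.lift_w ..
    simp [OS.dw_w_mul, e, hf]

/-- The functional on `Grav^∨(A)` dual to the gravity generator: it is `1` on the class of every
`w_ij` and vanishes in the other degrees. -/
noncomputable def gravFunctional (A : Type) : GravDual k A →ₗ[k] k :=
  Submodule.liftQ _ (TrivSqZeroExt.sndHom k k ∘ₗ (OS.toDual k A).toLinearMap) (by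
    rintro _ ⟨f, rfl⟩
    exact (OS.toDual_dw k f).2)

theorem OS.toDual_map {A B : Type} (φ : A ↪ B) (f : OS k A) :
    OS.toDual k B (OS.map k φ f) = OS.toDual k A f := by
  induction f using OS.induction with
  | one => simp
  | add f g hf hg => simp only [map_add, hf, hg]
  | smul c f hf => simp only [map_smul, hf]
  | mul i j h f hf =>
    have e : OS.toDual k A (OS.w k i j h) = TrivSqZeroExt.inr 1 := OS.lift_w ..
    have e' : OS.toDual k B (OS.w k (φ i) (φ j) (φ.injective.ne h)) = TrivSqZeroExt.inr 1 :=
      OS.lift_w ..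
    rw [map_mul, map_mul, map_mul, hf, OS.map_w, e, e']

theorem OS.toDual_tau {A : Type} (f : OS k A) :
    (OS.toDual k A (OS.tau k f)).fst = (OS.toDual k A f).fst ∧
      (OS.toDual k A (OS.tau k f)).snd = -(OS.toDual k A f).snd := by
  induction f using OS.induction with
  | one => simp
  | add f g hf hg => simp [hf, hg, add_comm]
  | smul c f hf => simp [hf]
  | mul i j h f hf =>
    have e : OS.toDual k A (OS.w k i j h) = TrivSqZeroExt.inr 1 := OS.lift_w ..
    simp [OS.tau_w, e, hf]

/-- `κ` on generators: the class of `w_ij` goes to `m_A`, classes of other degrees go to zero. -/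
noncomputable def kappaData : GenMap (gravSpecies k) (Hycomm k) where
  toFun {A} h := gen (hycommSpecies k) (HycommRel k) h ∘ₗ gravFunctional k A
  toFun_map {A B} hA hB σ x := by
    obtain ⟨f⟩ := x
    refine Eq.trans ?_ (gen_map (hycommSpecies k) (HycommRel k) hA hB σ
      (gravFunctional k A (Submodule.Quotient.mk f)))
    exact congrArg (fun t : TrivSqZeroExt k k => gen (hycommSpecies k) (HycommRel k) hB t.snd)
      (OS.toDual_map k σ.toEmbedding f)
  toFun_sgn {A} h x := by
    obtain ⟨f⟩ := x
    refine Eq.trans ?_ (gen_sgn (hycommSpecies k) (HycommRel k) h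
      (gravFunctional k A (Submodule.Quotient.mk f)))
    refine congrArg (gen (hycommSpecies k) (HycommRel k) h) ?_
    change gravFunctional k A (-Submodule.Quotient.mk (OS.tau k f)) = (OS.toDual k A f).snd
    rw [map_neg]
    change -(OS.toDual k A (OS.tau k f)).snd = _
    rw [(OS.toDual_tau k f).2, neg_neg]

/-- The morphism of operads `κ` from the cobar complex of `Grav^∨` to `Hycomm`. -/
noncomputable def kappa {A : Type} : (BarGrav k).obj A →ₗ[k] (Hycomm k).obj A := (kappaData k).lift

end Hycomm

end CobarHycom

/-!
The commutator of the two derivations `d` and `ζ` is a derivation, so that `ζ d = d ζ` has to be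
checked on a corolla `u^m/m! f` only (`zetaSum_d_of_corolla`), where it is a matter of comparing
trees.

* The cuts of the label set `A ⊔ {n}` (`cutSum_bijective`) are the cuts of `A` with `n` added to
  the lower or to the upper vertex, which give `ι` applied to the two vertices of `μ(f)`; the cut
  whose lower vertex has `n` as its only input besides the edge; and the cuts whose upper vertex
  has the inputs `s` and `n`. The last two kinds leave the decoration `1` on a binary vertex
  (`cutTerm_cutSum_root`, `cutTerm_cutSum_input`), and cancel against `∂_u ∂_w` applied to the
  binary corollas `u^(b+1)/(b+1)! w` in `ς_0n` and `ς_sn` (`d_graftRootSum`, `d_graftSum`).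
* In `ζ` applied to the composition `f^I ∘_* f^J`, grafting a binary corolla at the internal edge
  occurs once as `ς_*n` of the lower vertex and once, with the opposite sign, as `ς_0n` of the
  upper vertex. What remains is grafting at the inputs and at the root of the whole composition
  (`zetaSum_convComp`), and these are the terms `ς` of `d ζ` in which `d` acts on `f`.

The map `κ ε` kills `d` of a corolla for the following reason. The only contribution is that of the
terms of the cocomposition of `f` with one `w` on each vertex. The relations of `Hycomm` say that
`∑ m ∘_* m` over the splittings `I ⊔ J` with `i, j ∈ J` is an element `T` independent of the pair
`i ≠ j` (`hycommSum_eq`). Writing `f = w_ij g` with `g` linear in the `w`, the terms with `w_ij` on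
the upper vertex contribute `T` times minus the sum of the coefficients of `g`, up to the terms
where `g` is on the upper vertex as well, and the terms with `g` on the upper vertex contribute `T`
times the sum of the coefficients of `g`, up to the same correction (`sum_cutPairing_w_w`).

Finally `ν_n` is a cocycle as `w_12` is one and `ζ` is a chain map. Every term `ς` contains a
positive power of `u` on a binary vertex, and is killed by `ε`; so `ε` takes `ζ` to the derivation
that adds an input to each corolla (`eps_zetaSum`), and `ε(ν_n)` is the corolla `[w_12]` of arity
`n`, which `κ` sends to `m_n`.
-/

namespace CobarHycom

/-! ### Derivations of the operad `Bar` -/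

section Presented

variable {k : Type u} [Field k] {V : SuperSpecies.{u, v} k}

theorem DerData.deriv_sgn {E : Type} {p : ℕ} (δ : DerData V E p) {A : Type}
    (x : (free V).obj A) :
    δ.deriv ((free V).sgn x) = (-1 : k) ^ p • (free V).sgn (δ.deriv x) :=
  congrArg Prod.snd (δ.toGenMap.lift_sgn x)

/-- In a free operad a property holds everywhere as soon as it holds for generators and is
preserved by all operations. -/
theorem free_induction {C : ∀ {A : Type}, (free V).obj A → Prop}
    (zero : ∀ {A : Type}, C (0 : (free V).obj A))
    (add : ∀ {A : Type} (x y : (free V).obj A), C x → C y → C (x + y))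
    (smul : ∀ {A : Type} (c : k) (x : (free V).obj A), C x → C (c • x))
    (map : ∀ {A B : Type} (σ : A ≃ B) (x : (free V).obj A), C x → C ((free V).map σ x))
    (sgn : ∀ {A : Type} (x : (free V).obj A), C x → C ((free V).sgn x))
    (one : C (free V).one)
    (comp : ∀ {I J : Type} (x : (free V).obj (Option I)) (y : (free V).obj J),
      C x → C y → C ((free V).comp x y))
    (gen : ∀ {A : Type} (h : 2 ≤ Nat.card A) (x : V.obj A), C (freeGen V h x))
    {A : Type} (x : (free V).obj A) : C x := by
  suffices H : ∀ {A : Type} (t : Term V A), C (Pres.mk t : (free V).obj A) by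
    obtain ⟨t⟩ := x
    exact H t
  intro A t
  induction t with
  | zero => exact zero
  | add s t hs ht => exact add _ _ hs ht
  | smul c s hs => exact smul c _ hs
  | map σ s hs => exact map σ _ hs
  | sgn s hs => exact sgn _ hs
  | one => exact one
  | comp s t hs ht => exact comp _ _ hs ht
  | gen h x => exact gen h x

end Presented

section Bar

variable (k : Type u) [Field k]

/-- A derivation given on corollas, extended to `Bar`. -/
noncomputable def barDeriv {E : Type} {p : ℕ} (δ : DerData (genSpecies k) E p) {A : Type} :
    (Bar k).obj A →ₗ[k] (Bar k).obj (A ⊕ E) :=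
  δ.deriv

section barDeriv

variable {E : Type} {p : ℕ} (δ : DerData (genSpecies k) E p)

theorem barDeriv_map {A B : Type} (σ : A ≃ B) (x : (Bar k).obj A) :
    barDeriv k δ ((Bar k).map σ x) =
      (Bar k).map (Equiv.sumCongr σ (Equiv.refl E)) (barDeriv k δ x) :=
  δ.deriv_map σ x

theorem barDeriv_sgn {A : Type} (x : (Bar k).obj A) :
    barDeriv k δ ((Bar k).sgn x) = (-1 : k) ^ p • (Bar k).sgn (barDeriv k δ x) :=
  δ.deriv_sgn x

theorem barDeriv_one : barDeriv k δ (Bar k).one = 0 := δ.deriv_one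

theorem barDeriv_comp {I J : Type} (x : (Bar k).obj (Option I)) (y : (Bar k).obj J) :
    barDeriv k δ ((Bar k).comp x y) =
      (Bar k).map (sumSwap I E J)
        ((Bar k).comp ((Bar k).map (optionSum I E) (barDeriv k δ x)) y) +
      (Bar k).map (Equiv.sumAssoc I J E).symm
        ((Bar k).comp ((Bar k).sgnPow p x) (barDeriv k δ y)) :=
  δ.deriv_comp x y

end barDeriv

theorem zetaSum_eq {A : Type} (x : (Bar k).obj A) :
    zetaSum k x = barDeriv k (iotaData k) x + barDeriv k (sigmaInData k) x +
      barDeriv k (sigmaOutData k) x := rfl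

theorem d_eq {A : Type} (x : (Bar k).obj A) :
    d k x = (Bar k).map (Equiv.sumEmpty A Empty) (barDeriv k (dData k) x) := rfl

theorem zetaSum_map {A B : Type} (σ : A ≃ B) (x : (Bar k).obj A) :
    zetaSum k ((Bar k).map σ x) =
      (Bar k).map (Equiv.sumCongr σ (Equiv.refl Unit)) (zetaSum k x) := by
  simp only [zetaSum_eq, barDeriv_map, map_add]

theorem zetaSum_sgn {A : Type} (x : (Bar k).obj A) :
    zetaSum k ((Bar k).sgn x) = (Bar k).sgn (zetaSum k x) := by
  simp only [zetaSum_eq, barDeriv_sgn, map_add, pow_zero, one_smul]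

theorem zetaSum_one : zetaSum k (Bar k).one = 0 := by
  simp only [zetaSum_eq, barDeriv_one, add_zero]

theorem zetaSum_comp {I J : Type} (x : (Bar k).obj (Option I)) (y : (Bar k).obj J) :
    zetaSum k ((Bar k).comp x y) =
      (Bar k).map (sumSwap I Unit J)
        ((Bar k).comp ((Bar k).map (optionSum I Unit) (zetaSum k x)) y) +
      (Bar k).map (Equiv.sumAssoc I J Unit).symm ((Bar k).comp x (zetaSum k y)) := by
  simp only [zetaSum_eq, barDeriv_comp, map_add, LinearMap.add_apply, SuperOperad.sgnPow_zero]
  abel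

theorem zetaSum_corolla {A : Type} [Fintype A] (h : 2 ≤ Nat.card A) (x : k[X] ⊗[k] OS k A) :
    zetaSum k (corolla k h x) =
      iotaCorolla k h x + ∑ s : A, sigmaIn k h s x + sigmaOut k h x := by
  have e : (∑ᶠ s : A, sigmaIn k h s) x = ∑ s : A, sigmaIn k h s x := by
    rw [finsum_eq_sum_of_fintype, LinearMap.sum_apply]
  rw [← e]
  rfl

theorem d_map {A B : Type} (σ : A ≃ B) (x : (Bar k).obj A) :
    d k ((Bar k).map σ x) = (Bar k).map σ (d k x) := by
  rw [d_eq, d_eq, barDeriv_map, (Bar k).map_trans, (Bar k).map_trans]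
  congr 2
  ext (a | a)
  · rfl
  · exact a.elim

theorem d_sgn {A : Type} (x : (Bar k).obj A) :
    d k ((Bar k).sgn x) = -(Bar k).sgn (d k x) := by
  rw [d_eq, d_eq, barDeriv_sgn, pow_one, neg_smul, one_smul, map_neg, (Bar k).sgn_map]

theorem d_one : d k (Bar k).one = 0 := by
  rw [d_eq, barDeriv_one, map_zero]

/-- The Leibniz rule for the differential. -/
theorem d_comp {I J : Type} (x : (Bar k).obj (Option I)) (y : (Bar k).obj J) :
    d k ((Bar k).comp x y) = (Bar k).comp (d k x) y + (Bar k).comp ((Bar k).sgn x) (d k y) := by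
  simp only [d_eq, barDeriv_comp, SuperOperad.sgnPow_succ, SuperOperad.sgnPow_zero, map_add]
  congr 1
  · have e : Equiv.sumEmpty (Option I) Empty =
        (optionSum I Empty).trans (Equiv.optionCongr (Equiv.sumEmpty I Empty)) := by
      ext ((_ | i) | j) <;> first | rfl | exact j.elim
    rw [e, ← (Bar k).map_trans (optionSum I Empty), (Bar k).comp_map_left, (Bar k).map_trans]
    congr 2
    ext ((i | i) | i)
    · rfl
    · exact i.elim
    · rfl
  · rw [(Bar k).comp_map_right, (Bar k).map_trans]
    congr 2
    ext (i | j | j)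
    · rfl
    · rfl
    · exact j.elim

theorem d_corolla {A : Type} (h : 2 ≤ Nat.card A) (x : k[X] ⊗[k] OS k A) :
    d k (corolla k h x) = corolla k h (duw k x) + ∑ᶠ J : Cut A, cutTerm k J x := by
  have := finite_of_two_le h
  rw [← muCorolla_apply]
  change (Bar k).map (Equiv.sumEmpty A Empty) ((Bar k).map (Equiv.sumEmpty A Empty).symm
    (dCorolla k h x)) = _
  rw [(Bar k).map_trans, Equiv.symm_trans_self, (Bar k).map_refl]
  rfl

theorem bar_induction {C : ∀ {A : Type}, (Bar k).obj A → Prop}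
    (zero : ∀ {A : Type}, C (0 : (Bar k).obj A))
    (add : ∀ {A : Type} (x y : (Bar k).obj A), C x → C y → C (x + y))
    (smul : ∀ {A : Type} (c : k) (x : (Bar k).obj A), C x → C (c • x))
    (map : ∀ {A B : Type} (σ : A ≃ B) (x : (Bar k).obj A), C x → C ((Bar k).map σ x))
    (sgn : ∀ {A : Type} (x : (Bar k).obj A), C x → C ((Bar k).sgn x))
    (one : C (Bar k).one)
    (comp : ∀ {I J : Type} (x : (Bar k).obj (Option I)) (y : (Bar k).obj J),
      C x → C y → C ((Bar k).comp x y))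
    (corolla : ∀ {A : Type} (h : 2 ≤ Nat.card A) (x : k[X] ⊗[k] OS k A), C (corolla k h x))
    {A : Type} (x : (Bar k).obj A) : C x :=
  free_induction (V := genSpecies k) zero add smul map sgn one comp corolla x

/-- The commutator of `d` and `ζ` is a derivation, so it vanishes if it vanishes on corollas. -/
theorem zetaSum_d_of_corolla
    (H : ∀ {A : Type} (h : 2 ≤ Nat.card A) (x : k[X] ⊗[k] OS k A),
      zetaSum k (d k (corolla k h x)) = d k (zetaSum k (corolla k h x)))
    {A : Type} (x : (Bar k).obj A) : zetaSum k (d k x) = d k (zetaSum k x) := by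
  induction x using bar_induction with
  | zero => simp only [map_zero]
  | add x y hx hy => simp only [map_add, hx, hy]
  | smul c x hx => simp only [map_smul, hx]
  | map σ x hx => rw [d_map, zetaSum_map, zetaSum_map, d_map, hx]
  | sgn x hx => rw [d_sgn, map_neg, zetaSum_sgn, zetaSum_sgn, d_sgn, hx]
  | one => rw [d_one, zetaSum_one, map_zero, map_zero]
  | comp x y hx hy =>
    rw [d_comp, zetaSum_comp, map_add, zetaSum_comp, zetaSum_comp, map_add, d_map, d_map, d_comp,
      d_comp, d_map, (Bar k).sgn_map, zetaSum_sgn, hx, hy, map_add, map_add]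
    exact add_add_add_comm _ _ _ _
  | corolla h x => exact H h x

end Bar

/-! ### Grafting a binary operation -/

namespace SuperOperad

variable {k : Type u} [Field k] (P : SuperOperad.{u, v} k)

/-- The exchange of parallel compositions involves no sign when one of the two operations is
even, even if the other is not homogeneous. -/
theorem comp_parallel_even [CharZero k] {I J K : Type} (x : P.obj (Option (Option I)))
    (y : P.obj J) (z : P.obj K) (hy : P.sgn y = y) :
    P.comp (P.map (optionSum I J) (P.comp x y)) z = P.map (sumSwap I K J)
      (P.comp (P.map (optionSum I K) (P.comp (P.map (optionSwap I) x) z)) y) := by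
  have hom : ∀ (r : ℕ) (z : P.obj K), P.sgn z = (-1 : k) ^ r • z →
      P.comp (P.map (optionSum I J) (P.comp x y)) z = P.map (sumSwap I K J)
        (P.comp (P.map (optionSum I K) (P.comp (P.map (optionSwap I) x) z)) y) := by
    intro r z hz
    have := P.comp_parallel 0 r x y z (by rw [hy, pow_zero, one_smul]) hz
    rwa [zero_mul, pow_zero, one_smul] at this
  have h0 := hom 0 (z + P.sgn z) (by rw [map_add, P.sgn_sgn, pow_zero, one_smul, add_comm])
  have h1 := hom 1 (z - P.sgn z) (by rw [map_sub, P.sgn_sgn, pow_one, neg_smul, one_smul, neg_sub])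
  have hz : z = (2⁻¹ : k) • ((z + P.sgn z) + (z - P.sgn z)) := by
    rw [add_add_sub_cancel, ← two_smul k z, smul_smul, inv_mul_cancel₀ two_ne_zero, one_smul]
  rw [hz]
  simp only [map_smul, map_add (P.comp _) (z + P.sgn z), map_add (P.map _),
    map_add (P.comp), LinearMap.add_apply, LinearMap.smul_apply, h0, h1]

/-- A binary operation `w` with inputs `s` and `n` attached at the input `s` of `x`; the new
input `n` is `Sum.inr ()`. -/
noncomputable def graft {A : Type} (s : A) :
    P.obj A →ₗ[k] P.obj (Unit ⊕ Unit) →ₗ[k] P.obj (A ⊕ Unit) :=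
  (P.comp.compl₁₂ (P.map (splitAt s)) LinearMap.id).compr₂ (P.map (attachEquiv s))

/-- A binary operation `w` with inputs `*` and `n` to whose input `*` the operation `x` is
attached; the new input `n` is `Sum.inr ()`. -/
noncomputable def graftRoot {A : Type} :
    P.obj (Option Unit) →ₗ[k] P.obj A →ₗ[k] P.obj (A ⊕ Unit) :=
  P.comp.compr₂ (P.map (Equiv.sumComm Unit A))

theorem graft_apply {A : Type} (s : A) (x : P.obj A) (w : P.obj (Unit ⊕ Unit)) :
    P.graft s x w = P.map (attachEquiv s) (P.comp (P.map (splitAt s) x) w) := rfl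

theorem graftRoot_apply {A : Type} (w : P.obj (Option Unit)) (x : P.obj A) :
    P.graftRoot w x = P.map (Equiv.sumComm Unit A) (P.comp w x) := rfl

/-- Grafting at `s` may be computed with any identification of the remaining inputs. -/
theorem graft_eq {A B : Type} (s : A) (e : A ≃ Option B) (he : e s = none) (x : P.obj A)
    (w : P.obj (Unit ⊕ Unit)) :
    P.graft s x w = P.map ((Equiv.sumAssoc B Unit Unit).symm.trans
      (Equiv.sumCongr ((sumUnit B).trans e.symm) (Equiv.refl Unit))) (P.comp (P.map e x) w) := by
  obtain ⟨σ, hσ⟩ : ∃ σ : {a : A // a ≠ s} ≃ B, e = (splitAt s).trans (Equiv.optionCongr σ) := by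
    have h : ∀ a : {a : A // a ≠ s}, ((splitAt s).symm.trans e) (some a) ≠ none := by
      intro a h
      have h' : e a = none := by simpa [splitAt] using h
      exact a.2 (e.injective (h'.trans he.symm))
    refine ⟨Equiv.removeNone ((splitAt s).symm.trans e), ?_⟩
    refine Equiv.ext fun a => ?_
    obtain ⟨y, rfl⟩ := (splitAt s).symm.surjective a
    rcases y with _ | a
    · simpa [splitAt] using he
    · have := Equiv.removeNone_some ((splitAt s).symm.trans e) (Option.ne_none_iff_exists'.1 (h a))
      simp only [Equiv.trans_apply, Equiv.apply_symm_apply, Equiv.optionCongr_apply,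
        Option.map_some]
      exact this.symm
  subst hσ
  rw [graft_apply, ← P.map_trans (splitAt s), P.comp_map_left, P.map_trans]
  congr 2
  refine Equiv.ext fun a => ?_
  rcases a with a | a | a
  · exact congrArg Sum.inl (by simp [sumUnit, Equiv.eq_symm_apply])
  · exact congrArg Sum.inl (by simp [sumUnit, Equiv.eq_symm_apply])
  · rfl

theorem graft_map {A B : Type} (σ : A ≃ B) (s : A) (x : P.obj A) (w : P.obj (Unit ⊕ Unit)) :
    P.graft (σ s) (P.map σ x) w =
      P.map (Equiv.sumCongr σ (Equiv.refl Unit)) (P.graft s x w) := by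
  rw [P.graft_eq (σ s) (σ.symm.trans (splitAt s)) (by simp [splitAt]), graft_apply, P.map_trans,
    P.map_trans, ← Equiv.trans_assoc, Equiv.self_trans_symm, Equiv.refl_trans]
  congr 2
  refine Equiv.ext fun a => ?_
  rcases a with a | a | a <;> simp [attachEquiv, sumUnit]

theorem graftRoot_map {A B : Type} (σ : A ≃ B) (w : P.obj (Option Unit)) (x : P.obj A) :
    P.graftRoot w (P.map σ x) =
      P.map (Equiv.sumCongr σ (Equiv.refl Unit)) (P.graftRoot w x) := by
  rw [graftRoot_apply, graftRoot_apply, P.comp_map_right, P.map_trans, P.map_trans]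
  congr 2
  ext (a | a) <;> rfl

/-- Grafting at an input of the lower operation of a composition. -/
theorem comp_graft_some [CharZero k] {I J : Type} (i : I) (x : P.obj (Option I)) (y : P.obj J)
    (w : P.obj (Unit ⊕ Unit)) (hw : P.sgn w = w) :
    P.map (sumSwap I Unit J) (P.comp (P.map (optionSum I Unit) (P.graft (some i) x w)) y) =
      P.graft (Sum.inl i) (P.comp x y) w := by
  -- Once `i` is split off from `I`, the two graftings are the two orders of a parallel composition.
  have hi : splitAt i i = none := by simp [splitAt]
  generalize splitAt i = e at hi
  rw [P.graft_eq (some i) ((Equiv.optionCongr e).trans (optionSwap _)) (by simp [hi, optionSwap]),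
    P.graft_eq (Sum.inl i) ((Equiv.sumCongr e (Equiv.refl J)).trans (optionSum _ J))
      (by simp [hi, optionSum]), ← P.map_trans (Equiv.optionCongr e) (optionSwap _),
    ← P.map_trans (Equiv.sumCongr e (Equiv.refl J)), ← P.comp_map_left e x y, P.map_trans]
  generalize P.map (Equiv.optionCongr e) x = x'
  have h : (((Equiv.sumAssoc (Option {a : I // a ≠ i}) Unit Unit).symm.trans
      (Equiv.sumCongr ((sumUnit _).trans ((Equiv.optionCongr e).trans (optionSwap _)).symm)
        (Equiv.refl Unit))).trans (optionSum I Unit)) =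
      (optionSum {a : I // a ≠ i} (Unit ⊕ Unit)).trans (Equiv.optionCongr
        ((Equiv.sumAssoc {a : I // a ≠ i} Unit Unit).symm.trans
          (Equiv.sumCongr ((sumUnit _).trans e.symm) (Equiv.refl Unit)))) := by
    refine Equiv.ext fun a => ?_
    rcases a with (_ | a) | a | a <;> rfl
  have h' : (optionSwap {a : I // a ≠ i}).trans (optionSwap _) = Equiv.refl _ :=  by
    ext (_ | _ | a) <;> rfl
  rw [h, ← P.map_trans, P.comp_map_left, P.comp_parallel_even _ _ _ hw, P.map_trans _ _ x', h',
    P.map_refl, P.map_trans, P.map_trans]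
  congr 2
  refine Equiv.ext fun a => ?_
  rcases a with (a | a) | a | a <;> simp [sumUnit, optionSum, sumSwap]

/-- Grafting at an input of the upper operation of a composition. -/
theorem comp_graft_right {I J : Type} (j : J) (x : P.obj (Option I)) (y : P.obj J)
    (w : P.obj (Unit ⊕ Unit)) :
    P.map (Equiv.sumAssoc I J Unit).symm (P.comp x (P.graft j y w)) =
      P.graft (Sum.inr j) (P.comp x y) w := by
  have hj : splitAt j j = none := by simp [splitAt]
  generalize splitAt j = e at hj
  rw [P.graft_eq j e hj, P.graft_eq (Sum.inr j)
    ((Equiv.sumCongr (Equiv.refl I) e).trans (sumOption I _)) (by simp [hj, sumOption]),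
    P.comp_map_right _ x (P.comp _ w), ← P.map_trans (Equiv.sumCongr _ _) (sumOption I _),
    ← P.comp_map_right e x y, P.comp_assoc, P.map_trans, P.map_trans]
  congr 2
  refine Equiv.ext fun a => ?_
  rcases a with a | a | a | a <;> simp [sumUnit, sumOption]

/-- Grafting a binary operation onto the internal edge of a composition, seen from the lower and
from the upper vertex. -/
theorem comp_graft_none {I J : Type} (x : P.obj (Option I)) (y : P.obj J)
    (w : P.obj (Unit ⊕ Unit)) :
    P.map (sumSwap I Unit J) (P.comp (P.map (optionSum I Unit) (P.graft none x w)) y) =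
      P.map (Equiv.sumAssoc I J Unit).symm (P.comp x
        (P.graftRoot (P.map ((Equiv.sumComm Unit Unit).trans (sumUnit Unit)) w) y)) := by
  rw [P.graft_eq none (Equiv.refl (Option I)) rfl, P.map_refl, P.map_trans,
    P.comp_assoc' _ ((Equiv.sumComm Unit Unit).trans (sumUnit Unit)) (Equiv.refl _)
      (by ext (i | i | i) <;> rfl), graftRoot_apply, P.comp_map_right, P.map_trans, P.map_trans]
  congr 2
  ext (i | i | i) <;> rfl

/-- Grafting a composition onto a binary operation. -/
theorem comp_graftRoot {I J : Type} (x : P.obj (Option I)) (y : P.obj J)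
    (w : P.obj (Option Unit)) :
    P.map (sumSwap I Unit J) (P.comp (P.map (optionSum I Unit) (P.graftRoot w x)) y) =
      P.graftRoot w (P.comp x y) := by
  rw [graftRoot_apply, graftRoot_apply, P.map_trans,
    P.comp_assoc' _ (Equiv.refl _) (Equiv.sumComm _ _) (by ext (i | _ | i) <;> rfl), P.map_refl,
    P.map_trans]
  congr 2
  ext (i | i | i) <;> rfl

end SuperOperad

section Bar

variable (k : Type u) [Field k]

theorem d_graft {A : Type} (s : A) (x : (Bar k).obj A) (w : (Bar k).obj (Unit ⊕ Unit)) :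
    d k ((Bar k).graft s x w) =
      (Bar k).graft s (d k x) w + (Bar k).graft s ((Bar k).sgn x) (d k w) := by
  simp only [SuperOperad.graft_apply, d_map, d_comp, map_add, (Bar k).sgn_map]

theorem d_graftRoot {A : Type} (w : (Bar k).obj (Option Unit)) (x : (Bar k).obj A) :
    d k ((Bar k).graftRoot w x) =
      (Bar k).graftRoot (d k w) x + (Bar k).graftRoot ((Bar k).sgn w) (d k x) := by
  simp only [SuperOperad.graftRoot_apply, d_map, d_comp, map_add]

end Bar

/-! ### Coefficients with respect to the divided powers of `u` -/

section DividedPowers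

open Finset.HasAntidiagonal (antidiagonal)

variable (k : Type u) [Field k]

/-- Both sides are the sum of `F a b c` over `a + b + c = m`. -/
theorem sum_antidiagonal_left {M : Type*} [AddCommMonoid M] (F : ℕ → ℕ → ℕ → M) (m : ℕ) :
    ∑ p ∈ antidiagonal m, ∑ q ∈ antidiagonal p.1, F q.1 p.2 q.2 =
      ∑ p ∈ antidiagonal m, ∑ q ∈ antidiagonal p.1, F q.1 q.2 p.2 := by
  rw [Finset.sum_sigma', Finset.sum_sigma']
  refine Finset.sum_nbij' (fun x => ⟨(x.2.1 + x.1.2, x.2.2), (x.2.1, x.1.2)⟩)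
    (fun x => ⟨(x.2.1 + x.1.2, x.2.2), (x.2.1, x.1.2)⟩) ?_ ?_ ?_ ?_ ?_ <;>
    rintro ⟨⟨a, b⟩, ⟨c, e⟩⟩ h <;>
    simp only [Finset.mem_sigma, Finset.HasAntidiagonal.mem_antidiagonal] at h ⊢ <;>
    (obtain ⟨rfl, rfl⟩ := h; first | rfl | exact ⟨by omega, trivial⟩)

/-- Both sides are the sum of `F a b c` over `a + b + c = m`. -/
theorem sum_antidiagonal_right {M : Type*} [AddCommMonoid M] (F : ℕ → ℕ → ℕ → M) (m : ℕ) :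
    ∑ p ∈ antidiagonal m, ∑ q ∈ antidiagonal p.2, F p.1 q.1 q.2 =
      ∑ p ∈ antidiagonal m, ∑ q ∈ antidiagonal p.1, F q.1 q.2 p.2 := by
  rw [Finset.sum_sigma', Finset.sum_sigma']
  refine Finset.sum_nbij' (fun x => ⟨(x.1.1 + x.2.1, x.2.2), (x.1.1, x.2.1)⟩)
    (fun x => ⟨(x.2.1, x.2.2 + x.1.2), (x.2.2, x.1.2)⟩) ?_ ?_ ?_ ?_ ?_ <;>
    rintro ⟨⟨a, b⟩, ⟨c, e⟩⟩ h <;>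
    simp only [Finset.mem_sigma, Finset.HasAntidiagonal.mem_antidiagonal] at h ⊢ <;>
    (obtain ⟨rfl, rfl⟩ := h; first | rfl | exact ⟨by omega, trivial⟩)

/-- In characteristic zero the divided powers of `u` span `k[u]`. -/
theorem tmul_induction [CharZero k] {M : Type*} [AddCommGroup M] [Module k M]
    {C : k[X] ⊗[k] M → Prop} (add : ∀ x y, C x → C y → C (x + y))
    (tmul : ∀ (m : ℕ) (f : M), C (ud k m ⊗ₜ f)) (x : k[X] ⊗[k] M) : C x := by
  induction x using TensorProduct.induction_on with
  | zero => simpa using tmul 0 0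
  | add x y hx hy => exact add x y hx hy
  | tmul p f =>
    induction p using Polynomial.induction_on' with
    | add p q hp hq => rw [TensorProduct.add_tmul]; exact add _ _ hp hq
    | monomial n a =>
      have hn : (n.factorial : k) ≠ 0 := by exact_mod_cast n.factorial_ne_zero
      have e : Polynomial.monomial n a = (a * n.factorial) • ud k n := by
        rw [ud, Polynomial.smul_monomial, smul_eq_mul, mul_assoc, mul_inv_cancel₀ hn, mul_one]
      rw [e, TensorProduct.smul_tmul]
      exact tmul n _

theorem du_ud_zero : du k (ud k 0) = 0 := by
  simp [du, ud]

theorem du_ud_succ [CharZero k] (m : ℕ) : du k (ud k (m + 1)) = ud k m := by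
  have hm : ((m : k) + 1) ≠ 0 := by exact_mod_cast m.succ_ne_zero
  have hn : (m.factorial : k) ≠ 0 := by exact_mod_cast m.factorial_ne_zero
  rw [du, ud, ud, Polynomial.derivative_monomial, Nat.add_sub_cancel]
  congr 1
  rw [Nat.factorial_succ]
  push_cast
  field_simp

theorem duw_ud_zero {A : Type} (f : OS k A) : duw k (ud k 0 ⊗ₜ f) = 0 := by
  rw [duw, TensorProduct.map_tmul, du_ud_zero, TensorProduct.zero_tmul]

theorem duw_ud_succ [CharZero k] {A : Type} (m : ℕ) (f : OS k A) :
    duw k (ud k (m + 1) ⊗ₜ f) = ud k m ⊗ₜ OS.dw k f := by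
  rw [duw, TensorProduct.map_tmul, du_ud_succ]

theorem gmap_ud {A B : Type} (φ : A ↪ B) (m : ℕ) (f : OS k A) :
    gmap k φ (ud k m ⊗ₜ f) = ud k m ⊗ₜ OS.map k φ f := rfl

theorem shiftOut_ud [CharZero k] {A : Type} (m : ℕ) (f : OS k A) :
    shiftOut k (ud k m ⊗ₜ f) =
      ∑ p ∈ antidiagonal m, (ud k p.1 ⊗ₜ[k] f) ⊗ₜ[k] ud k (p.2 + 1) := by
  rw [shiftOut, LinearMap.comp_apply, TensorProduct.map_tmul, splitShiftU, udLift_ud,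
    TensorProduct.sum_tmul, map_sum]
  rfl

theorem gcocomp_ud [CharZero k] {I J : Type} (m : ℕ) (f : OS k (I ⊕ J)) :
    gcocomp k I J (ud k m ⊗ₜ f) = ∑ p ∈ antidiagonal m,
      TensorProduct.map (TensorProduct.mk k k[X] _ (ud k p.1))
        (TensorProduct.mk k k[X] _ (ud k p.2)) (OS.cocomp k I J f) := by
  rw [gcocomp, LinearMap.comp_apply, TensorProduct.map_tmul, splitU, udLift_ud,
    TensorProduct.sum_tmul, map_sum]
  refine Finset.sum_congr rfl fun p _ => ?_
  generalize OS.cocomp k I J f = t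
  induction t using TensorProduct.induction_on with
  | zero => simp only [TensorProduct.tmul_zero, map_zero]
  | add x y hx hy => simp only [TensorProduct.tmul_add, map_add, hx, hy]
  | tmul g h => rfl

/-! ### The maps `ς` on families of coefficients -/

/-- The binary corolla decorated by `u^(b+1)/(b+1)! w_sn`. -/
noncomputable def wIn (b : ℕ) : (Bar k).obj (Unit ⊕ Unit) :=
  binary k (B := Unit ⊕ Unit) (by simp) (.inl ()) (.inr ()) (by simp) (ud k (b + 1))

/-- The binary corolla decorated by `u^(b+1)/(b+1)! w_*n`. -/
noncomputable def wRoot (b : ℕ) : (Bar k).obj (Option Unit) :=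
  binary k (B := Option Unit) (by simp) none (some ()) (by simp) (ud k (b + 1))

theorem sgn_wIn (b : ℕ) : (Bar k).sgn (wIn k b) = wIn k b := binary_sgn k _ _ _ _ _

theorem sgn_wRoot (b : ℕ) : (Bar k).sgn (wRoot k b) = wRoot k b := binary_sgn k _ _ _ _ _

/-- The two encodings of the binary corolla agree, with the input `s` as the label `*`. -/
theorem map_wIn (b : ℕ) :
    (Bar k).map ((Equiv.sumComm Unit Unit).trans (sumUnit Unit)) (wIn k b) = wRoot k b := by
  refine (corolla_map k _ (by simp) _ _).symm.trans (congrArg (corolla k _) ?_)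
  change gmap k _ (ud k (b + 1) ⊗ₜ _) = ud k (b + 1) ⊗ₜ _
  rw [gmap_ud, OS.map_w]
  rfl

/-- A corolla with two inputs has no decomposition, so that its differential is `∂_u ∂_w`. -/
theorem d_corolla_binary {B : Type} (hB : 2 ≤ Nat.card B) (h : Nat.card B = 2)
    (x : k[X] ⊗[k] OS k B) : d k (corolla k hB x) = corolla k hB (duw k x) := by
  have := finite_of_two_le hB
  have hC : IsEmpty (Cut B) := ⟨fun J => by
    have h1 := J.2.1
    have h2 := J.2.2
    have h3 := Nat.card_congr (cutEquiv J.1)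
    rw [Nat.card_sum] at h3
    omega⟩
  rw [d_corolla, finsum_of_isEmpty, add_zero]

theorem d_binary [CharZero k] {B : Type} (hB : 2 ≤ Nat.card B) (hB' : Nat.card B = 2) (i j : B)
    (h : i ≠ j) (b : ℕ) :
    d k (binary k hB i j h (ud k (b + 1))) = corolla k hB (ud k b ⊗ₜ 1) := by
  have e : OS.dw k (OS.w k i j h) = 1 := by
    have := OS.dw_w_mul k i j h 1
    rwa [mul_one, OS.dw_one, mul_zero, sub_zero] at this
  refine (d_corolla_binary k hB hB' _).trans (congrArg (corolla k hB) ?_)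
  refine (duw_ud_succ k b _).trans ?_
  rw [e]

theorem d_wIn [CharZero k] (b : ℕ) :
    d k (wIn k b) = corolla k (A := Unit ⊕ Unit) (by simp) (ud k b ⊗ₜ 1) :=
  d_binary k _ (by simp) _ _ _ b

theorem d_wRoot [CharZero k] (b : ℕ) :
    d k (wRoot k b) = corolla k (A := Option Unit) (by simp) (ud k b ⊗ₜ 1) :=
  d_binary k _ (by simp) _ _ _ b

/-- The coefficient of `u^m/m!` in `ς_sn` of a family of coefficients `Z`, where `Z a` stands for
the coefficient of `u^a/a!` and is an arbitrary element of `Bar`. -/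
noncomputable def graftSum {A : Type} (s : A) (m : ℕ) :
    (ℕ → (Bar k).obj A) →ₗ[k] (Bar k).obj (A ⊕ Unit) :=
  ∑ p ∈ antidiagonal m, (((Bar k).graft s).flip (wIn k p.2)) ∘ₗ LinearMap.proj p.1

/-- The coefficient of `u^m/m!` in `ς_0n` of a family of coefficients. -/
noncomputable def graftRootSum {A : Type} (m : ℕ) :
    (ℕ → (Bar k).obj A) →ₗ[k] (Bar k).obj (A ⊕ Unit) :=
  -∑ p ∈ antidiagonal m, ((Bar k).graftRoot (wRoot k p.2)) ∘ₗ LinearMap.proj p.1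

theorem graftSum_apply {A : Type} (s : A) (m : ℕ) (Z : ℕ → (Bar k).obj A) :
    graftSum k s m Z = ∑ p ∈ antidiagonal m, (Bar k).graft s (Z p.1) (wIn k p.2) := by
  simp [graftSum]

theorem graftRootSum_apply {A : Type} (m : ℕ) (Z : ℕ → (Bar k).obj A) :
    graftRootSum k m Z = -∑ p ∈ antidiagonal m, (Bar k).graftRoot (wRoot k p.2) (Z p.1) := by
  simp [graftRootSum]

theorem graftSum_map {A B : Type} (σ : A ≃ B) (s : A) (m : ℕ) (Z : ℕ → (Bar k).obj A) :
    graftSum k (σ s) m (fun a => (Bar k).map σ (Z a)) =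
      (Bar k).map (Equiv.sumCongr σ (Equiv.refl Unit)) (graftSum k s m Z) := by
  simp only [graftSum_apply, (Bar k).graft_map, map_sum]

theorem graftRootSum_map {A B : Type} (σ : A ≃ B) (m : ℕ) (Z : ℕ → (Bar k).obj A) :
    graftRootSum k m (fun a => (Bar k).map σ (Z a)) =
      (Bar k).map (Equiv.sumCongr σ (Equiv.refl Unit)) (graftRootSum k m Z) := by
  simp only [graftRootSum_apply, (Bar k).graftRoot_map, map_sum, map_neg]

theorem sigmaIn_ud [CharZero k] {A : Type} (h : 2 ≤ Nat.card A) (s : A) (m : ℕ) (f : OS k A) :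
    sigmaIn k h s (ud k m ⊗ₜ f) = graftSum k s m fun a => corolla k h (ud k a ⊗ₜ f) := by
  rw [sigmaIn, LinearMap.comp_apply, LinearMap.comp_apply, shiftOut_ud, map_sum, map_sum,
    graftSum_apply]
  rfl

theorem sigmaOut_ud [CharZero k] {A : Type} (h : 2 ≤ Nat.card A) (m : ℕ) (f : OS k A) :
    sigmaOut k h (ud k m ⊗ₜ f) = graftRootSum k m fun a => corolla k h (ud k a ⊗ₜ f) := by
  rw [sigmaOut, LinearMap.neg_apply, LinearMap.comp_apply, LinearMap.comp_apply, shiftOut_ud,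
    map_sum, map_sum, graftRootSum_apply]
  rfl

theorem zetaSum_corolla_ud [CharZero k] {A : Type} [Fintype A] (h : 2 ≤ Nat.card A) (m : ℕ)
    (f : OS k A) :
    zetaSum k (corolla k h (ud k m ⊗ₜ f)) = iotaCorolla k h (ud k m ⊗ₜ f) +
      ∑ s : A, graftSum k s m (fun a => corolla k h (ud k a ⊗ₜ f)) +
      graftRootSum k m (fun a => corolla k h (ud k a ⊗ₜ f)) := by
  rw [zetaSum_corolla, sigmaOut_ud]
  simp only [sigmaIn_ud]

/-- `ς_sn` commutes with `∂_u ∂_w`. -/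
theorem sigmaIn_duw [CharZero k] {A : Type} (h : 2 ≤ Nat.card A) (s : A) (m : ℕ) (f : OS k A) :
    sigmaIn k h s (duw k (ud k m ⊗ₜ f)) =
      graftSum k s m fun a => corolla k h (duw k (ud k a ⊗ₜ f)) := by
  cases m with
  | zero => simp [graftSum_apply, duw_ud_zero]
  | succ m =>
    rw [duw_ud_succ, sigmaIn_ud, graftSum_apply, graftSum_apply,
      Finset.Nat.sum_antidiagonal_succ]
    simp [duw_ud_zero, duw_ud_succ]

/-- `ς_0n` commutes with `∂_u ∂_w`. -/
theorem sigmaOut_duw [CharZero k] {A : Type} (h : 2 ≤ Nat.card A) (m : ℕ) (f : OS k A) :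
    sigmaOut k h (duw k (ud k m ⊗ₜ f)) =
      graftRootSum k m fun a => corolla k h (duw k (ud k a ⊗ₜ f)) := by
  cases m with
  | zero => simp [graftRootSum_apply, duw_ud_zero]
  | succ m =>
    rw [duw_ud_succ, sigmaOut_ud, graftRootSum_apply, graftRootSum_apply,
      Finset.Nat.sum_antidiagonal_succ]
    simp [duw_ud_zero, duw_ud_succ]

/-- The differential of the binary corolla `u^(b+1)/(b+1)! w` is `u^b/b!`, which gives the second
sum. -/
theorem d_graftSum [CharZero k] {A : Type} (s : A) (m : ℕ) (Z : ℕ → (Bar k).obj A) :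
    d k (graftSum k s m Z) = graftSum k s m (fun a => d k (Z a)) +
      ∑ p ∈ antidiagonal m, (Bar k).graft s ((Bar k).sgn (Z p.1))
        (corolla k (A := Unit ⊕ Unit) (by simp) (ud k p.2 ⊗ₜ 1)) := by
  simp only [graftSum_apply, map_sum, d_graft, d_wIn, Finset.sum_add_distrib]

theorem d_graftRootSum [CharZero k] {A : Type} (m : ℕ) (Z : ℕ → (Bar k).obj A) :
    d k (graftRootSum k m Z) = graftRootSum k m (fun a => d k (Z a)) -
      ∑ p ∈ antidiagonal m, (Bar k).graftRoot
        (corolla k (A := Option Unit) (by simp) (ud k p.2 ⊗ₜ 1)) (Z p.1) := by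
  simp only [graftRootSum_apply, map_sum, map_neg, d_graftRoot, d_wRoot, Finset.sum_add_distrib,
    sgn_wRoot]
  abel

/-- The coefficient of `u^m/m!` in the composition of two families of coefficients. -/
noncomputable def convComp {I J : Type} (m : ℕ) (X : ℕ → (Bar k).obj (Option I))
    (Y : ℕ → (Bar k).obj J) : (Bar k).obj (I ⊕ J) :=
  ∑ p ∈ antidiagonal m, (Bar k).comp (X p.1) (Y p.2)

/-- The value of `ζ` on a composition: the two terms that graft a binary corolla onto the internal
edge cancel, and the other ones graft it onto an input or onto the root of the composition. -/
theorem zetaSum_convComp [CharZero k] {I J : Type} [Fintype I] [Fintype J]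
    (X : ℕ → (Bar k).obj (Option I)) (Y : ℕ → (Bar k).obj J)
    (iX : ℕ → (Bar k).obj (Option I ⊕ Unit)) (iY : ℕ → (Bar k).obj (J ⊕ Unit))
    (hX : ∀ a, zetaSum k (X a) = iX a + ∑ s, graftSum k s a X + graftRootSum k a X)
    (hY : ∀ a, zetaSum k (Y a) = iY a + ∑ s, graftSum k s a Y + graftRootSum k a Y) (m : ℕ) :
    zetaSum k (convComp k m X Y) =
      (Bar k).map (sumSwap I Unit J)
        (convComp k m (fun a => (Bar k).map (optionSum I Unit) (iX a)) Y) +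
      (Bar k).map (Equiv.sumAssoc I J Unit).symm (convComp k m X iY) +
      ∑ s, graftSum k s m (fun a => convComp k a X Y) +
      graftRootSum k m (fun a => convComp k a X Y) := by
  have hw := sgn_wIn k
  simp only [convComp, map_sum, zetaSum_comp, hX, hY, Fintype.sum_option, Fintype.sum_sum_type,
    graftSum_apply, graftRootSum_apply, map_add, map_neg, LinearMap.add_apply, LinearMap.neg_apply,
    LinearMap.sum_apply, Finset.sum_add_distrib, Finset.sum_neg_distrib,
    (Bar k).comp_graft_some _ _ _ _ (hw _), (Bar k).comp_graft_right, (Bar k).comp_graft_none,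
    (Bar k).comp_graftRoot, map_wIn]
  have h1 := sum_antidiagonal_left (fun a b c => (Bar k).map (Equiv.sumAssoc I J Unit).symm
    ((Bar k).comp (X a) ((Bar k).graftRoot (wRoot k c) (Y b)))) m
  have h2 := sum_antidiagonal_right (fun a b c => (Bar k).map (Equiv.sumAssoc I J Unit).symm
    ((Bar k).comp (X a) ((Bar k).graftRoot (wRoot k c) (Y b)))) m
  have h3 := sum_antidiagonal_left (fun a b c =>
    (Bar k).graftRoot (wRoot k c) ((Bar k).comp (X a) (Y b))) m
  have h4 : ∀ i : I, _ := fun i => sum_antidiagonal_left (fun a b c =>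
    (Bar k).graft (Sum.inl i) ((Bar k).comp (X a) (Y b)) (wIn k c)) m
  have h5 : ∀ j : J, _ := fun j => sum_antidiagonal_right (fun a b c =>
    (Bar k).graft (Sum.inr j) ((Bar k).comp (X a) (Y b)) (wIn k c)) m
  rw [Finset.sum_comm (s := antidiagonal m) (t := Finset.univ),
    Finset.sum_comm (s := antidiagonal m) (t := Finset.univ), h1, h2, h3]
  simp only [h4, h5]
  abel

end DividedPowers

/-! ### The cocomposition and injections of label sets -/

namespace OS

variable (k : Type u) [Field k]

theorem cocomp_map_embedding {I J I' J' : Type} (σ : I ↪ I') (τ : J ↪ J') (f : OS k (I ⊕ J)) :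
    cocomp k I' J' (map k (σ.sumMap τ) f) =
      TensorProduct.map (map k σ.optionMap).toLinearMap (map k τ).toLinearMap
        (cocomp k I J f) := by
  induction f using induction with
  | one => simp [cocomp_one]
  | add f g hf hg => simp only [map_add, hf, hg]
  | smul c f hf => simp only [map_smul, hf]
  | mul a b h f hf =>
    rw [map_mul, map_w, cocomp_w_mul, hf, cocomp_w_mul]
    generalize cocomp k I J f = t
    induction t using TensorProduct.induction_on with
    | zero => simp only [map_zero]
    | add x y hx hy => simp only [map_add, hx, hy]
    | tmul x y =>
      rcases a with a | a <;> rcases b with b | b <;>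
        simp only [cocompGen, mulL, mulR, TensorProduct.map_tmul, AlgHom.toLinearMap_apply,
          LinearMap.mulLeft_apply, LinearMap.id_apply, map_mul, map_w, ← tau_map] <;> rfl

/-- If at most one of the labels of `f` goes to the upper vertex, the upper factor of the
cocomposition of `f` is trivial. -/
theorem cocomp_map_of_collapse {A I J : Type} (φ : A ↪ I ⊕ J) (ψ : A ↪ Option I)
    (h : ∀ a, ψ a = Sum.elim some (fun _ => none) (φ a)) (f : OS k A) :
    cocomp k I J (map k φ f) = map k ψ f ⊗ₜ 1 := by
  induction f using induction with
  | one => simp [cocomp_one]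
  | add f g hf hg => simp only [map_add, hf, hg, TensorProduct.add_tmul]
  | smul c f hf => simp only [map_smul, hf, TensorProduct.smul_tmul']
  | mul i j hij f hf =>
    rw [map_mul, map_w, cocomp_w_mul, hf, map_mul, map_w]
    have key : ∀ (a b : I ⊕ J) (hab : a ≠ b) (a' b' : Option I) (hab' : a' ≠ b'),
        a' = Sum.elim some (fun _ => none) a → b' = Sum.elim some (fun _ => none) b →
        cocompGen k I J a b hab (map k ψ f ⊗ₜ 1) = (w k a' b' hab' * map k ψ f) ⊗ₜ 1 := by
      rintro (a | a) (b | b) hab a' b' hab' rfl rfl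
      · rfl
      · rfl
      · rfl
      · exact absurd rfl hab'
    exact key _ _ _ _ _ _ (h i) (h j)

/-- If all labels of `f` are on the upper vertex, the lower factor of the cocomposition of `f` is
trivial. -/
theorem cocomp_map_inr {I J : Type} (f : OS k J) :
    cocomp k I J (map k Function.Embedding.inr f) = 1 ⊗ₜ f := by
  induction f using induction with
  | one => simp [cocomp_one]
  | add f g hf hg => simp only [map_add, hf, hg, TensorProduct.tmul_add]
  | smul c f hf => simp only [map_smul, hf, TensorProduct.tmul_smul]
  | mul i j hij f hf =>
    rw [map_mul, map_w, cocomp_w_mul, hf]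
    change TensorProduct.map _ _ _ = _
    rw [TensorProduct.map_tmul]
    simp

end OS

/-! ### The map `ζ` on the cocomposition of a corolla -/

section Join

open Finset.HasAntidiagonal (antidiagonal)

variable (k : Type u) [Field k]

/-- The coefficient of `u^m/m!` in the composition of the corollas decorated by the two factors of
an element of `OS(I ⊔ {*}) ⊗ OS(J)`. -/
noncomputable def joinSum {I J : Type} (hI : 1 ≤ Nat.card I) (hJ : 2 ≤ Nat.card J) (m : ℕ) :
    OS k (Option I) ⊗[k] OS k J →ₗ[k] (Bar k).obj (I ⊕ J) :=
  ∑ p ∈ antidiagonal m, joinCorolla k hI hJ ∘ₗ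
    TensorProduct.map (TensorProduct.mk k k[X] _ (ud k p.1)) (TensorProduct.mk k k[X] _ (ud k p.2))

theorem joinSum_tmul {I J : Type} (hI : 1 ≤ Nat.card I) (hJ : 2 ≤ Nat.card J) (m : ℕ)
    (g : OS k (Option I)) (h : OS k J) :
    joinSum k hI hJ m (g ⊗ₜ h) = convComp k m
      (fun a => corolla k (two_le_card_option hI) (ud k a ⊗ₜ OS.tau k g))
      (fun b => corolla k hJ (ud k b ⊗ₜ h)) := by
  rw [joinSum, LinearMap.sum_apply]
  rfl

theorem splitCorolla_ud [CharZero k] {I J : Type} (hI : 1 ≤ Nat.card I) (hJ : 2 ≤ Nat.card J)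
    (m : ℕ) (f : OS k (I ⊕ J)) :
    splitCorolla k hI hJ (ud k m ⊗ₜ f) = joinSum k hI hJ m (OS.cocomp k I J f) := by
  rw [splitCorolla, LinearMap.comp_apply, gcocomp_ud, map_sum, joinSum, LinearMap.sum_apply]
  rfl

theorem cutTermOf_ud [CharZero k] {I J A B : Type} (hI : 1 ≤ Nat.card I) (hJ : 2 ≤ Nat.card J)
    (e : I ⊕ J ≃ B) (φ : A ↪ B) (m : ℕ) (f : OS k A) :
    cutTermOf k hI hJ e (gmap k φ (ud k m ⊗ₜ f)) = (Bar k).map e (joinSum k hI hJ m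
      (OS.cocomp k I J (OS.map k (φ.trans e.symm.toEmbedding) f))) := by
  rw [cutTermOf, LinearMap.comp_apply, LinearMap.comp_apply, gmap_gmap, gmap_ud, splitCorolla_ud]

theorem one_le_card_sum {I : Type} (h : 1 ≤ Nat.card I) : 1 ≤ Nat.card (I ⊕ Unit) := by
  have : Finite I := Nat.finite_of_card_ne_zero (by omega)
  rw [Nat.card_sum]; omega

/-- The value of `ζ` on the composition of two corollas. -/
theorem zetaSum_joinSum [CharZero k] {I J : Type} [Fintype I] [Fintype J] (hI : 1 ≤ Nat.card I)
    (hJ : 2 ≤ Nat.card J) (m : ℕ) (t : OS k (Option I) ⊗[k] OS k J) :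
    zetaSum k (joinSum k hI hJ m t) =
      (Bar k).map (sumSwap I Unit J) (joinSum k (one_le_card_sum hI) hJ m
        (TensorProduct.map (OS.map k (Function.Embedding.inl (β := Unit)).optionMap).toLinearMap
          LinearMap.id t)) +
      (Bar k).map (Equiv.sumAssoc I J Unit).symm (joinSum k hI (two_le_card_sum hJ) m
        (TensorProduct.map LinearMap.id (OS.map k Function.Embedding.inl).toLinearMap t)) +
      ∑ s, graftSum k s m (fun a => joinSum k hI hJ a t) +
      graftRootSum k m (fun a => joinSum k hI hJ a t) := by
  induction t using TensorProduct.induction_on with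
  | zero => simp [graftSum_apply, graftRootSum_apply]
  | add x y hx hy =>
    have e : (fun a => joinSum k hI hJ a (x + y)) =
        (fun a => joinSum k hI hJ a x) + (fun a => joinSum k hI hJ a y) :=
      funext fun a => map_add _ _ _
    rw [e]
    simp only [map_add, hx, hy, Finset.sum_add_distrib]
    abel
  | tmul g h =>
    simp only [joinSum_tmul, TensorProduct.map_tmul]
    rw [zetaSum_convComp k _ _ _ _
      (fun a => zetaSum_corolla_ud k (two_le_card_option hI) a (OS.tau k g))
      (fun b => zetaSum_corolla_ud k hJ b h)]
    congr 4
    refine congrArg (fun X => convComp k m X _) (funext fun a => ?_)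
    refine (corolla_map k _ (two_le_card_option (one_le_card_sum hI)) (optionSum I Unit)
      _).symm.trans (congrArg (corolla k _) ?_)
    rw [gmap_gmap, gmap_ud]
    refine congrArg (ud k a ⊗ₜ[k] ·) ?_
    change OS.map k _ _ = OS.tau k (OS.map k _ g)
    rw [OS.tau_map]
    congr 2
    ext (_ | i) <;> rfl

end Join

/-! ### Cuts of a label set with an additional label -/

section Cuts

variable (k : Type u) [Field k]

theorem one_le_card_compl_iff {A : Type} [Finite A] (J : Set A) :
    1 ≤ Nat.card {a : A // a ∉ J} ↔ ∃ a, a ∉ J := by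
  rw [Nat.one_le_iff_ne_zero, ← Nat.pos_iff_ne_zero, Finite.card_pos_iff, nonempty_subtype]

theorem two_le_card_iff {A : Type} [Finite A] (J : Set A) :
    2 ≤ Nat.card {a : A // a ∈ J} ↔ ∃ a ∈ J, ∃ b ∈ J, a ≠ b := by
  change 1 < _ ↔ _
  rw [Finite.one_lt_card_iff_nontrivial]
  exact (Set.nontrivial_coe_sort (s := J))

/-- The summand of the differential belonging to a cut may be computed with any bijection
`I ⊔ J ≃ A` whose upper part is the cut. -/
theorem cutTerm_eq_cutTermOf {I J A : Type} (hI : 1 ≤ Nat.card I) (hJ : 2 ≤ Nat.card J)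
    (e : I ⊕ J ≃ A) (K : Cut A) (hl : ∀ i, e (Sum.inl i) ∉ K.1) (hr : ∀ j, e (Sum.inr j) ∈ K.1)
    (x : k[X] ⊗[k] OS k A) : cutTerm k K x = cutTermOf k hI hJ e x := by
  let s : I ≃ {a : A // a ∉ K.1} := Equiv.ofBijective (fun i => ⟨e (Sum.inl i), hl i⟩)
    ⟨fun i i' h => Sum.inl_injective (e.injective (congrArg Subtype.val h)), fun a => by
      obtain ⟨a, ha⟩ := a
      obtain ⟨i | j, rfl⟩ := e.surjective a
      · exact ⟨i, rfl⟩
      · exact absurd (hr j) ha⟩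
  let t : J ≃ {a : A // a ∈ K.1} := Equiv.ofBijective (fun j => ⟨e (Sum.inr j), hr j⟩)
    ⟨fun i i' h => Sum.inr_injective (e.injective (congrArg Subtype.val h)), fun a => by
      obtain ⟨a, ha⟩ := a
      obtain ⟨i | j, rfl⟩ := e.surjective a
      · exact absurd ha (hl i)
      · exact ⟨j, rfl⟩⟩
  have h := cutTermOf_map k hI hJ K.2.1 K.2.2 s t e (cutEquiv K.1) (Equiv.refl A)
    (by ext (i | j) <;> rfl) x
  rwa [gmap_refl, (Bar k).map_refl] at h

variable {A : Type} [Finite A] (h : 2 ≤ Nat.card A)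

/-- The cuts of `A ⊔ {n}`: the label `n` may be added to the lower or to the upper vertex of a cut
of `A`; or the lower vertex is binary with `n` as its only input; or the upper vertex is binary
with inputs `s` and `n`. -/
def cutSum : (Cut A ⊕ Cut A) ⊕ (Unit ⊕ A) → Cut (A ⊕ Unit)
  | .inl (.inl J) => ⟨Sum.inl '' J.1, by
      have h1 := (one_le_card_compl_iff _).1 J.2.1
      have h2 := (two_le_card_iff _).1 J.2.2
      rw [one_le_card_compl_iff, two_le_card_iff]
      simpa using h2⟩
  | .inl (.inr J) => ⟨insert (Sum.inr ()) (Sum.inl '' J.1), by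
      have h1 := (one_le_card_compl_iff _).1 J.2.1
      have h2 := (two_le_card_iff _).1 J.2.2
      rw [one_le_card_compl_iff, two_le_card_iff]
      obtain ⟨a, ha⟩ := h1
      obtain ⟨b, hb, -⟩ := h2
      exact ⟨⟨Sum.inl a, by simpa using ha⟩, Sum.inr (), by simp, Sum.inl b, by simpa using hb,
        by simp⟩⟩
  | .inr (.inl _) => ⟨Set.range Sum.inl, by
      rw [one_le_card_compl_iff, two_le_card_iff]
      have : Nontrivial A := Finite.one_lt_card_iff_nontrivial.1 h
      obtain ⟨a, b, hab⟩ := exists_pair_ne A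
      exact ⟨⟨Sum.inr (), by simp⟩, Sum.inl a, by simp, Sum.inl b, by simp, by simpa using hab⟩⟩
  | .inr (.inr s) => ⟨{Sum.inl s, Sum.inr ()}, by
      rw [one_le_card_compl_iff, two_le_card_iff]
      have : Nontrivial A := Finite.one_lt_card_iff_nontrivial.1 h
      obtain ⟨a, ha⟩ := exists_ne s
      exact ⟨⟨Sum.inl a, by simpa using ha⟩, Sum.inl s, by simp, Sum.inr (), by simp, by simp⟩⟩

theorem cutSum_bijective : Function.Bijective (cutSum h) := by
  -- A cut is determined by which of the labels it contains.
  have inl_mem : ∀ x a, Sum.inl a ∈ (cutSum h x).1 ↔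
      Sum.elim (Sum.elim (fun J => a ∈ J.1) (fun J => a ∈ J.1))
        (Sum.elim (fun _ => True) (fun s => a = s)) x := by
    rintro ((J | J) | _ | s) a <;> simp [cutSum]
  have inr_mem : ∀ x, Sum.inr () ∈ (cutSum h x).1 ↔
      Sum.elim (Sum.elim (fun _ => False) (fun _ => True))
        (Sum.elim (fun _ => False) (fun _ => True)) x := by
    rintro ((J | J) | _ | s) <;> simp [cutSum]
  constructor
  · intro x y hxy
    have e1 : ∀ a, _ ↔ _ := fun a => (inl_mem x a).symm.trans ((by rw [hxy]) : _ ↔ _)|>.trans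
      (inl_mem y a)
    have e2 := (inr_mem x).symm.trans ((by rw [hxy]) : _ ↔ _)|>.trans (inr_mem y)
    rcases x with (J | J) | _ | s <;> rcases y with (J' | J') | _ | s' <;>
      simp only [Sum.elim_inl, Sum.elim_inr, iff_false, iff_true, not_true, true_iff] at e1 e2
    · rw [Subtype.ext (Set.ext e1) (a1 := J) (a2 := J')]
    · obtain ⟨a, ha⟩ := (one_le_card_compl_iff _).1 J.2.1
      exact absurd (e1 a) ha
    · rw [Subtype.ext (Set.ext e1) (a1 := J) (a2 := J')]
    · obtain ⟨a, ha, b, hb, hab⟩ := (two_le_card_iff _).1 J.2.2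
      exact absurd (((e1 a).1 ha).trans ((e1 b).1 hb).symm) hab
    · obtain ⟨a, ha⟩ := (one_le_card_compl_iff _).1 J'.2.1
      exact absurd (e1 a) ha
    · rfl
    · obtain ⟨a, ha, b, hb, hab⟩ := (two_le_card_iff _).1 J'.2.2
      exact absurd (((e1 a).2 ha).trans ((e1 b).2 hb).symm) hab
    · rw [(e1 s).1 rfl]
  · intro K
    obtain ⟨h1, h2⟩ := K.2
    rw [one_le_card_compl_iff] at h1
    rw [two_le_card_iff] at h2
    suffices H : ∃ x, (∀ a, Sum.inl a ∈ (cutSum h x).1 ↔ Sum.inl a ∈ K.1) ∧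
        (Sum.inr () ∈ (cutSum h x).1 ↔ Sum.inr () ∈ K.1) by
      obtain ⟨x, hx, hx'⟩ := H
      refine ⟨x, Subtype.ext (Set.ext ?_)⟩
      rintro (a | a)
      · exact hx a
      · exact hx'
    simp only [inl_mem, inr_mem]
    by_cases hn : Sum.inr () ∈ K.1
    · by_cases hJ : ∃ a, Sum.inl a ∈ K.1 ∧ ∃ b, Sum.inl b ∈ K.1 ∧ a ≠ b
      · refine ⟨.inl (.inr ⟨Sum.inl ⁻¹' K.1, ?_, ?_⟩), fun a => Iff.rfl,
          fun _ => hn, fun _ => trivial⟩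
        · rw [one_le_card_compl_iff]
          obtain ⟨a | a, ha⟩ := h1
          · exact ⟨a, ha⟩
          · exact absurd hn ha
        · rw [two_le_card_iff]
          exact hJ
      · push Not at hJ
        obtain ⟨s, hs⟩ : ∃ s, Sum.inl s ∈ K.1 := by
          obtain ⟨a | a, ha, b | b, hb, hab⟩ := h2
          · exact ⟨a, ha⟩
          · exact ⟨a, ha⟩
          · exact ⟨b, hb⟩
          · exact absurd rfl hab
        exact ⟨.inr (.inr s), fun a => ⟨fun e => by rw [show a = s from e]; exact hs,
          fun ha => hJ a ha s hs⟩, by simpa using hn⟩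
    · by_cases hJ : ∃ a, Sum.inl a ∉ K.1
      · refine ⟨.inl (.inl ⟨Sum.inl ⁻¹' K.1, ?_, ?_⟩), fun a => Iff.rfl,
          fun e => e.elim, fun e => hn e⟩
        · rw [one_le_card_compl_iff]
          exact hJ
        · rw [two_le_card_iff]
          obtain ⟨a | a, ha, b | b, hb, hab⟩ := h2
          · exact ⟨a, ha, b, hb, fun e => hab (congrArg _ e)⟩
          · exact absurd hb hn
          · exact absurd ha hn
          · exact absurd ha hn
      · push Not at hJ
        exact ⟨.inr (.inl ()), fun a => ⟨fun _ => hJ a, fun _ => trivial⟩, by simpa using hn⟩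

end Cuts

/-! ### The commutator of `d` and `ζ` -/

section Commutator

open Finset.HasAntidiagonal (antidiagonal)

variable (k : Type u) [Field k]

theorem duw_iota {A : Type} (h : 2 ≤ Nat.card A) (x : k[X] ⊗[k] OS k A) :
    iotaCorolla k h (duw k x) =
      corolla k (two_le_card_sum h) (duw k (gmap k Function.Embedding.inl x)) := by
  rw [duw_gmap]
  rfl

theorem cutTerm_ud [CharZero k] {A : Type} (J : Cut A) (m : ℕ) (f : OS k A) :
    cutTerm k J (ud k m ⊗ₜ f) = (Bar k).map (cutEquiv J.1) (joinSum k J.2.1 J.2.2 m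
      (OS.cocomp k _ _ (OS.map k (cutEquiv J.1).symm.toEmbedding f))) := by
  have := cutTermOf_ud k J.2.1 J.2.2 (cutEquiv J.1) (Equiv.refl A).toEmbedding m f
  rwa [gmap_refl] at this

section cutSum

variable [CharZero k] {A : Type} [Finite A] (h : 2 ≤ Nat.card A)

/-- The cut with `n` added to the lower vertex gives `ι` of the lower vertex. -/
theorem cutTerm_cutSum_lower (J : Cut A) (m : ℕ) (f : OS k A) :
    cutTerm k (cutSum h (.inl (.inl J))) (gmap k Function.Embedding.inl (ud k m ⊗ₜ f)) =
      (Bar k).map (Equiv.sumCongr (cutEquiv J.1) (Equiv.refl Unit))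
        ((Bar k).map (sumSwap _ Unit _) (joinSum k (one_le_card_sum J.2.1) J.2.2 m
          (TensorProduct.map (OS.map k (Function.Embedding.inl (β := Unit)).optionMap).toLinearMap
            LinearMap.id
            (OS.cocomp k _ _ (OS.map k (cutEquiv J.1).symm.toEmbedding f))))) := by
  rw [cutTerm_eq_cutTermOf k (one_le_card_sum J.2.1) J.2.2
    ((sumSwap _ Unit _).trans (Equiv.sumCongr (cutEquiv J.1) (Equiv.refl Unit)))
    (cutSum h (.inl (.inl J))), cutTermOf_ud, (Bar k).map_trans]
  · congr 2
    have e := OS.cocomp_map_embedding k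
      (Function.Embedding.inl (α := {a : A // a ∉ J.1}) (β := Unit))
      (Equiv.refl {a : A // a ∈ J.1}).toEmbedding (OS.map k (cutEquiv J.1).symm.toEmbedding f)
    have e' : (OS.map k (Equiv.refl {a : A // a ∈ J.1}).toEmbedding).toLinearMap =
      LinearMap.id := LinearMap.ext (OS.map_refl k)
    rw [e', OS.map_map] at e
    rw [← e]
    congr 3
    ext a
    obtain ⟨x, rfl⟩ := (cutEquiv J.1).surjective a
    simp only [Function.Embedding.trans_apply, Equiv.coe_toEmbedding, Equiv.symm_apply_apply,
      Function.Embedding.inl_apply, Equiv.symm_apply_eq]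
    rcases x with x | x <;> rfl
  · rintro (⟨a, ha⟩ | a) ⟨b, hb, e⟩
    · exact ha ((Sum.inl_injective e : b = a) ▸ hb)
    · cases e
  · exact fun ⟨a, ha⟩ => ⟨a, ha, rfl⟩

/-- The cut with `n` added to the upper vertex gives `ι` of the upper vertex. -/
theorem cutTerm_cutSum_upper (J : Cut A) (m : ℕ) (f : OS k A) :
    cutTerm k (cutSum h (.inl (.inr J))) (gmap k Function.Embedding.inl (ud k m ⊗ₜ f)) =
      (Bar k).map (Equiv.sumCongr (cutEquiv J.1) (Equiv.refl Unit))
        ((Bar k).map (Equiv.sumAssoc _ _ Unit).symm (joinSum k J.2.1 (two_le_card_sum J.2.2) m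
          (TensorProduct.map LinearMap.id (OS.map k Function.Embedding.inl).toLinearMap
            (OS.cocomp k _ _ (OS.map k (cutEquiv J.1).symm.toEmbedding f))))) := by
  rw [cutTerm_eq_cutTermOf k J.2.1 (two_le_card_sum J.2.2)
    ((Equiv.sumAssoc _ _ Unit).symm.trans (Equiv.sumCongr (cutEquiv J.1) (Equiv.refl Unit)))
    (cutSum h (.inl (.inr J))), cutTermOf_ud, (Bar k).map_trans]
  · congr 2
    have e := OS.cocomp_map_embedding k (Equiv.refl {a : A // a ∉ J.1}).toEmbedding
      (Function.Embedding.inl (α := {a : A // a ∈ J.1}) (β := Unit))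
      (OS.map k (cutEquiv J.1).symm.toEmbedding f)
    have e' : (OS.map k (Equiv.refl {a : A // a ∉ J.1}).toEmbedding.optionMap).toLinearMap =
        LinearMap.id := by
      refine LinearMap.ext fun g => Eq.trans ?_ (OS.map_refl k g)
      refine congrArg (fun φ => OS.map k φ g) ?_
      ext (_ | a) <;> rfl
    rw [e', OS.map_map] at e
    rw [← e]
    congr 3
  · rintro ⟨a, ha⟩ (e | ⟨b, hb, e⟩)
    · cases e
    · exact ha ((Sum.inl_injective e : b = a) ▸ hb)
  · rintro (⟨a, ha⟩ | a)
    · exact Or.inr ⟨a, ha, rfl⟩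
    · exact Or.inl rfl

/-- The cut with lower vertex `{*, n}` gives the decoration `1` on that vertex. -/
theorem cutTerm_cutSum_root (m : ℕ) (f : OS k A) :
    cutTerm k (cutSum h (.inr (.inl ()))) (gmap k Function.Embedding.inl (ud k m ⊗ₜ f)) =
      ∑ p ∈ antidiagonal m, (Bar k).graftRoot
        (corolla k (A := Option Unit) (by simp) (ud k p.2 ⊗ₜ 1)) (corolla k h (ud k p.1 ⊗ₜ f)) := by
  rw [cutTerm_eq_cutTermOf k (I := Unit) (by simp) h (Equiv.sumComm Unit A)
    (cutSum h (.inr (.inl ()))), cutTermOf_ud]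
  · have e : OS.cocomp k Unit A (OS.map k (Function.Embedding.inl.trans
        (Equiv.sumComm Unit A).symm.toEmbedding) f) = 1 ⊗ₜ f := OS.cocomp_map_inr k f
    rw [e, joinSum_tmul, convComp, map_sum, ← Finset.Nat.sum_antidiagonal_swap]
    simp only [map_one]
    rfl
  · rintro i ⟨b, e⟩
    cases e
  · exact fun a => ⟨a, rfl⟩

/-- The cut with upper vertex `{s, n}` gives the decoration `1` on that vertex. -/
theorem cutTerm_cutSum_input (s : A) (m : ℕ) (f : OS k A) :
    cutTerm k (cutSum h (.inr (.inr s))) (gmap k Function.Embedding.inl (ud k m ⊗ₜ f)) =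
      -∑ p ∈ antidiagonal m, (Bar k).graft s ((Bar k).sgn (corolla k h (ud k p.1 ⊗ₜ f)))
        (corolla k (A := Unit ⊕ Unit) (by simp) (ud k p.2 ⊗ₜ 1)) := by
  have h' : 2 ≤ Nat.card (Option {a : A // a ≠ s}) := by
    rwa [← Nat.card_congr (splitAt s)]
  have hs : 1 ≤ Nat.card {a : A // a ≠ s} := by
    rw [Finite.card_option] at h'; omega
  rw [cutTerm_eq_cutTermOf k hs (J := Unit ⊕ Unit) (by simp) (attachEquiv s)
    (cutSum h (.inr (.inr s))), cutTermOf_ud]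
  · rw [OS.cocomp_map_of_collapse k _ (splitAt s).toEmbedding, joinSum_tmul, convComp, map_sum,
      ← Finset.sum_neg_distrib]
    · refine Finset.sum_congr rfl fun p _ => ?_
      rw [SuperOperad.graft_apply, ← (Bar k).sgn_map, ← corolla_map k h h', gmap_ud]
      have e := corolla_gtau k h' (ud k p.1 ⊗ₜ OS.map k (splitAt s).toEmbedding f)
      rw [← neg_eq_iff_eq_neg] at e
      rw [← e, map_neg, LinearMap.neg_apply, map_neg, neg_neg]
      rfl
    · intro a
      obtain ⟨x, rfl⟩ := (splitAt s).symm.surjective a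
      rw [Equiv.coe_toEmbedding, Equiv.apply_symm_apply]
      have e : ∀ y, (attachEquiv s) y = Sum.inl ((splitAt s).symm x) →
          x = Sum.elim some (fun _ => none) y := by
        rintro (y | y | y) hy
        · exact (splitAt s).symm.injective (Sum.inl_injective hy.symm)
        · exact (splitAt s).symm.injective (Sum.inl_injective hy.symm)
        · cases hy
      exact e _ (Equiv.apply_symm_apply _ _)
  · rintro ⟨a, ha⟩ (e | e)
    · exact ha (by simpa [attachEquiv, splitAt, sumUnit] using e)
    · simp [attachEquiv] at e
  · rintro (a | a)
    · exact Or.inl (by simp [attachEquiv, splitAt, sumUnit])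
    · exact Or.inr rfl

end cutSum

theorem zetaSum_map_joinSum [CharZero k] {I J A : Type} [Fintype A] (hI : 1 ≤ Nat.card I)
    (hJ : 2 ≤ Nat.card J) (e : I ⊕ J ≃ A) (m : ℕ) (t : OS k (Option I) ⊗[k] OS k J) :
    zetaSum k ((Bar k).map e (joinSum k hI hJ m t)) =
      (Bar k).map (Equiv.sumCongr e (Equiv.refl Unit))
        ((Bar k).map (sumSwap I Unit J) (joinSum k (one_le_card_sum hI) hJ m
          (TensorProduct.map (OS.map k (Function.Embedding.inl (β := Unit)).optionMap).toLinearMap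
            LinearMap.id t))) +
      (Bar k).map (Equiv.sumCongr e (Equiv.refl Unit))
        ((Bar k).map (Equiv.sumAssoc I J Unit).symm (joinSum k hI (two_le_card_sum hJ) m
          (TensorProduct.map LinearMap.id (OS.map k Function.Embedding.inl).toLinearMap t))) +
      ∑ s, graftSum k s m (fun a => (Bar k).map e (joinSum k hI hJ a t)) +
      graftRootSum k m (fun a => (Bar k).map e (joinSum k hI hJ a t)) := by
  have : Finite I := Nat.finite_of_card_ne_zero (by omega)
  have := finite_of_two_le hJ
  have := Fintype.ofFinite I
  have := Fintype.ofFinite J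
  rw [zetaSum_map, zetaSum_joinSum, map_add, map_add, map_add, map_sum, ← graftRootSum_map,
    ← e.sum_comp]
  simp only [graftSum_map]

/-- The chain map property on corollas. -/
theorem zetaSum_d_corolla [CharZero k] {A : Type} (h : 2 ≤ Nat.card A) (x : k[X] ⊗[k] OS k A) :
    zetaSum k (d k (corolla k h x)) = d k (zetaSum k (corolla k h x)) := by
  classical
  have := finite_of_two_le h
  have := Fintype.ofFinite A
  have := Fintype.ofFinite (Cut A)
  have := Fintype.ofFinite (Cut (A ⊕ Unit))
  induction x using tmul_induction with
  | add x y hx hy => simp only [map_add, hx, hy]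
  | tmul m f =>
    have hd : ∀ a, d k (corolla k h (ud k a ⊗ₜ f)) = corolla k h (duw k (ud k a ⊗ₜ f)) +
        ∑ J : Cut A, (Bar k).map (cutEquiv J.1) (joinSum k J.2.1 J.2.2 a
          (OS.cocomp k _ _ (OS.map k (cutEquiv J.1).symm.toEmbedding f))) := by
      intro a
      rw [d_corolla, finsum_eq_sum_of_fintype]
      simp only [cutTerm_ud]
    -- The cuts of `A ⊔ {n}`, sorted by the position of `n`.
    have hr : d k (iotaCorolla k h (ud k m ⊗ₜ f)) = iotaCorolla k h (duw k (ud k m ⊗ₜ f)) +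
        (∑ J : Cut A, cutTerm k (cutSum h (.inl (.inl J)))
            (gmap k Function.Embedding.inl (ud k m ⊗ₜ f)) +
          ∑ J : Cut A, cutTerm k (cutSum h (.inl (.inr J)))
            (gmap k Function.Embedding.inl (ud k m ⊗ₜ f)) +
          (cutTerm k (cutSum h (.inr (.inl ())))
            (gmap k Function.Embedding.inl (ud k m ⊗ₜ f)) +
          ∑ s : A, cutTerm k (cutSum h (.inr (.inr s)))
            (gmap k Function.Embedding.inl (ud k m ⊗ₜ f)))) := by
      refine (d_corolla k (two_le_card_sum h) _).trans ?_
      rw [duw_iota, finsum_eq_sum_of_fintype,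
        ← (Equiv.ofBijective _ (cutSum_bijective h)).sum_comp, Fintype.sum_sum_type,
        Fintype.sum_sum_type, Fintype.sum_sum_type, Fintype.sum_unique (ι := Unit)]
      rfl
    have hd' : (fun a => d k (corolla k h (ud k a ⊗ₜ f))) =
        (fun a => corolla k h (duw k (ud k a ⊗ₜ f))) +
        ∑ J : Cut A, fun a => (Bar k).map (cutEquiv J.1) (joinSum k J.2.1 J.2.2 a
          (OS.cocomp k _ _ (OS.map k (cutEquiv J.1).symm.toEmbedding f))) := by
      funext a
      rw [hd, Pi.add_apply, Finset.sum_apply]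
    rw [zetaSum_corolla_ud, map_add, map_add, hr, map_sum, d_graftRootSum, hd, map_add, map_sum,
      zetaSum_corolla, sigmaOut_duw]
    simp only [d_graftSum, hd', map_add, map_sum, zetaSum_map_joinSum, Finset.sum_add_distrib,
      cutTerm_cutSum_lower, cutTerm_cutSum_upper, cutTerm_cutSum_root, cutTerm_cutSum_input,
      sigmaIn_duw, Finset.sum_neg_distrib]
    rw [Finset.sum_comm (s := Finset.univ (α := Cut A)) (t := Finset.univ (α := A))]
    abel

theorem zetaSum_d [CharZero k] {A : Type} (x : (Bar k).obj A) :
    zetaSum k (d k x) = d k (zetaSum k x) :=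
  zetaSum_d_of_corolla k (zetaSum_d_corolla k) x

theorem zeta_d [CharZero k] (n : ℕ) (x : (Bar k).obj (Fin n)) :
    zeta k n (d k x) = d k (zeta k n x) := by
  rw [zeta, LinearMap.comp_apply, LinearMap.comp_apply, zetaSum_d, d_map]

end Commutator

/-! ### The degree of `ζ` -/

section Degree

variable (k : Type u) [Field k]

theorem OS.map_mem_degree {A B : Type} (φ : A ↪ B) {r : ℕ} {f : OS k A}
    (hf : f ∈ OS.degree k A r) : OS.map k φ f ∈ OS.degree k B r := by
  have h : (OS.degree k A r).map (OS.map k φ).toLinearMap ≤ OS.degree k B r := by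
    rw [OS.degree, OS.degree, Submodule.map_pow]
    refine pow_le_pow_left' ?_ r
    rw [Submodule.map_span]
    refine Submodule.span_mono ?_
    rintro _ ⟨_, ⟨i, j, hij, rfl⟩, rfl⟩
    exact ⟨φ i, φ j, φ.injective.ne hij, OS.map_w k φ i j hij⟩
  exact h ⟨f, hf, rfl⟩

theorem OS.w_mem_degree {A : Type} (i j : A) (h : i ≠ j) : OS.w k i j h ∈ OS.degree k A 1 := by
  rw [OS.degree, pow_one]
  exact Submodule.subset_span ⟨i, j, h, rfl⟩

variable {k}

theorem HasDegree.sum {A ι : Type} (s : Finset ι) (r : ℤ) (F : ι → (Bar k).obj A)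
    (h : ∀ i ∈ s, HasDegree k r (F i)) : HasDegree k r (∑ i ∈ s, F i) :=
  Finset.sum_induction F (HasDegree k r) (fun _ _ => HasDegree.add r _ _) (HasDegree.zero r) h

theorem HasDegree.congr {A : Type} {r r' : ℤ} {x : (Bar k).obj A} (h : HasDegree k r x)
    (e : r = r') : HasDegree k r' x := e ▸ h

theorem hasDegree_wIn (b : ℕ) : HasDegree k (-2 * (b + 1 : ℕ)) (wIn k b) :=
  (HasDegree.corolla (A := Unit ⊕ Unit) (by simp) (b + 1) 1 _ (OS.w_mem_degree k _ _ _)).congr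
    (by simp; ring)

theorem hasDegree_wRoot (b : ℕ) : HasDegree k (-2 * (b + 1 : ℕ)) (wRoot k b) :=
  (HasDegree.corolla (A := Option Unit) (by simp) (b + 1) 1 _ (OS.w_mem_degree k _ _ _)).congr
    (by simp; ring)

theorem HasDegree.zetaSum [CharZero k] {A : Type} {r : ℤ} {x : (Bar k).obj A}
    (h : HasDegree k r x) : HasDegree k (r - 2) (zetaSum k x) := by
  induction h with
  | zero d => rw [map_zero]; exact .zero _
  | add d x y _ _ hx hy => rw [map_add]; exact .add _ _ _ hx hy
  | smul d c x _ hx => rw [map_smul]; exact .smul _ _ _ hx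
  | map d σ x _ hx => rw [zetaSum_map]; exact .map _ _ _ hx
  | one => rw [zetaSum_one]; exact .zero _
  | comp d e x y hx hy hx' hy' =>
    rw [zetaSum_comp]
    exact .add _ _ _ (.map _ _ _ ((HasDegree.comp _ _ _ _ (.map _ _ _ hx') hy).congr (by ring)))
      (.map _ _ _ ((HasDegree.comp _ _ _ _ hx hy').congr (by ring)))
  | @corolla A h n r f hf =>
    have := finite_of_two_le h
    have := Fintype.ofFinite A
    have hC : ∀ a, _ := fun a => HasDegree.corolla (k := k) h a r f hf
    rw [zetaSum_corolla_ud]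
    refine .add _ _ _ (.add _ _ _ ?_ ?_) ?_
    · refine (HasDegree.corolla (two_le_card_sum h) n r _
        (OS.map_mem_degree k Function.Embedding.inl hf)).congr ?_
      rw [Nat.card_sum]
      simp
      ring
    · refine .sum _ _ _ fun s _ => ?_
      rw [graftSum_apply]
      refine .sum _ _ _ fun p hp => ?_
      rw [Finset.HasAntidiagonal.mem_antidiagonal] at hp
      refine (HasDegree.map _ _ _ (HasDegree.comp _ _ _ _ (.map _ _ _ (hC p.1))
        (hasDegree_wIn p.2))).congr ?_
      rw [← hp]
      push_cast
      ring
    · rw [graftRootSum_apply, ← neg_one_smul k]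
      refine .smul _ _ _ (.sum _ _ _ fun p hp => ?_)
      rw [Finset.HasAntidiagonal.mem_antidiagonal] at hp
      refine (HasDegree.map _ _ _ (HasDegree.comp _ _ _ _ (hasDegree_wRoot p.2) (hC p.1))).congr ?_
      rw [← hp]
      push_cast
      ring

theorem HasDegree.zeta [CharZero k] (n : ℕ) {r : ℤ} {x : (Bar k).obj (Fin n)}
    (h : HasDegree k r x) : HasDegree k (r - 2) (zeta k n x) :=
  .map _ _ _ h.zetaSum

end Degree

/-! ### The elements `ν` represent the generators of `Hycomm` -/

section Represent

variable (k : Type u) [Field k]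

theorem eps_map {A B : Type} (σ : A ≃ B) (x : (Bar k).obj A) :
    eps k ((Bar k).map σ x) = (BarGrav k).map σ (eps k x) := (epsData k).lift_map σ x

theorem eps_sgn {A : Type} (x : (Bar k).obj A) :
    eps k ((Bar k).sgn x) = (BarGrav k).sgn (eps k x) := (epsData k).lift_sgn x

theorem eps_comp {I J : Type} (x : (Bar k).obj (Option I)) (y : (Bar k).obj J) :
    eps k ((Bar k).comp x y) = (BarGrav k).comp (eps k x) (eps k y) := (epsData k).lift_comp x y

theorem eps_one : eps k (Bar k).one = (BarGrav k).one := rfl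

/-- The corollas of the cobar complex of `Grav^∨`. -/
noncomputable def gravCorolla {A : Type} (h : 2 ≤ Nat.card A) :
    GravDual k A →ₗ[k] (BarGrav k).obj A :=
  freeGen (gravSpecies k) h

theorem gravCorolla_map {A B : Type} (hA : 2 ≤ Nat.card A) (hB : 2 ≤ Nat.card B) (σ : A ≃ B)
    (x : GravDual k A) :
    gravCorolla k hB (gravMap k σ.toEmbedding x) = (BarGrav k).map σ (gravCorolla k hA x) :=
  gen_map (gravSpecies k) _ hA hB σ x

theorem eps_corolla {A : Type} (h : 2 ≤ Nat.card A) (x : k[X] ⊗[k] OS k A) :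
    eps k (corolla k h x) = gravCorolla k h (augment k A x) := rfl

theorem augment_ud {A : Type} (m : ℕ) (f : OS k A) :
    augment k A (ud k m ⊗ₜ f) = if m = 0 then Submodule.Quotient.mk f else 0 := by
  change (ud k m).coeff 0 • (Submodule.Quotient.mk f : GravDual k A) = _
  rw [ud, Polynomial.coeff_monomial]
  split_ifs with h
  · rw [h]; simp
  · rw [zero_smul]

theorem gravMap_gravMap {A B C : Type} (φ : A ↪ B) (ψ : B ↪ C) (x : GravDual k A) :
    gravMap k ψ (gravMap k φ x) = gravMap k (φ.trans ψ) x := by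
  obtain ⟨f, rfl⟩ := Submodule.Quotient.mk_surjective _ x
  rw [gravMap_mk, gravMap_mk, gravMap_mk, OS.map_map]

theorem gravTau_gravMap {A B : Type} (φ : A ↪ B) (x : GravDual k A) :
    gravTau k (gravMap k φ x) = gravMap k φ (gravTau k x) := by
  obtain ⟨f, rfl⟩ := Submodule.Quotient.mk_surjective _ x
  rw [gravMap_mk, gravTau_mk, gravTau_mk, gravMap_mk, OS.tau_map]

/-- The corolla with an additional input and unchanged decoration. -/
noncomputable def gravIotaCorolla {A : Type} (h : 2 ≤ Nat.card A) :
    GravDual k A →ₗ[k] (BarGrav k).obj (A ⊕ Unit) :=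
  gravCorolla k (two_le_card_sum h) ∘ₗ gravMap k Function.Embedding.inl

theorem gravIotaCorolla_map {A B : Type} (hA : 2 ≤ Nat.card A) (hB : 2 ≤ Nat.card B) (σ : A ≃ B)
    (x : GravDual k A) :
    gravIotaCorolla k hB (gravMap k σ.toEmbedding x) =
      (BarGrav k).map (Equiv.sumCongr σ (Equiv.refl Unit)) (gravIotaCorolla k hA x) := by
  change gravCorolla k _ (gravMap k _ (gravMap k σ.toEmbedding x)) =
    (BarGrav k).map _ (gravCorolla k _ (gravMap k _ x))
  rw [← gravCorolla_map k (two_le_card_sum hA) (two_le_card_sum hB), gravMap_gravMap,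
    gravMap_gravMap]
  rfl

theorem gravIotaCorolla_neg_gravTau {A : Type} (h : 2 ≤ Nat.card A) (x : GravDual k A) :
    gravIotaCorolla k h (-gravTau k x) = (BarGrav k).sgn (gravIotaCorolla k h x) := by
  refine Eq.trans ?_ (gen_sgn (gravSpecies k) _ (two_le_card_sum h)
    (gravMap k Function.Embedding.inl x))
  refine congrArg (gravCorolla k (two_le_card_sum h)) ?_
  change _ = -gravTau k (gravMap k Function.Embedding.inl x)
  rw [gravTau_gravMap, map_neg]

/-- The derivation of the cobar complex of `Grav^∨` that adds an input to the corollas and leaves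
their decorations unchanged. -/
noncomputable def gravIotaData : DerData (gravSpecies k) Unit 0 where
  toFun h := gravIotaCorolla k h
  toFun_map hA hB σ x := gravIotaCorolla_map k hA hB σ x
  toFun_sgn h x := by
    rw [pow_zero, one_smul]
    exact gravIotaCorolla_neg_gravTau k h x

/-- The derivation extending `gravIotaData`. -/
noncomputable def gravIota {A : Type} : (BarGrav k).obj A →ₗ[k] (BarGrav k).obj (A ⊕ Unit) :=
  (gravIotaData k).deriv

theorem gravIota_map {A B : Type} (σ : A ≃ B) (x : (BarGrav k).obj A) :
    gravIota k ((BarGrav k).map σ x) =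
      (BarGrav k).map (Equiv.sumCongr σ (Equiv.refl Unit)) (gravIota k x) :=
  (gravIotaData k).deriv_map σ x

theorem gravIota_sgn {A : Type} (x : (BarGrav k).obj A) :
    gravIota k ((BarGrav k).sgn x) = (BarGrav k).sgn (gravIota k x) := by
  have := (gravIotaData k).deriv_sgn x
  rw [pow_zero, one_smul] at this
  exact this

theorem gravIota_comp {I J : Type} (x : (BarGrav k).obj (Option I)) (y : (BarGrav k).obj J) :
    gravIota k ((BarGrav k).comp x y) =
      (BarGrav k).map (sumSwap I Unit J)
        ((BarGrav k).comp ((BarGrav k).map (optionSum I Unit) (gravIota k x)) y) +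
      (BarGrav k).map (Equiv.sumAssoc I J Unit).symm ((BarGrav k).comp x (gravIota k y)) := by
  have : gravIota k ((BarGrav k).comp x y) =
      (BarGrav k).map (sumSwap I Unit J)
        ((BarGrav k).comp ((BarGrav k).map (optionSum I Unit) (gravIota k x)) y) +
      (BarGrav k).map (Equiv.sumAssoc I J Unit).symm
        ((BarGrav k).comp ((BarGrav k).sgnPow 0 x) (gravIota k y)) :=
    (gravIotaData k).deriv_comp x y
  rwa [SuperOperad.sgnPow_zero] at this

theorem gravIota_one : gravIota k (BarGrav k).one = 0 := (gravIotaData k).deriv_one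

theorem gravIota_corolla {A : Type} (h : 2 ≤ Nat.card A) (x : GravDual k A) :
    gravIota k (gravCorolla k h x) =
      gravCorolla k (two_le_card_sum h) (gravMap k Function.Embedding.inl x) := rfl

theorem eps_wIn (b : ℕ) : eps k (wIn k b) = 0 := by
  refine (eps_corolla k _ _).trans ((congrArg (gravCorolla k _) ?_).trans (map_zero _))
  exact (augment_ud k (b + 1) _).trans (if_neg b.succ_ne_zero)

theorem eps_wRoot (b : ℕ) : eps k (wRoot k b) = 0 := by
  refine (eps_corolla k _ _).trans ((congrArg (gravCorolla k _) ?_).trans (map_zero _))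
  exact (augment_ud k (b + 1) _).trans (if_neg b.succ_ne_zero)

/-- The terms `ς` of `ζ` contain a positive power of `u`, so that only `ι` survives `ε`. -/
theorem eps_zetaSum [CharZero k] {A : Type} (x : (Bar k).obj A) :
    eps k (zetaSum k x) = gravIota k (eps k x) := by
  induction x using bar_induction with
  | zero => simp only [map_zero]
  | add x y hx hy => simp only [map_add, hx, hy]
  | smul c x hx => simp only [map_smul, hx]
  | map σ x hx => rw [zetaSum_map, eps_map, eps_map, gravIota_map, hx]
  | sgn x hx => rw [zetaSum_sgn, eps_sgn, eps_sgn, gravIota_sgn, hx]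
  | one => rw [zetaSum_one, eps_one, gravIota_one, map_zero]
  | comp x y hx hy =>
    rw [zetaSum_comp, map_add, eps_map, eps_map, eps_comp, eps_comp, eps_comp, eps_map,
      gravIota_comp, hx, hy]
  | @corolla A h x =>
    have := finite_of_two_le h
    have := Fintype.ofFinite A
    induction x using tmul_induction with
    | add x y hx hy => simp only [map_add, hx, hy]
    | tmul m f =>
      rw [zetaSum_corolla_ud, graftRootSum_apply]
      simp only [graftSum_apply, map_add, map_sum, map_neg, SuperOperad.graft_apply,
        SuperOperad.graftRoot_apply, eps_map, eps_comp, eps_wIn, eps_wRoot, map_zero,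
        LinearMap.zero_apply, Finset.sum_const_zero, neg_zero, add_zero]
      rw [eps_corolla, gravIota_corolla]
      exact congrArg (gravCorolla k _) (augment_natural k _ (gravMap k Function.Embedding.inl)
        (fun _ => rfl) (ud k m ⊗ₜ f))

theorem eps_nu [CharZero k] (n : ℕ) : ∃ (i j : Fin (n + 2)) (h : i ≠ j),
    eps k (nu k n) = gravCorolla k (by simp) (Submodule.Quotient.mk (OS.w k i j h)) := by
  induction n with
  | zero =>
    refine ⟨0, 1, by simp, congrArg (gravCorolla k _) ?_⟩
    change (1 : k[X]).coeff 0 • (Submodule.Quotient.mk _ : GravDual k _) = _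
    rw [Polynomial.coeff_one_zero, one_smul]
  | succ n ih =>
    obtain ⟨i, j, h, e⟩ := ih
    refine ⟨addLast _ (.inl i), addLast _ (.inl j),
      (addLast _).injective.ne (Sum.inl_injective.ne h), ?_⟩
    rw [nu, zeta, LinearMap.comp_apply, eps_map, eps_zetaSum, e, gravIota_corolla,
      ← gravCorolla_map k (two_le_card_sum (by simp)) (by simp), gravMap_mk, gravMap_mk, OS.map_w,
      OS.map_w]
    rfl

theorem OS.toDual_w {A : Type} (i j : A) (h : i ≠ j) :
    OS.toDual k A (OS.w k i j h) = TrivSqZeroExt.inr 1 := OS.lift_w ..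

theorem kappa_gravCorolla {A : Type} (h : 2 ≤ Nat.card A) (f : OS k A) :
    kappa k (gravCorolla k h (Submodule.Quotient.mk f)) =
      (OS.toDual k A f).snd • hycommGen k h := by
  refine Eq.trans ?_ (map_smul (gen (hycommSpecies k) (HycommRel k) h) _ (1 : k))
  exact congrArg (gen (hycommSpecies k) (HycommRel k) h) (mul_one (OS.toDual k A f).snd).symm

theorem kappa_eps_nu [CharZero k] (n : ℕ) :
    kappa k (eps k (nu k n)) = hycommGen k (A := Fin (n + 2)) (by simp) := by
  obtain ⟨i, j, h, e⟩ := eps_nu k n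
  rw [e, kappa_gravCorolla, OS.toDual_w, TrivSqZeroExt.snd_inr, one_smul]

theorem d_nu [CharZero k] (n : ℕ) : d k (nu k n) = 0 := by
  induction n with
  | zero =>
    rw [nu, d_corolla_binary k _ (by simp), duw, TensorProduct.map_tmul, du,
      Polynomial.derivative_one, TensorProduct.zero_tmul, map_zero]
  | succ n ih => rw [nu, ← zeta_d, ih, map_zero]

end Represent

/-! ### The composite `κε` is a chain map -/

section Kappa

variable (k : Type u) [Field k]

theorem kappa_eps_map {A B : Type} (σ : A ≃ B) (x : (Bar k).obj A) :
    kappa k (eps k ((Bar k).map σ x)) = (Hycomm k).map σ (kappa k (eps k x)) :=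
  (congrArg (kappa k) (eps_map k σ x)).trans ((kappaData k).lift_map σ (eps k x))

theorem kappa_eps_sgn {A : Type} (x : (Bar k).obj A) :
    kappa k (eps k ((Bar k).sgn x)) = (Hycomm k).sgn (kappa k (eps k x)) :=
  (congrArg (kappa k) (eps_sgn k x)).trans ((kappaData k).lift_sgn (eps k x))

theorem kappa_eps_comp {I J : Type} (x : (Bar k).obj (Option I)) (y : (Bar k).obj J) :
    kappa k (eps k ((Bar k).comp x y)) =
      (Hycomm k).comp (kappa k (eps k x)) (kappa k (eps k y)) :=
  (congrArg (kappa k) (eps_comp k x y)).trans ((kappaData k).lift_comp (eps k x) (eps k y))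

theorem kappa_eps_corolla {A : Type} (h : 2 ≤ Nat.card A) (m : ℕ) (f : OS k A) :
    kappa k (eps k (corolla k h (ud k m ⊗ₜ f))) =
      if m = 0 then (OS.toDual k A f).snd • hycommGen k h else 0 := by
  rw [eps_corolla, augment_ud]
  split_ifs
  · exact kappa_gravCorolla k h f
  · rw [map_zero, map_zero]

/-! ### The relations of `Hycomm` -/

/-- The generators of `Hycomm` as a map out of the species of generators. -/
noncomputable def hycommProjData : GenMap (hycommSpecies k) (Hycomm k) where
  toFun h := gen (hycommSpecies k) (HycommRel k) h
  toFun_map hA hB σ x := gen_map (hycommSpecies k) (HycommRel k) hA hB σ x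
  toFun_sgn h x := gen_sgn (hycommSpecies k) (HycommRel k) h x

/-- The projection of the free operad onto `Hycomm` takes the class of an expression to the class of
the same expression. -/
theorem hycommProjData_eval {A : Type} (t : Term (hycommSpecies k) A) :
    (hycommProjData k).eval t = Pres.mk t := by
  induction t with
  | zero => rfl
  | add s t hs ht => exact congrArg₂ (· + ·) hs ht
  | smul c s hs => exact congrArg (c • ·) hs
  | map σ s hs => exact congrArg ((Hycomm k).map σ) hs
  | sgn s hs => exact congrArg (Hycomm k).sgn hs
  | one => rfl
  | comp s t hs ht => exact congrArg₂ (fun a b => (Hycomm k).comp a b) hs ht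
  | gen h x => rfl

/-- `m_(I ⊔ {*}) ∘_* m_J` in `Hycomm`, for a splitting `A = I ⊔ J`. -/
noncomputable def hycommComp {A : Type} (J : Cut A) : (Hycomm k).obj A :=
  (Hycomm k).map (cutEquiv J.1) ((Hycomm k).comp
    (hycommGen k (two_le_card_option J.2.1)) (hycommGen k J.2.2))

theorem lift_hycommCut {A : Type} (J : Cut A) :
    (hycommProjData k).lift (hycommCut k J) = hycommComp k J := rfl

open Classical in
theorem hycomm_relation {A : Type} [Fintype (Cut A)] {a b c : A} (hab : a ≠ b) (hbc : b ≠ c)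
    (hac : a ≠ c) :
    (∑ J : Cut A, if a ∈ J.1 ∧ b ∈ J.1 ∧ c ∉ J.1 then hycommComp k J else 0) =
      ∑ J : Cut A, if b ∈ J.1 ∧ c ∈ J.1 ∧ a ∉ J.1 then hycommComp k J else 0 := by
  obtain ⟨t, ht⟩ : ∃ t : Term (hycommSpecies k) A,
      (Pres.mk t : (free (hycommSpecies k)).obj A) =
        (∑ᶠ (J : Cut A) (_ : a ∈ J.1 ∧ b ∈ J.1 ∧ c ∉ J.1), hycommCut k J) -
        ∑ᶠ (J : Cut A) (_ : b ∈ J.1 ∧ c ∈ J.1 ∧ a ∉ J.1), hycommCut k J :=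
    Quot.exists_rep _
  have h0 : (Pres.mk t : (Hycomm k).obj A) = 0 :=
    Quot.sound (Rel.rel t ⟨a, b, c, hab, hbc, hac, ht⟩)
  have h1 : (hycommProjData k).lift (Pres.mk t : (free (hycommSpecies k)).obj A) = 0 :=
    (hycommProjData_eval k t).trans h0
  rw [ht, map_sub, sub_eq_zero, finsum_eq_sum_of_fintype, finsum_eq_sum_of_fintype, map_sum,
    map_sum] at h1
  simp only [finsum_eq_if, apply_ite (hycommProjData k).lift, map_zero, lift_hycommCut] at h1
  exact h1

open Classical in
/-- `∑ m_(I ⊔ {*}) ∘_* m_J` over the splittings with `a, b ∈ J`. -/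
noncomputable def hycommSum {A : Type} [Fintype (Cut A)] (a b : A) : (Hycomm k).obj A :=
  ∑ J : Cut A, if a ∈ J.1 ∧ b ∈ J.1 then hycommComp k J else 0

theorem hycommSum_comm {A : Type} [Fintype (Cut A)] (a b : A) :
    hycommSum k a b = hycommSum k b a := by
  classical
  exact Finset.sum_congr rfl fun J _ => if_congr and_comm rfl rfl

/-- The relation of `Hycomm`, with the sum over the splittings with `a, b, c ∈ J` added to both
sides. -/
theorem hycommSum_shift {A : Type} [Fintype (Cut A)] {a b c : A} (hab : a ≠ b) (hbc : b ≠ c) :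
    hycommSum k a b = hycommSum k b c := by
  classical
  by_cases hac : a = c
  · rw [hac, hycommSum_comm]
  have e1 : hycommSum k a b =
      (∑ J : Cut A, if a ∈ J.1 ∧ b ∈ J.1 ∧ c ∉ J.1 then hycommComp k J else 0) +
      ∑ J : Cut A, if a ∈ J.1 ∧ b ∈ J.1 ∧ c ∈ J.1 then hycommComp k J else 0 := by
    rw [hycommSum, ← Finset.sum_add_distrib]
    refine Finset.sum_congr rfl fun J _ => ?_
    by_cases ha : a ∈ J.1 <;> by_cases hb : b ∈ J.1 <;> by_cases hc : c ∈ J.1 <;>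
      simp [ha, hb, hc]
  have e2 : hycommSum k b c =
      (∑ J : Cut A, if b ∈ J.1 ∧ c ∈ J.1 ∧ a ∉ J.1 then hycommComp k J else 0) +
      ∑ J : Cut A, if a ∈ J.1 ∧ b ∈ J.1 ∧ c ∈ J.1 then hycommComp k J else 0 := by
    rw [hycommSum, ← Finset.sum_add_distrib]
    refine Finset.sum_congr rfl fun J _ => ?_
    by_cases ha : a ∈ J.1 <;> by_cases hb : b ∈ J.1 <;> by_cases hc : c ∈ J.1 <;>
      simp [ha, hb, hc]
  rw [e1, e2, hycomm_relation k hab hbc hac]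

/-- The sum over the splittings with `a, b ∈ J` does not depend on the pair `a ≠ b`. -/
theorem hycommSum_eq {A : Type} [Fintype (Cut A)] {a b c e : A} (hab : a ≠ b) (hce : c ≠ e) :
    hycommSum k a b = hycommSum k c e := by
  by_cases hbc : b = c
  · subst hbc
    exact hycommSum_shift k hab hce
  · rw [hycommSum_shift k hab hbc, hycommSum_shift k hbc hce]

/-! ### Low degree coefficients of the cocomposition -/

/-- The coefficient of `1`. -/
noncomputable def coeffOne (A : Type) : OS k A →ₗ[k] k :=
  TrivSqZeroExt.fstHom k k k ∘ₗ (OS.toDual k A).toLinearMap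

/-- The sum of the coefficients of the `w_ij`. -/
noncomputable def coeffW (A : Type) : OS k A →ₗ[k] k :=
  TrivSqZeroExt.sndHom k k ∘ₗ (OS.toDual k A).toLinearMap

theorem coeffOne_one (A : Type) : coeffOne k A 1 = 1 := by simp [coeffOne]

theorem coeffW_one (A : Type) : coeffW k A 1 = 0 := by simp [coeffW]

theorem coeffOne_w_mul {A : Type} (i j : A) (h : i ≠ j) (f : OS k A) :
    coeffOne k A (OS.w k i j h * f) = 0 := by
  simp [coeffOne, OS.toDual_w]

theorem coeffW_w_mul {A : Type} (i j : A) (h : i ≠ j) (f : OS k A) :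
    coeffW k A (OS.w k i j h * f) = coeffOne k A f := by
  simp [coeffW, coeffOne, OS.toDual_w]

theorem coeffOne_tau {A : Type} (f : OS k A) : coeffOne k A (OS.tau k f) = coeffOne k A f :=
  (OS.toDual_tau k f).1

theorem coeffW_tau {A : Type} (f : OS k A) : coeffW k A (OS.tau k f) = -coeffW k A f :=
  (OS.toDual_tau k f).2

theorem coeffOne_map {A B : Type} (φ : A ↪ B) (f : OS k A) :
    coeffOne k B (OS.map k φ f) = coeffOne k A f := congrArg TrivSqZeroExt.fst (OS.toDual_map k φ f)

theorem coeffW_map {A B : Type} (φ : A ↪ B) (f : OS k A) :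
    coeffW k B (OS.map k φ f) = coeffW k A f := congrArg TrivSqZeroExt.snd (OS.toDual_map k φ f)

/-- The tensor product of two functionals. -/
noncomputable def pairing {I J : Type} (p : OS k (Option I) →ₗ[k] k) (q : OS k J →ₗ[k] k) :
    OS k (Option I) ⊗[k] OS k J →ₗ[k] k :=
  LinearMap.mul' k k ∘ₗ TensorProduct.map p q

theorem pairing_tmul {I J : Type} (p : OS k (Option I) →ₗ[k] k) (q : OS k J →ₗ[k] k)
    (g : OS k (Option I)) (h : OS k J) : pairing k p q (g ⊗ₜ h) = p g * q h := rfl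

theorem pairing_mulL_one {I J : Type} (q : OS k J →ₗ[k] k) (i j : Option I) (h : i ≠ j)
    (t : OS k (Option I) ⊗[k] OS k J) :
    pairing k (coeffOne k _) q (OS.mulL k (OS.w k i j h) t) = 0 := by
  induction t using TensorProduct.induction_on with
  | zero => simp only [map_zero]
  | add x y hx hy => simp only [map_add, hx, hy, add_zero]
  | tmul x y => exact (congrArg (· * _) (coeffOne_w_mul k i j h x)).trans (zero_mul _)

theorem pairing_mulL_w {I J : Type} (q : OS k J →ₗ[k] k) (i j : Option I) (h : i ≠ j)
    (t : OS k (Option I) ⊗[k] OS k J) :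
    pairing k (coeffW k _) q (OS.mulL k (OS.w k i j h) t) = pairing k (coeffOne k _) q t := by
  induction t using TensorProduct.induction_on with
  | zero => simp only [map_zero]
  | add x y hx hy => simp only [map_add, hx, hy]
  | tmul x y => exact congrArg (· * _) (coeffW_w_mul k i j h x)

theorem pairing_mulR_one {I J : Type} (p : OS k (Option I) →ₗ[k] k) (i j : J) (h : i ≠ j)
    (t : OS k (Option I) ⊗[k] OS k J) :
    pairing k p (coeffOne k _) (OS.mulR k (OS.w k i j h) t) = 0 := by
  induction t using TensorProduct.induction_on with
  | zero => simp only [map_zero]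
  | add x y hx hy => simp only [map_add, hx, hy, add_zero]
  | tmul x y => exact (congrArg (_ * ·) (coeffOne_w_mul k i j h y)).trans (mul_zero _)

theorem pairing_one_mulR_w {I J : Type} (i j : J) (h : i ≠ j)
    (t : OS k (Option I) ⊗[k] OS k J) :
    pairing k (coeffOne k _) (coeffW k _) (OS.mulR k (OS.w k i j h) t) =
      pairing k (coeffOne k _) (coeffOne k _) t := by
  induction t using TensorProduct.induction_on with
  | zero => simp only [map_zero]
  | add x y hx hy => simp only [map_add, hx, hy]
  | tmul x y => exact congrArg₂ (· * ·) (coeffOne_tau k x) (coeffW_w_mul k i j h y)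

theorem pairing_w_mulR_w {I J : Type} (i j : J) (h : i ≠ j)
    (t : OS k (Option I) ⊗[k] OS k J) :
    pairing k (coeffW k _) (coeffW k _) (OS.mulR k (OS.w k i j h) t) =
      -pairing k (coeffW k _) (coeffOne k _) t := by
  induction t using TensorProduct.induction_on with
  | zero => simp only [map_zero, neg_zero]
  | add x y hx hy => simp only [map_add, hx, hy, neg_add]
  | tmul x y =>
    refine (congrArg₂ (· * ·) (coeffW_tau k x) (coeffW_w_mul k i j h y)).trans ?_
    rw [pairing_tmul, neg_mul]

theorem pairing_one_one_cocomp {I J : Type} (f : OS k (I ⊕ J)) :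
    pairing k (coeffOne k _) (coeffOne k _) (OS.cocomp k I J f) = coeffOne k _ f := by
  induction f using OS.induction with
  | one => rw [OS.cocomp_one, pairing_tmul, coeffOne_one, coeffOne_one, coeffOne_one, one_mul]
  | add f g hf hg => simp only [map_add, hf, hg]
  | smul c f hf => simp only [map_smul, hf]
  | mul a b h f hf =>
    rw [OS.cocomp_w_mul, coeffOne_w_mul]
    rcases a with a | a <;> rcases b with b | b <;>
      simp only [OS.cocompGen, pairing_mulL_one, pairing_mulR_one]

theorem pairing_one_w_cocomp_w_mul {I J : Type} (a b : I ⊕ J) (h : a ≠ b) (f : OS k (I ⊕ J)) :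
    pairing k (coeffOne k _) (coeffW k _) (OS.cocomp k I J (OS.w k a b h * f)) =
      if a.isRight ∧ b.isRight then coeffOne k _ f else 0 := by
  rw [OS.cocomp_w_mul]
  rcases a with a | a <;> rcases b with b | b <;>
    simp [OS.cocompGen, pairing_mulL_one, pairing_one_mulR_w, pairing_one_one_cocomp]

/-- The total coefficient of the `w_ij` splits into those of the lower and of the upper vertex. -/
theorem pairing_w_one_cocomp {I J : Type} (f : OS k (I ⊕ J)) :
    pairing k (coeffW k _) (coeffOne k _) (OS.cocomp k I J f) =
      coeffW k _ f - pairing k (coeffOne k _) (coeffW k _) (OS.cocomp k I J f) := by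
  induction f using OS.induction with
  | one => simp [OS.cocomp_one, pairing_tmul, coeffW_one]
  | add f g hf hg => simp only [map_add, hf, hg]; ring
  | smul c f hf => simp only [map_smul, hf, smul_sub]
  | mul a b h f hf =>
    rw [pairing_one_w_cocomp_w_mul, coeffW_w_mul, OS.cocomp_w_mul]
    rcases a with a | a <;> rcases b with b | b <;>
      simp [OS.cocompGen, pairing_mulL_w, pairing_mulR_one, pairing_one_one_cocomp]

theorem pairing_w_w_cocomp_w_mul {I J : Type} (a b : I ⊕ J) (h : a ≠ b) (f : OS k (I ⊕ J)) :
    pairing k (coeffW k _) (coeffW k _) (OS.cocomp k I J (OS.w k a b h * f)) =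
      pairing k (coeffOne k _) (coeffW k _) (OS.cocomp k I J f) -
        if a.isRight ∧ b.isRight then coeffW k _ f else 0 := by
  rw [OS.cocomp_w_mul]
  rcases a with a | a <;> rcases b with b | b <;>
    simp [OS.cocompGen, pairing_mulL_w, pairing_w_mulR_w, pairing_w_one_cocomp]

/-- A functional on `OS(I ⊔ {*}) ⊗ OS(J)` applied to the cocomposition along a cut. -/
noncomputable def cutPairing {A : Type} (J : Cut A)
    (p : OS k (Option {a : A // a ∉ J.1}) →ₗ[k] k) (q : OS k {a : A // a ∈ J.1} →ₗ[k] k) :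
    OS k A →ₗ[k] k :=
  pairing k p q ∘ₗ OS.cocomp k _ _ ∘ₗ (OS.map k (cutEquiv J.1).symm.toEmbedding).toLinearMap

theorem isRight_cutEquiv_symm {A : Type} (J : Set A) (a : A) :
    ((cutEquiv J).symm a).isRight ↔ a ∈ J := by
  obtain ⟨x, rfl⟩ := (cutEquiv J).surjective a
  rw [Equiv.symm_apply_apply]
  rcases x with x | x
  · exact iff_of_false (by simp) x.2
  · exact iff_of_true rfl x.2

open Classical in
theorem cutPairing_one_w_mul {A : Type} (J : Cut A) (a b : A) (h : a ≠ b) (f : OS k A) :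
    cutPairing k J (coeffOne k _) (coeffW k _) (OS.w k a b h * f) =
      if a ∈ J.1 ∧ b ∈ J.1 then coeffOne k A f else 0 := by
  change pairing k _ _ (OS.cocomp k _ _ (OS.map k _ (OS.w k a b h * f))) = _
  rw [map_mul, OS.map_w, pairing_one_w_cocomp_w_mul, coeffOne_map]
  exact if_congr (and_congr (isRight_cutEquiv_symm _ a) (isRight_cutEquiv_symm _ b)) rfl rfl

open Classical in
theorem cutPairing_w_w_mul {A : Type} (J : Cut A) (a b : A) (h : a ≠ b) (f : OS k A) :
    cutPairing k J (coeffW k _) (coeffW k _) (OS.w k a b h * f) =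
      cutPairing k J (coeffOne k _) (coeffW k _) f -
        if a ∈ J.1 ∧ b ∈ J.1 then coeffW k A f else 0 := by
  change pairing k _ _ (OS.cocomp k _ _ (OS.map k _ (OS.w k a b h * f))) = _
  rw [map_mul, OS.map_w, pairing_w_w_cocomp_w_mul, coeffW_map]
  refine congrArg₂ (· - ·) rfl ?_
  exact if_congr (and_congr (isRight_cutEquiv_symm _ a) (isRight_cutEquiv_symm _ b)) rfl rfl

theorem cutPairing_one {A : Type} (J : Cut A) (p : OS k (Option {a : A // a ∉ J.1}) →ₗ[k] k) :
    cutPairing k J p (coeffW k _) 1 = 0 := by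
  change pairing k _ _ (OS.cocomp k _ _ (OS.map k _ 1)) = _
  rw [map_one, OS.cocomp_one, pairing_tmul, coeffW_one, mul_zero]

section Sums

variable {A : Type} [Fintype (Cut A)]

/-- The terms of the cocomposition with one `w_ij` on the upper vertex and none on the lower one
contribute, for every `w_ij`, the same sum `T` over the splittings with `i, j ∈ J`. -/
theorem sum_cutPairing_one_w (T : (Hycomm k).obj A) (hT : ∀ a b : A, a ≠ b → hycommSum k a b = T)
    (f : OS k A) :
    ∑ J : Cut A, cutPairing k J (coeffOne k _) (coeffW k _) f • hycommComp k J =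
      coeffW k A f • T := by
  classical
  induction f using OS.induction with
  | one => simp only [cutPairing_one, coeffW_one, zero_smul, Finset.sum_const_zero]
  | add f g hf hg => simp only [map_add, add_smul, Finset.sum_add_distrib, hf, hg]
  | smul c f hf => simp only [map_smul, smul_assoc, ← Finset.smul_sum, hf]
  | mul a b h f _ =>
    simp only [cutPairing_one_w_mul, coeffW_w_mul, ← hT a b h, hycommSum, Finset.smul_sum,
      ite_smul, zero_smul, smul_ite, smul_zero]

/-- The cocomposition of an element of degree two is a relation of `Hycomm`. -/
theorem sum_cutPairing_w_w (T : (Hycomm k).obj A) (hT : ∀ a b : A, a ≠ b → hycommSum k a b = T)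
    (f : OS k A) :
    ∑ J : Cut A, cutPairing k J (coeffW k _) (coeffW k _) f • hycommComp k J = 0 := by
  classical
  induction f using OS.induction with
  | one => simp only [cutPairing_one, zero_smul, Finset.sum_const_zero]
  | add f g hf hg => simp only [map_add, add_smul, Finset.sum_add_distrib, hf, hg, add_zero]
  | smul c f hf => simp only [map_smul, smul_assoc, ← Finset.smul_sum, hf, smul_zero]
  | mul a b h f _ =>
    simp only [cutPairing_w_w_mul, sub_smul, Finset.sum_sub_distrib,
      sum_cutPairing_one_w k T hT f]
    simp only [← hT a b h, hycommSum, Finset.smul_sum,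
      ite_smul, zero_smul, smul_ite, smul_zero, sub_self]

end Sums

/-- Of the composition of two corollas only the term with `u^0` and one `w` on each vertex survives;
its sign is that of `joinCorolla`. -/
theorem kappa_eps_joinSum {I J : Type} (hI : 1 ≤ Nat.card I) (hJ : 2 ≤ Nat.card J) (m : ℕ)
    (t : OS k (Option I) ⊗[k] OS k J) :
    kappa k (eps k (joinSum k hI hJ m t)) =
      if m = 0 then -(pairing k (coeffW k _) (coeffW k _) t •
        (Hycomm k).comp (hycommGen k (two_le_card_option hI)) (hycommGen k hJ)) else 0 := by
  induction t using TensorProduct.induction_on with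
  | zero => simp
  | add x y hx hy =>
    rw [map_add, map_add, map_add, hx, hy]
    split_ifs
    · rw [map_add, add_smul, neg_add]
    · rw [add_zero]
  | tmul g h =>
    rw [joinSum_tmul, convComp, map_sum, map_sum]
    simp only [kappa_eps_comp, kappa_eps_corolla]
    split_ifs with hm
    · subst hm
      rw [Finset.Nat.antidiagonal_zero, Finset.sum_singleton, if_pos rfl, if_pos rfl, map_smul,
        LinearMap.map_smul₂, smul_smul, pairing_tmul, ← neg_smul]
      congr 1
      rw [(OS.toDual_tau k g).2, mul_neg, mul_comm]
      rfl
    · refine Finset.sum_eq_zero fun p hp => ?_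
      rw [Finset.HasAntidiagonal.mem_antidiagonal] at hp
      by_cases h1 : p.1 = 0
      · rw [if_neg (show p.2 ≠ 0 by omega), map_zero]
      · rw [if_neg h1, map_zero, LinearMap.zero_apply]

theorem kappa_eps_d_corolla [CharZero k] {A : Type} (h : 2 ≤ Nat.card A) (x : k[X] ⊗[k] OS k A) :
    kappa k (eps k (d k (corolla k h x))) = 0 := by
  have := finite_of_two_le h
  have := Fintype.ofFinite (Cut A)
  induction x using tmul_induction with
  | add x y hx hy => simp only [map_add, hx, hy, add_zero]
  | tmul m f =>
    have h1 : kappa k (eps k (corolla k h (duw k (ud k m ⊗ₜ f)))) = 0 := by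
      cases m with
      | zero => rw [duw_ud_zero, map_zero, map_zero, map_zero]
      | succ m =>
        rw [duw_ud_succ, kappa_eps_corolla, (OS.toDual_dw k f).2, zero_smul, ite_self]
    have h2 : ∀ J : Cut A, kappa k (eps k (cutTerm k J (ud k m ⊗ₜ f))) =
        if m = 0 then -(cutPairing k J (coeffW k _) (coeffW k _) f • hycommComp k J) else 0 := by
      intro J
      rw [cutTerm_ud, kappa_eps_map, kappa_eps_joinSum]
      split_ifs
      · rw [map_neg, map_smul]
        rfl
      · rw [map_zero]
    rw [d_corolla, map_add, map_add, h1, zero_add, finsum_eq_sum_of_fintype, map_sum, map_sum]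
    simp only [h2]
    split_ifs
    · have : Nontrivial A := Finite.one_lt_card_iff_nontrivial.1 h
      obtain ⟨a, b, hab⟩ := exists_pair_ne A
      rw [Finset.sum_neg_distrib, sum_cutPairing_w_w k (hycommSum k a b)
        (fun c e hce => hycommSum_eq k hce hab), neg_zero]
    · rw [Finset.sum_const_zero]

theorem kappa_eps_d [CharZero k] {A : Type} (x : (Bar k).obj A) :
    kappa k (eps k (d k x)) = 0 := by
  induction x using bar_induction with
  | zero => simp only [map_zero]
  | add x y hx hy => simp only [map_add, hx, hy, add_zero]
  | smul c x hx => simp only [map_smul, hx, smul_zero]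
  | map σ x hx => rw [d_map, kappa_eps_map, hx, map_zero]
  | sgn x hx => rw [d_sgn, map_neg, map_neg, kappa_eps_sgn, hx, map_zero, neg_zero]
  | one => rw [d_one, map_zero, map_zero]
  | comp x y hx hy =>
    rw [d_comp, map_add, map_add, kappa_eps_comp, kappa_eps_comp, hx, hy, map_zero, map_zero,
      LinearMap.zero_apply, add_zero]
  | corolla h x => exact kappa_eps_d_corolla k h x

end Kappa

end CobarHycom

theorem mainTheorem11 (k : Type u) [Field k] [CharZero k] :
    (∀ (n : ℕ) (x : (CobarHycom.Bar k).obj (Fin n)),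
        CobarHycom.zeta k n (CobarHycom.d k x) = CobarHycom.d k (CobarHycom.zeta k n x)) ∧
    (∀ (n : ℕ) (r : ℤ) (x : (CobarHycom.Bar k).obj (Fin n)),
        CobarHycom.HasDegree k r x → CobarHycom.HasDegree k (r - 2) (CobarHycom.zeta k n x)) ∧
    (∀ (n : ℕ) (x : (CobarHycom.Bar k).obj (Fin n)),
        CobarHycom.kappa k (CobarHycom.eps k (CobarHycom.d k x)) = 0) ∧
    ∀ n : ℕ, CobarHycom.d k (CobarHycom.nu k n) = 0 ∧
      CobarHycom.kappa k (CobarHycom.eps k (CobarHycom.nu k n)) =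
        CobarHycom.hycommGen k (A := Fin (n + 2)) (by simp) :=
  ⟨CobarHycom.zeta_d k, fun n _ _ h => h.zeta n, fun _ x => CobarHycom.kappa_eps_d k x,
    fun n => ⟨CobarHycom.d_nu k n, CobarHycom.kappa_eps_nu k n⟩⟩
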